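/- Let $\Sigma$ be a connected oriented punctured surface with Euler characteristic $-n<0$, with an ideal triangulation $T_0$ having $3n$ (labelled, oriented) edges. Let $T_0\to T_1\to\dots\to T_N$ be a sequence of 2--2 moves (flips), the $i$-th of which attaches an ideal tetrahedron to the surface triangulated by $T_{i-1}$, and let an orientation-preserving combinatorial isomorphism $T_0\cong T_N$ be given, along which the bottom and the top surface are glued. The result is a layered triangulation $\mathcal T_\varphi$ of the mapping torus $M_\varphi$ of the resulting homeomorphism $\varphi$ of $\Sigma$. Let $\alpha:\pi_1(M_\varphi)\to\mathbb Z$ be the class of the fibration $M_\varphi\to S^1$. Fix a sign cocycle $\sigma$ representing a boundary obstruction class, that is, a sign $\sigma^i_{jk}$ for every short edge of the truncated triangulation (near the vertex $i$ and parallel to the edge $[j,k]$) such that the product of the signs around every truncation triangle is $+1$; the choice $\sigma\equiv 1$ is allowed. A Ptolemy assignment $c$ on $\mathcal T_\varphi$ assigns a non-zero complex number to each oriented edge, with $c(-e)=-c(e)$ and, for every tetrahedron $[0,1,2,3]$ with oriented edges $e_{ij}=[i,j]$, $$c(e_{01})c(e_{23})-\frac{\sigma^2_{03}\sigma^3_{12}}{\sigma^1_{03}\sigma^0_{12}}\,c(e_{02})c(e_{13})+\frac{\sigma^3_{02}\sigma^2_{13}}{\sigma^1_{02}\sigma^0_{13}}\,c(e_{03})c(e_{12})=0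 .$$ It determines a representation $\rho_c:\pi_1(M_\varphi)\to SL_2(\mathbb C)$ (up to conjugation), by the cocycle on the truncated triangulation which assigns $\begin{pmatrix}0&-c^{-1}\\ c&0\end{pmatrix}$, with $c=c(e_{ij})$, to the long edge along $e_{ij}$, and $\begin{pmatrix}\sigma^i_{jk}&u\\0&\sigma^i_{jk}\end{pmatrix}$, with $u=-\sigma^j_{ik}\sigma^k_{ij}\,\dfrac{c(e_{jk})}{c(e_{ij})c(e_{ik})}$, to the short edge near $i$ from $[i,j]$ to $[i,k]$. Solving the Ptolemy equations of the tetrahedra one after the other expresses the Ptolemy variables $c'_1,\dots,c'_{3n}$ of the edges of the top surface as rational functions of the Ptolemy variables $c_1,\dots,c_{3n}$ of the edges of the bottom surface. Here $c'_i$ belongs to the edge of the top surface at the same position as (that is, identified with) the $i$-th edge of the bottom surface, so that Ptolemy assignments on $\mathcal T_\varphi$ correspond to solutions of $c'_i=c_i$ for $1\le i\le 3n$. Let $\tau_{3,\rho_c}(t)$ be the $\mathbb C^3$-torsion polynomial, that is, the twisted Alexander polynomial (in the sense of Wada) of $\pi_1(M_\varphi)$ associated to $\mathrm{Sym}^2(\rho_c)\otimes\alpha$,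 computed from presentations $\langle x_1,\dots,x_m,s\mid s x_i s^{-1}=w_i(x)\rangle$ of $\pi_1(M_\varphi)$, where $x_1,\dots,x_m$ is a free basis of $\ker\alpha=\pi_1(\Sigma)$ and $\alpha(s)=1$; it is well defined up to sign and multiplication by powers of $t$. **Theorem.** If $\rho_c$ is irreducible, then $c'_1,\dots,c'_{3n}$ are differentiable at $(c_1,\dots,c_{3n})$ and, up to sign and multiplication by a power of $t$, $$\tau_{3,\rho_c}(t)=\det\left(tI-\frac{\partial(c'_1,\dots,c'_{3n})}{\partial(c_1,\dots,c_{3n})}\right),$$ where the Jacobian matrix is evaluated at the Ptolemy variables $(c_1,\dots,c_{3n})$ of the bottom surface given by $c$. -/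

import Mathlib

open CategoryTheory
open scoped LaurentPolynomial MatrixGroups

/-! ### Ideal triangulations of punctured surfaces, and flips -/

/-- The oriented edges ("darts") of a surface triangulation with `3 * n` labelled and oriented
edges: `(e, true)` is the edge `e` with its chosen orientation, `(e, false)` is its reverse. -/
abbrev Dart (n : ℕ) : Type := Fin (3 * n) × Bool

/-- Reversal of an oriented edge. -/
def Dart.rev {n : ℕ} (d : Dart n) : Dart n := (d.1, !d.2)

/-- An ideal triangulation of a connected oriented punctured surface of Euler characteristic `-n`,
with `3 * n` edges and `2 * n` triangles.  Every oriented edge `d` lies on the boundary of exactly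
one triangle, the one on its left; `next d` is the oriented edge which follows `d` on the boundary
of this triangle.  So the triangles are the 3-cycles of `next`, and two triangles are glued along
`d` and `d.rev`.  The punctures are the vertices. -/
structure SurfaceTriangulation (n : ℕ) where
  next : Equiv.Perm (Dart n)
  next_next_next : ∀ d, next (next (next d)) = d
  next_ne : ∀ d, next d ≠ d
  connected : ∀ d d', Relation.ReflTransGen (fun x y => y = next x ∨ y = Dart.rev x) d d'

namespace SurfaceTriangulation

variable {n : ℕ} (T : SurfaceTriangulation n)

/-- The edge `e` is a side of the triangle to the left of `d`. -/
def Touches (e : Fin (3 * n)) (d : Dart n) : Prop :=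
  d.1 = e ∨ (T.next d).1 = e ∨ (T.next (T.next d)).1 = e

/-- `T'` is obtained from `T` by a flip (2-2 move) at the edge `e`.  For the two orientations `x`
of `e`, the triangles `(x, b, c)` and `(x.rev, d, e')` of `T` have to be distinct, and they are
replaced by the triangles `(c, d, x)` and `(e', b, x.rev)`: the oriented edge `x` of `T'` is the
new diagonal, which again carries the label `e`. -/
structure IsFlip (T T' : SurfaceTriangulation n) (e : Fin (3 * n)) : Prop where
  ne_next : ∀ x : Dart n, x.1 = e → x.rev ≠ T.next x
  ne_next_next : ∀ x : Dart n, x.1 = e → x.rev ≠ T.next (T.next x)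
  next_third : ∀ x : Dart n, x.1 = e → T'.next (T.next (T.next x)) = T.next x.rev
  next_rev : ∀ x : Dart n, x.1 = e → T'.next (T.next x.rev) = x
  next_self : ∀ x : Dart n, x.1 = e → T'.next x = T.next (T.next x)
  next_other : ∀ d : Dart n, ¬ T.Touches e d → T'.next d = T.next d

end SurfaceTriangulation

/-! ### Layered triangulations of mapping tori -/

/-- The combinatorial data of a layered triangulation of a mapping torus `M_φ`: a sequence of
flips `tri 0 → tri 1 → ... → tri N`, the `i`-th of which attaches the tetrahedron `Δ_i` to the
surface triangulated by `tri i`, and the orientation preserving combinatorial isomorphism `mono`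
along which the bottom surface `tri 0` is identified with the top surface `tri N`.  If every edge
is flipped eventually, then the tetrahedra `Δ_i` form an ideal triangulation of `M_φ`; this is not
required here. -/
structure LayeredTriangulation (n : ℕ) where
  N : ℕ
  tri : Fin (N + 1) → SurfaceTriangulation n
  flipAt : Fin N → Fin (3 * n)
  isFlip : ∀ i : Fin N, (tri i.castSucc).IsFlip (tri i.succ) (flipAt i)
  mono : Equiv.Perm (Dart n)
  mono_rev : ∀ d, mono d.rev = (mono d).rev
  mono_next : ∀ d, (tri (Fin.last N)).next (mono d) = mono ((tri 0).next d)

/-- The cocycle which represents a boundary obstruction class.  The short edges of the truncated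
triangulation are the corners of the triangles of the surfaces `tri i`; `sign i d` is the sign of
the short edge at the head of `d` in the triangle to the left of `d`.  Corners of a triangle which
persists from `tri i` to `tri (i + 1)` are the same short edge.  The conditions `sign_third` and
`sign_next` say that for each of the four triangular faces of the `i`-th truncated tetrahedron
the product of the three signs on its boundary is `1`. -/
structure BoundarySign {n : ℕ} (L : LayeredTriangulation n) where
  sign : Fin (L.N + 1) → Dart n → ℤˣ
  sign_other : ∀ (i : Fin L.N) (d : Dart n), ¬ (L.tri i.castSucc).Touches (L.flipAt i) d →
    sign i.succ d = sign i.castSucc d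
  sign_third : ∀ (i : Fin L.N) (x : Dart n), x.1 = L.flipAt i →
    sign i.succ ((L.tri i.castSucc).next ((L.tri i.castSucc).next x)) =
      sign i.castSucc ((L.tri i.castSucc).next ((L.tri i.castSucc).next x)) *
        sign i.castSucc x.rev
  sign_next : ∀ (i : Fin L.N) (x : Dart n), x.1 = L.flipAt i →
    sign i.castSucc ((L.tri i.castSucc).next x) =
      sign i.succ ((L.tri i.castSucc).next x) * sign i.succ x
  sign_mono : ∀ d : Dart n, sign (Fin.last L.N) (L.mono d) = sign 0 d

/-- The trivial cocycle: with it, all equations below are the ones without signs. -/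
def BoundarySign.trivial {n : ℕ} (L : LayeredTriangulation n) : BoundarySign L where
  sign _ _ := 1
  sign_other _ _ _ := rfl
  sign_third _ _ _ := rfl
  sign_next _ _ _ := rfl
  sign_mono _ := rfl

/-! ### Ptolemy assignments -/

/-- The extension of a function on edges to oriented edges by `c (-e) = - c e`. -/
def onDart {n : ℕ} (c : Fin (3 * n) → ℂ) (d : Dart n) : ℂ := if d.2 then c d.1 else - c d.1

/-- A sign as a complex number. -/
def sgn (ε : ℤˣ) : ℂ := ((ε : ℤ) : ℂ)

/-- For a flip at `e`, with `x` an orientation of `e` and triangles `(x, b, c)`, `(x.rev, d, e')`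
as in `IsFlip`, this is the part `- ± c_{02} c_{13} ± c_{03} c_{12}` of the Ptolemy equation of the
attached tetrahedron `[0, 1, 2, 3]`, where `x = [0, 1]`, `b = [1, 2]`, `c = [2, 0]`,
`x.rev = [1, 0]`, `d = [0, 3]`, `e' = [3, 1]`, and the new diagonal is `x.rev = [2, 3]`.
Here `s` and `s'` are the signs of the corners on the bottom and on the top surface. -/
def ptolemyRest {n : ℕ} (T : SurfaceTriangulation n) (s s' : Dart n → ℤˣ)
    (z : Fin (3 * n) → ℂ) (x : Dart n) : ℂ :=
  - sgn (s' x * s' x.rev * s (T.next (T.next x.rev)) * s (T.next (T.next x))) *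
      (onDart z (T.next (T.next x)) * onDart z (T.next (T.next x.rev))) +
    sgn (s' (T.next x.rev) * s' (T.next x) * s x * s x.rev) *
      (onDart z (T.next x.rev) * onDart z (T.next x))

/-- A (sign-deformed) Ptolemy assignment on a layered triangulation: a non-zero complex number for
each edge of each surface `tri i`, which agree on edges that are identified in the layered
triangulation, with the Ptolemy equation for each tetrahedron. -/
structure PtolemyAssignment {n : ℕ} (L : LayeredTriangulation n) (σ : BoundarySign L) where
  val : Fin (L.N + 1) → Fin (3 * n) → ℂ
  ne_zero : ∀ i e, val i e ≠ 0
  val_other : ∀ (i : Fin L.N) (e : Fin (3 * n)), e ≠ L.flipAt i → val i.succ e = val i.castSucc e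
  ptolemy : ∀ (i : Fin L.N) (x : Dart n), x.1 = L.flipAt i →
    onDart (val i.castSucc) x * onDart (val i.succ) x.rev +
      ptolemyRest (L.tri i.castSucc) (σ.sign i.castSucc) (σ.sign i.succ) (val i.castSucc) x = 0
  val_mono : ∀ d : Dart n, onDart (val (Fin.last L.N)) (L.mono d) = onDart (val 0) d

/-- The Ptolemy variables after a flip at `e`, as functions of those before the flip: the Ptolemy
equation is solved for the variable of the new edge. -/
noncomputable def flipVars {n : ℕ} (T : SurfaceTriangulation n) (s s' : Dart n → ℤˣ)
    (e : Fin (3 * n)) (z : Fin (3 * n) → ℂ) : Fin (3 * n) → ℂ :=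
  Function.update z e (ptolemyRest T s s' z (e, true) / z e)

/-- The Ptolemy variables of the surface `tri i` as functions of those of `tri 0`. -/
noncomputable def levelVars {n : ℕ} (L : LayeredTriangulation n) (σ : BoundarySign L)
    (i : Fin (L.N + 1)) : (Fin (3 * n) → ℂ) → (Fin (3 * n) → ℂ) :=
  Fin.induction (motive := fun _ => (Fin (3 * n) → ℂ) → (Fin (3 * n) → ℂ)) id
    (fun j f z => flipVars (L.tri j.castSucc) (σ.sign j.castSucc) (σ.sign j.succ) (L.flipAt j)
      (f z)) i

/-- The functions `c'_i` of `c_1, ..., c_{3n}`: the Ptolemy variable on the top surface of the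
edge at the same position as (i.e. identified by `mono` with) the `i`-th edge of the bottom
surface. -/
noncomputable def topVars {n : ℕ} (L : LayeredTriangulation n) (σ : BoundarySign L)
    (z : Fin (3 * n) → ℂ) (i : Fin (3 * n)) : ℂ :=
  onDart (levelVars L σ (Fin.last L.N) z) (L.mono (i, true))

/-- The Jacobian matrix `∂(c'_1, ..., c'_{3n}) / ∂(c_1, ..., c_{3n})` at `z`. -/
noncomputable def topJacobian {n : ℕ} (L : LayeredTriangulation n) (σ : BoundarySign L)
    (z : Fin (3 * n) → ℂ) : Matrix (Fin (3 * n)) (Fin (3 * n)) ℂ :=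
  LinearMap.toMatrix' (fderiv ℂ (topVars L σ) z : (Fin (3 * n) → ℂ) →ₗ[ℂ] (Fin (3 * n) → ℂ))

/-! ### The fundamental group of the mapping torus

It is presented by the fundamental groupoid of the 2-skeleton of a cell structure of `M_φ` which
refines the truncated triangulation: the truncated surfaces `tri i` are kept apart, and vertical
edges join the copies of the same vertex on consecutive surfaces. -/

/-- `⟨i, d⟩` is the vertex near the tail of the oriented edge `d` of the truncated `tri i`. -/
structure TVertex {n : ℕ} (L : LayeredTriangulation n) : Type where
  level : Fin (L.N + 1)
  dart : Dart n

/-- The edges of the cell structure. -/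
inductive TEdge {n : ℕ} (L : LayeredTriangulation n) : TVertex L → TVertex L → Type
  /-- The long edge along `d`, where `d' = d.rev`. -/
  | long (i : Fin (L.N + 1)) (d d' : Dart n) (h : d.rev = d') : TEdge L ⟨i, d⟩ ⟨i, d'⟩
  /-- The short edge at the head of `d` in the triangle to the left of `d`, from the end of the
  side `d` (where `r = d.rev`) to the beginning of the next side `d'`. -/
  | short (i : Fin (L.N + 1)) (d r d' : Dart n) (hr : d.rev = r) (h : (L.tri i).next d = d') :
      TEdge L ⟨i, r⟩ ⟨i, d'⟩
  /-- The vertical edge from `tri i` to `tri (i + 1)` at an edge which is not flipped. -/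
  | up (i : Fin L.N) (d : Dart n) (h : d.1 ≠ L.flipAt i) : TEdge L ⟨i.castSucc, d⟩ ⟨i.succ, d⟩
  /-- The vertical edge from the top surface to the bottom surface. -/
  | close (d d' : Dart n) (h : L.mono d = d') : TEdge L ⟨Fin.last L.N, d'⟩ ⟨0, d⟩

instance {n : ℕ} (L : LayeredTriangulation n) : Quiver (TVertex L) := ⟨TEdge L⟩

/-- An edge of the cell structure as a generator of the free groupoid. -/
def TEdge.gen {n : ℕ} {L : LayeredTriangulation n} {x y : TVertex L} (f : TEdge L x y) :
    (Quiver.FreeGroupoid.of (TVertex L)).obj x ⟶ (Quiver.FreeGroupoid.of (TVertex L)).obj y :=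
  (Quiver.FreeGroupoid.of (TVertex L)).map f

/-- The 2-cells of the cell structure. -/
inductive TRel {n : ℕ} (L : LayeredTriangulation n) :
    HomRel (Quiver.FreeGroupoid (TVertex L))
  /-- The two orientations of a long edge. -/
  | long (i : Fin (L.N + 1)) (d d' : Dart n) (h : d.rev = d') (h' : d'.rev = d) :
      TRel L ((TEdge.long i d d' h).gen ≫ (TEdge.long i d' d h').gen) (𝟙 _)
  /-- The hexagons. -/
  | hexagon (i : Fin (L.N + 1)) (d₁ d₂ d₃ r₁ r₂ r₃ : Dart n)
      (h₁ : d₁.rev = r₁) (h₂ : d₂.rev = r₂) (h₃ : d₃.rev = r₃)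
      (k₁ : (L.tri i).next d₁ = d₂) (k₂ : (L.tri i).next d₂ = d₃) (k₃ : (L.tri i).next d₃ = d₁) :
      TRel L ((TEdge.long i d₁ r₁ h₁).gen ≫ (TEdge.short i d₁ r₁ d₂ h₁ k₁).gen ≫
        (TEdge.long i d₂ r₂ h₂).gen ≫ (TEdge.short i d₂ r₂ d₃ h₂ k₂).gen ≫
        (TEdge.long i d₃ r₃ h₃).gen ≫ (TEdge.short i d₃ r₃ d₁ h₃ k₃).gen) (𝟙 _)
  /-- The square above a long edge which is not flipped. -/
  | upLong (i : Fin L.N) (d r : Dart n) (h : d.rev = r)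
      (hd : d.1 ≠ L.flipAt i) (hr : r.1 ≠ L.flipAt i) :
      TRel L ((TEdge.up i d hd).gen ≫ (TEdge.long i.succ d r h).gen)
        ((TEdge.long i.castSucc d r h).gen ≫ (TEdge.up i r hr).gen)
  /-- The square above a short edge which belongs to both `tri i` and `tri (i + 1)`. -/
  | upShort (i : Fin L.N) (d r d' : Dart n) (h : d.rev = r)
      (k : (L.tri i.castSucc).next d = d') (k' : (L.tri i.succ).next d = d')
      (hr : r.1 ≠ L.flipAt i) (hd' : d'.1 ≠ L.flipAt i)
      (ht : ¬ (L.tri i.castSucc).Touches (L.flipAt i) d) :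
      TRel L ((TEdge.up i r hr).gen ≫ (TEdge.short i.succ d r d' h k').gen)
        ((TEdge.short i.castSucc d r d' h k).gen ≫ (TEdge.up i d' hd').gen)
  /-- The triangular face of the `i`-th truncated tetrahedron at an end of its bottom edge `x`:
  two short edges on the bottom, one on the top. -/
  | below (i : Fin L.N) (x y c r d : Dart n) (hx : x.1 = L.flipAt i) (hy : y.rev = x)
      (h : c.rev = r) (k : (L.tri i.castSucc).next c = x) (l : (L.tri i.castSucc).next y = d)
      (k' : (L.tri i.succ).next c = d) (hr : r.1 ≠ L.flipAt i) (hd : d.1 ≠ L.flipAt i) :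
      TRel L ((TEdge.short i.castSucc c r x h k).gen ≫ (TEdge.short i.castSucc y x d hy l).gen ≫
          (TEdge.up i d hd).gen)
        ((TEdge.up i r hr).gen ≫ (TEdge.short i.succ c r d h k').gen)
  /-- The triangular face of the `i`-th truncated tetrahedron at an end of its top edge `x`:
  two short edges on the top, one on the bottom. -/
  | above (i : Fin L.N) (x y c r d : Dart n) (hx : x.1 = L.flipAt i) (hy : y.rev = x)
      (h : c.rev = r) (k : (L.tri i.succ).next c = x) (l : (L.tri i.succ).next y = d)
      (k' : (L.tri i.castSucc).next c = d) (hr : r.1 ≠ L.flipAt i) (hd : d.1 ≠ L.flipAt i) :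
      TRel L ((TEdge.up i r hr).gen ≫ (TEdge.short i.succ c r x h k).gen ≫
          (TEdge.short i.succ y x d hy l).gen)
        ((TEdge.short i.castSucc c r d h k').gen ≫ (TEdge.up i d hd).gen)
  /-- The square between a long edge on the top and the corresponding one on the bottom. -/
  | closeLong (d r e s : Dart n) (h : d.rev = r) (he : L.mono d = e) (hs : L.mono r = s)
      (h' : e.rev = s) :
      TRel L ((TEdge.close d e he).gen ≫ (TEdge.long 0 d r h).gen)
        ((TEdge.long (Fin.last L.N) e s h').gen ≫ (TEdge.close r s hs).gen)
  /-- The square between a short edge on the top and the corresponding one on the bottom. -/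
  | closeShort (d r d' e s e' : Dart n) (h : d.rev = r) (k : (L.tri 0).next d = d')
      (he : L.mono d = e) (hs : L.mono r = s) (he' : L.mono d' = e')
      (h' : e.rev = s) (k' : (L.tri (Fin.last L.N)).next e = e') :
      TRel L ((TEdge.close r s hs).gen ≫ (TEdge.short 0 d r d' h k).gen)
        ((TEdge.short (Fin.last L.N) e s e' h' k').gen ≫ (TEdge.close d' e' he').gen)

/-- The fundamental groupoid of `M_φ`. -/
abbrev TGroupoid {n : ℕ} (L : LayeredTriangulation n) : Type := CategoryTheory.Quotient (TRel L)

/-- The base point given by an oriented edge of the bottom surface. -/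
def TGroupoid.base {n : ℕ} (L : LayeredTriangulation n) (d₀ : Dart n) : TGroupoid L :=
  ⟨(Quiver.FreeGroupoid.of (TVertex L)).obj ⟨0, d₀⟩⟩

/-- The fundamental group of `M_φ`; the product is the concatenation of paths. -/
abbrev TGroup {n : ℕ} (L : LayeredTriangulation n) (d₀ : Dart n) : Type :=
  TGroupoid.base L d₀ ⟶ TGroupoid.base L d₀

/-- Labels in a group `H` on the edges, as a functor on the free groupoid; a path is sent to the
product of its labels, from left to right. -/
def TEdge.labelFunctor {n : ℕ} {L : LayeredTriangulation n} {H : Type} [Group H]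
    (w : ∀ {x y : TVertex L}, TEdge L x y → H) :
    Quiver.FreeGroupoid (TVertex L) ⥤ SingleObj Hᵐᵒᵖ :=
  Quiver.FreeGroupoid.lift
    { obj := fun _ => SingleObj.star _
      map := fun {_ _} f => (MulOpposite.op (w f) : Hᵐᵒᵖ) }

theorem TEdge.labelFunctor_gen {n : ℕ} {L : LayeredTriangulation n} {H : Type} [Group H]
    (w : ∀ {x y : TVertex L}, TEdge L x y → H) {x y : TVertex L} (f : TEdge L x y) :
    (TEdge.labelFunctor w).map f.gen = (MulOpposite.op (w f) : Hᵐᵒᵖ) := by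
  have h := Quiver.FreeGroupoid.lift_spec
    ({ obj := fun _ => SingleObj.star _
       map := fun {_ _} f => (MulOpposite.op (w f) : Hᵐᵒᵖ) } : TVertex L ⥤q SingleObj Hᵐᵒᵖ)
  have := Prefunctor.congr_hom h f
  simpa using! this

/-- Labels in a group `H` which are compatible with the 2-cells induce a homomorphism from the
fundamental group to `H`. -/
def TGroup.hom {n : ℕ} {L : LayeredTriangulation n} {H : Type} [Group H]
    (w : ∀ {x y : TVertex L}, TEdge L x y → H)
    (hw : ∀ (x y : Quiver.FreeGroupoid (TVertex L)) (f g : x ⟶ y), TRel L f g →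
      (TEdge.labelFunctor w).map f = (TEdge.labelFunctor w).map g) (d₀ : Dart n) :
    TGroup L d₀ →* H where
  toFun γ := MulOpposite.unop
    (show Hᵐᵒᵖ from (CategoryTheory.Quotient.lift (TRel L) (TEdge.labelFunctor w) hw).map γ)
  map_one' := by
    have := (CategoryTheory.Quotient.lift (TRel L) (TEdge.labelFunctor w) hw).map_id
      (TGroupoid.base L d₀)
    exact congrArg MulOpposite.unop this
  map_mul' γ δ := by
    have := (CategoryTheory.Quotient.lift (TRel L) (TEdge.labelFunctor w) hw).map_comp γ δ
    exact congrArg MulOpposite.unop this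

/-- The labels of the class `α`: crossing from the top surface to the bottom surface counts `1`. -/
def TEdge.height {n : ℕ} {L : LayeredTriangulation n} {x y : TVertex L} :
    TEdge L x y → Multiplicative ℤ
  | .long _ _ _ _ => 1
  | .short _ _ _ _ _ _ => 1
  | .up _ _ _ => 1
  | .close _ _ _ => Multiplicative.ofAdd 1

theorem TEdge.height_rel {n : ℕ} {L : LayeredTriangulation n}
    (x y : Quiver.FreeGroupoid (TVertex L)) (f g : x ⟶ y) (h : TRel L f g) :
    (TEdge.labelFunctor (H := Multiplicative ℤ) TEdge.height).map f =
      (TEdge.labelFunctor (H := Multiplicative ℤ) TEdge.height).map g := by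
  cases h <;> rfl

/-- The class `α : π₁(M_φ) → ℤ` of the fibration. -/
def TGroup.alpha {n : ℕ} (L : LayeredTriangulation n) (d₀ : Dart n) :
    TGroup L d₀ →* Multiplicative ℤ :=
  TGroup.hom TEdge.height TEdge.height_rel d₀

/-! ### The representation of a Ptolemy assignment -/

theorem sgn_sq (ε : ℤˣ) : sgn ε * sgn ε = 1 := by
  rcases Int.units_eq_one_or ε with h | h <;> simp [sgn, h]

theorem sgn_mul (ε ε' : ℤˣ) : sgn (ε * ε') = sgn ε * sgn ε' := by
  simp [sgn]

/-- The matrix of a long edge with Ptolemy variable `z`. -/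
noncomputable def longMatrix (z : ℂ) (hz : z ≠ 0) : SL(2, ℂ) :=
  ⟨!![0, -z⁻¹; z, 0], by simp [Matrix.det_fin_two_of, hz]⟩

/-- The matrix of a short edge with sign `ε`. -/
noncomputable def shortMatrix (ε : ℤˣ) (u : ℂ) : SL(2, ℂ) :=
  ⟨!![sgn ε, u; 0, sgn ε], by simp [Matrix.det_fin_two_of, sgn_sq]⟩

theorem longMatrix_coe (z : ℂ) (hz : z ≠ 0) :
    (longMatrix z hz : Matrix (Fin 2) (Fin 2) ℂ) = !![0, -z⁻¹; z, 0] := rfl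

theorem shortMatrix_coe (ε : ℤˣ) (u : ℂ) :
    (shortMatrix ε u : Matrix (Fin 2) (Fin 2) ℂ) = !![sgn ε, u; 0, sgn ε] := rfl

theorem onDart_rev {n : ℕ} (z : Fin (3 * n) → ℂ) (d : Dart n) :
    onDart z d.rev = - onDart z d := by
  rcases d with ⟨e, _ | _⟩ <;> simp [onDart, Dart.rev]

theorem Dart.rev_rev {n : ℕ} (d : Dart n) : d.rev.rev = d := by
  simp [Dart.rev]

theorem onDart_ne_zero {n : ℕ} {z : Fin (3 * n) → ℂ} (hz : ∀ e, z e ≠ 0) (d : Dart n) :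
    onDart z d ≠ 0 := by
  rcases d with ⟨e, _ | _⟩ <;> simp [onDart, hz]

theorem onDart_congr {n : ℕ} {z z' : Fin (3 * n) → ℂ} {d : Dart n} (h : z d.1 = z' d.1) :
    onDart z d = onDart z' d := by
  simp [onDart, h]

/-- The off-diagonal entry of the matrix of the short edge at the head of `d` in the triangle
`(d, d', d'')` to the left of `d`. -/
noncomputable def shortEntry {n : ℕ} (T : SurfaceTriangulation n) (s : Dart n → ℤˣ)
    (z : Fin (3 * n) → ℂ) (d : Dart n) : ℂ :=
  - sgn (s (T.next d) * s (T.next (T.next d))) *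
    (onDart z (T.next (T.next d)) / (onDart z d * onDart z (T.next d)))

namespace PtolemyAssignment

variable {n : ℕ} {L : LayeredTriangulation n} {σ : BoundarySign L} (c : PtolemyAssignment L σ)

/-- The `SL(2, ℂ)`-labels of the edges given by a Ptolemy assignment. -/
noncomputable def label {x y : TVertex L} : TEdge L x y → SL(2, ℂ)
  | .long i d _ _ => longMatrix (onDart (c.val i) d) (onDart_ne_zero (c.ne_zero i) d)
  | .short i d _ _ _ _ => shortMatrix (σ.sign i d) (shortEntry (L.tri i) (σ.sign i) (c.val i) d)
  | .up _ _ _ => 1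
  | .close _ _ _ => 1

theorem touches_next {T : SurfaceTriangulation n} {e : Fin (3 * n)} {d : Dart n}
    (h : ¬ T.Touches e d) : ¬ T.Touches e (T.next d) := by
  unfold SurfaceTriangulation.Touches at *
  rw [T.next_next_next]
  tauto

theorem longMatrix_congr {z z' : ℂ} (h : z = z') (hz : z ≠ 0) (hz' : z' ≠ 0) :
    longMatrix z hz = longMatrix z' hz' := by subst h; rfl

theorem label_long_mul (z : ℂ) (hz : z ≠ 0) (hz' : -z ≠ 0) :
    longMatrix z hz * longMatrix (-z) hz' = 1 := by
  apply Subtype.ext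
  rw [Matrix.SpecialLinearGroup.coe_mul, longMatrix_coe, longMatrix_coe, Matrix.mul_fin_two,
    Matrix.SpecialLinearGroup.coe_one, Matrix.one_fin_two]
  simp [hz]

theorem shortMatrix_mul (ε ε' : ℤˣ) (u u' : ℂ) :
    shortMatrix ε u * shortMatrix ε' u' = shortMatrix (ε * ε') (sgn ε * u' + u * sgn ε') := by
  apply Subtype.ext
  rw [Matrix.SpecialLinearGroup.coe_mul, shortMatrix_coe, shortMatrix_coe, shortMatrix_coe,
    Matrix.mul_fin_two, sgn_mul]
  simp

theorem hexagon_eq (x y z : ℂ) (hx : x ≠ 0) (hy : y ≠ 0) (hz : z ≠ 0) (a b c : ℤˣ) :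
    longMatrix x hx * (shortMatrix a (- sgn (b * c) * (z / (x * y))) *
      (longMatrix y hy * (shortMatrix b (- sgn (c * a) * (x / (y * z))) *
      (longMatrix z hz * shortMatrix c (- sgn (a * b) * (y / (z * x))))))) = 1 := by
  have ha := sgn_sq a
  have hb := sgn_sq b
  have hc := sgn_sq c
  apply Subtype.ext
  simp only [Matrix.SpecialLinearGroup.coe_mul, longMatrix_coe, shortMatrix_coe,
    Matrix.mul_fin_two, Matrix.SpecialLinearGroup.coe_one, Matrix.one_fin_two, sgn_mul]
  generalize sgn a = a at *
  generalize sgn b = b at *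
  generalize sgn c = c at *
  have hx2 : x * x⁻¹ = 1 := mul_inv_cancel₀ hx
  have hy2 : y * y⁻¹ = 1 := mul_inv_cancel₀ hy
  have hz2 : z * z⁻¹ = 1 := mul_inv_cancel₀ hz
  have e : ∀ p q r s p' q' r' s' : ℂ, p = p' → q = q' → r = r' → s = s' →
    !![p, q; r, s] = !![p', q'; r', s'] := by rintro _ _ _ _ _ _ _ _ rfl rfl rfl rfl; rfl
  apply e <;> field_simp
  all_goals grind

theorem shortMatrix_congr {ε ε' : ℤˣ} {u u' : ℂ} (h : ε = ε') (h' : u = u') :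
    shortMatrix ε u = shortMatrix ε' u' := by rw [h, h']

theorem dart_eq_or {x y : Dart n} (h : y.1 = x.1) : y = x ∨ y = x.rev := by
  rcases x with ⟨e, _ | _⟩ <;> rcases y with ⟨e', _ | _⟩ <;> simp_all [Dart.rev]

theorem next_next_ne {T T' : SurfaceTriangulation n} {e : Fin (3 * n)} (h : T.IsFlip T' e)
    {x : Dart n} (hx : x.1 = e) : (T.next (T.next x)).1 ≠ e := by
  intro h1
  rcases dart_eq_or (h1.trans hx.symm) with h2 | h2
  · have := T.next_next_next x
    rw [h2] at this
    exact T.next_ne x this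
  · exact h.ne_next_next x hx h2.symm

theorem next_ne_edge {T T' : SurfaceTriangulation n} {e : Fin (3 * n)} (h : T.IsFlip T' e)
    {x : Dart n} (hx : x.1 = e) : (T.next x).1 ≠ e := by
  intro h1
  rcases dart_eq_or (h1.trans hx.symm) with h2 | h2
  · exact T.next_ne x h2
  · exact h.ne_next x hx h2.symm

theorem below_alg {X X' p d e b S Y S' Y' D B E P : ℂ} (hX : X ≠ 0) (hp : p ≠ 0) (hd : d ≠ 0)
    (hS : S' * S' = 1) (hD : D * D = 1)
    (h : X * -X' + (-(S' * Y' * E * P) * (p * e) + D * B * S * Y * (d * b)) = 0) :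
    P * (-(D * Y' * E) * (e / (-X * d))) + -(S * (B * S')) * (b / (p * X)) * Y =
      -(D * S') * (X' / (p * d)) := by
  field_simp
  linear_combination -D * S' * h - D * P * Y' * E * e * p * hS + B * S' * S * Y * d * b * hD

theorem above_alg {X X' p e c b S Y S' Y' B E P C : ℂ} (hX : X' ≠ 0) (hp : p ≠ 0) (he : e ≠ 0)
    (hY : Y * Y = 1) (hE : E * E = 1)
    (h : X * -X' + (-(S' * Y' * E * C) * (c * e) + P * B * S * Y * (p * b)) = 0) :
    P * (-(E * S * B) * (b / (-X' * e))) + -(S' * (C * Y)) * (c / (p * X')) * Y' =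
      -(E * Y) * (-X / (p * e)) := by
  field_simp
  linear_combination E * Y * h + S' * Y' * C * Y * c * e * hE - P * B * S * E * p * b * hY

/-- The relation of the labels at an end of the bottom edge of a tetrahedron. -/
theorem below_eq (i : Fin L.N) (x : Dart n) (hx : x.1 = L.flipAt i) (p : Dart n)
    (hp : (L.tri i.castSucc).next p = x) :
    shortMatrix (σ.sign i.castSucc p)
        (shortEntry (L.tri i.castSucc) (σ.sign i.castSucc) (c.val i.castSucc) p) *
      shortMatrix (σ.sign i.castSucc x.rev)
        (shortEntry (L.tri i.castSucc) (σ.sign i.castSucc) (c.val i.castSucc) x.rev) =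
    shortMatrix (σ.sign i.succ p)
        (shortEntry (L.tri i.succ) (σ.sign i.succ) (c.val i.succ) p) := by
  have hF := L.isFlip i
  have hx' : x.rev.1 = L.flipAt i := hx
  have e1 : p = (L.tri i.castSucc).next ((L.tri i.castSucc).next x) := by
    rw [← hp, (L.tri i.castSucc).next_next_next]
  have t1 := onDart_congr (d := p) (c.val_other i p.1 (by rw [e1]; exact next_next_ne hF hx))
  have t2 := onDart_congr (d := (L.tri i.castSucc).next x.rev)
    (c.val_other i _ (next_ne_edge hF hx'))
  have s1 := σ.sign_third i x hx
  have s2 := σ.sign_next i x hx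
  have s3 := σ.sign_next i x.rev hx'
  have n1 := hF.next_third x hx
  have n2 := hF.next_rev x hx
  have P := c.ptolemy i x hx
  have z1 := onDart_ne_zero (c.ne_zero i.castSucc) x
  have z2 := onDart_ne_zero (c.ne_zero i.castSucc) p
  have z3 := onDart_ne_zero (c.ne_zero i.castSucc) ((L.tri i.castSucc).next x.rev)
  rw [← e1] at s1 n1
  rw [shortMatrix_mul]
  refine shortMatrix_congr s1.symm ?_
  simp only [shortEntry, ptolemyRest, hp, n1, n2, t1, t2, onDart_rev, ← e1, s2, s3, sgn_mul] at P ⊢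
  exact below_alg z1 z2 z3 (sgn_sq _) (sgn_sq _) P

/-- The relation of the labels at an end of the top edge of a tetrahedron. -/
theorem above_eq (i : Fin L.N) (x : Dart n) (hx : x.1 = L.flipAt i) (p : Dart n)
    (hp : (L.tri i.succ).next p = x) :
    shortMatrix (σ.sign i.succ p)
        (shortEntry (L.tri i.succ) (σ.sign i.succ) (c.val i.succ) p) *
      shortMatrix (σ.sign i.succ x.rev)
        (shortEntry (L.tri i.succ) (σ.sign i.succ) (c.val i.succ) x.rev) =
    shortMatrix (σ.sign i.castSucc p)
        (shortEntry (L.tri i.castSucc) (σ.sign i.castSucc) (c.val i.castSucc) p) := by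
  have hF := L.isFlip i
  have hx' : x.rev.1 = L.flipAt i := hx
  have e1 : p = (L.tri i.castSucc).next x.rev := by
    apply (L.tri i.succ).next.injective
    rw [hp, hF.next_rev x hx]
  have e2 := (L.tri i.castSucc).next_next_next x.rev
  rw [← e1] at e2
  have t1 := onDart_congr (d := p) (c.val_other i p.1 (by rw [e1]; exact next_ne_edge hF hx'))
  have t2 := onDart_congr (d := (L.tri i.castSucc).next p)
    (c.val_other i _ (by rw [e1]; exact next_next_ne hF hx'))
  have t3 := onDart_congr (d := (L.tri i.castSucc).next ((L.tri i.castSucc).next x))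
    (c.val_other i _ (next_next_ne hF hx))
  have t4 := onDart_congr (d := (L.tri i.castSucc).next x) (c.val_other i _ (next_ne_edge hF hx))
  have s1 := σ.sign_third i x hx
  have s2 := σ.sign_next i x.rev hx'
  have s3 := σ.sign_third i x.rev hx'
  have n1 := hF.next_self x hx
  have n2 := hF.next_self x.rev hx'
  have n3 := hF.next_third x.rev hx'
  have P := c.ptolemy i x hx
  have z1 := onDart_ne_zero (c.ne_zero i.castSucc) x
  have z2 := onDart_ne_zero (c.ne_zero i.castSucc) p
  have z3 := onDart_ne_zero (c.ne_zero i.castSucc) ((L.tri i.castSucc).next p)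
  have z4 := onDart_ne_zero (c.ne_zero i.succ) x
  rw [← e1] at s2 n2 s3 n3
  rw [Dart.rev_rev] at s3 n3
  rw [shortMatrix_mul]
  refine shortMatrix_congr s2.symm ?_
  simp only [shortEntry, ptolemyRest, hp, n1, n2, n3, e2, t1, t2, t3, t4, onDart_rev, ← e1,
    s1, s3, sgn_mul] at P ⊢
  exact above_alg z4 z2 z3 (sgn_sq _) (sgn_sq _) P

theorem label_rel (x y : Quiver.FreeGroupoid (TVertex L)) (f g : x ⟶ y) (h : TRel L f g) :
    (TEdge.labelFunctor (H := SL(2, ℂ)) c.label).map f =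
      (TEdge.labelFunctor (H := SL(2, ℂ)) c.label).map g := by
  cases h with
  | long i d d' h h' =>
    rw [Functor.map_comp, CategoryTheory.Functor.map_id, TEdge.labelFunctor_gen, TEdge.labelFunctor_gen]
    subst h
    refine congrArg MulOpposite.op ?_
    exact (congrArg (longMatrix _ (onDart_ne_zero (c.ne_zero i) d) * ·)
      (longMatrix_congr (onDart_rev (c.val i) d) (onDart_ne_zero (c.ne_zero i) d.rev)
        (neg_ne_zero.2 (onDart_ne_zero (c.ne_zero i) d)))).trans (label_long_mul _ _ _)
  | hexagon i d₁ d₂ d₃ r₁ r₂ r₃ h₁ h₂ h₃ k₁ k₂ k₃ =>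
    simp only [Functor.map_comp, CategoryTheory.Functor.map_id]
    rw [TEdge.labelFunctor_gen, TEdge.labelFunctor_gen, TEdge.labelFunctor_gen,
      TEdge.labelFunctor_gen, TEdge.labelFunctor_gen, TEdge.labelFunctor_gen]
    refine congrArg MulOpposite.op ?_
    change longMatrix _ (onDart_ne_zero (c.ne_zero i) d₁) * (shortMatrix _ _ *
      (longMatrix _ (onDart_ne_zero (c.ne_zero i) d₂) * (shortMatrix _ _ *
      (longMatrix _ (onDart_ne_zero (c.ne_zero i) d₃) * shortMatrix _ _)))) = 1
    simp only [shortEntry, k₁, k₂, k₃]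
    exact hexagon_eq _ _ _ _ _ _ _ _ _
  | upLong i d r h hd hr =>
    rw [Functor.map_comp, Functor.map_comp, TEdge.labelFunctor_gen, TEdge.labelFunctor_gen,
      TEdge.labelFunctor_gen, TEdge.labelFunctor_gen]
    refine congrArg MulOpposite.op ?_
    refine (one_mul _).trans (Eq.trans ?_ (mul_one _).symm)
    exact longMatrix_congr (onDart_congr (c.val_other i _ hd))
      (onDart_ne_zero (c.ne_zero _) _) (onDart_ne_zero (c.ne_zero _) _)
  | upShort i d r d' h k k' hr hd' ht =>
    rw [Functor.map_comp, Functor.map_comp, TEdge.labelFunctor_gen, TEdge.labelFunctor_gen,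
      TEdge.labelFunctor_gen, TEdge.labelFunctor_gen]
    refine congrArg MulOpposite.op ?_
    change 1 * shortMatrix _ _ = shortMatrix _ _ * 1
    rw [one_mul, mul_one]
    have ht1 := touches_next ht
    have ht2 := touches_next ht1
    have hn := (L.isFlip i).next_other
    have key : ∀ q, ¬ (L.tri i.castSucc).Touches (L.flipAt i) q →
        onDart (c.val i.succ) q = onDart (c.val i.castSucc) q := fun q hq =>
      onDart_congr (c.val_other i _ fun h => hq (Or.inl h))
    simp only [shortEntry, hn _ ht, hn _ ht1, key _ ht, key _ ht1, key _ ht2,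
      σ.sign_other i _ ht, σ.sign_other i _ ht1, σ.sign_other i _ ht2]
  | below i x y p r d hx hy h k l k' hr hd =>
    simp only [Functor.map_comp]
    rw [TEdge.labelFunctor_gen, TEdge.labelFunctor_gen,
      TEdge.labelFunctor_gen, TEdge.labelFunctor_gen, TEdge.labelFunctor_gen]
    refine congrArg MulOpposite.op ?_
    change shortMatrix _ _ * (shortMatrix _ _ * 1) = 1 * shortMatrix _ _
    rw [one_mul, mul_one]
    have : y = x.rev := by rw [← hy, Dart.rev_rev]
    subst this
    exact c.below_eq i x hx p k
  | above i x y p r d hx hy h k l k' hr hd =>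
    simp only [Functor.map_comp]
    rw [TEdge.labelFunctor_gen, TEdge.labelFunctor_gen,
      TEdge.labelFunctor_gen, TEdge.labelFunctor_gen, TEdge.labelFunctor_gen]
    refine congrArg MulOpposite.op ?_
    change 1 * (shortMatrix _ _ * shortMatrix _ _) = shortMatrix _ _ * 1
    rw [one_mul, mul_one]
    have : y = x.rev := by rw [← hy, Dart.rev_rev]
    subst this
    exact c.above_eq i x hx p k
  | closeLong d r e s h he hs h' =>
    rw [Functor.map_comp, Functor.map_comp, TEdge.labelFunctor_gen, TEdge.labelFunctor_gen,
      TEdge.labelFunctor_gen, TEdge.labelFunctor_gen]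
    refine congrArg MulOpposite.op ?_
    refine (one_mul _).trans (Eq.trans ?_ (mul_one _).symm)
    subst he
    exact longMatrix_congr (c.val_mono d).symm
      (onDart_ne_zero (c.ne_zero _) _) (onDart_ne_zero (c.ne_zero _) _)
  | closeShort d r d' e s e' h k he hs he' h' k' =>
    rw [Functor.map_comp, Functor.map_comp, TEdge.labelFunctor_gen, TEdge.labelFunctor_gen,
      TEdge.labelFunctor_gen, TEdge.labelFunctor_gen]
    refine congrArg MulOpposite.op ?_
    change 1 * shortMatrix _ _ = shortMatrix _ _ * 1
    rw [one_mul, mul_one]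
    subst he
    simp only [shortEntry, L.mono_next, σ.sign_mono, c.val_mono]

/-- The representation `ρ_c : π₁(M_φ) → SL(2, ℂ)` of a Ptolemy assignment `c`. -/
noncomputable def rho (d₀ : Dart n) : TGroup L d₀ →* SL(2, ℂ) :=
  TGroup.hom c.label c.label_rel d₀

end PtolemyAssignment

/-! ### Twisted Alexander polynomials -/

section Torsion

open scoped Classical in
/-- Fox derivative of a word `x₁^{±1} x₂^{±1} ...` with respect to the generator `j`, by the rules
`∂(x u) = ∂x + x ∂u` and `∂(x⁻¹ u) = x⁻¹ (∂u - ∂x)`. -/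
noncomputable def foxWord {X : Type} (j : X) : List (X × Bool) → MonoidAlgebra ℤ (FreeGroup X)
  | [] => 0
  | (x, true) :: u =>
      (if x = j then 1 else 0) + MonoidAlgebra.of ℤ _ (FreeGroup.of x) * foxWord j u
  | (x, false) :: u =>
      MonoidAlgebra.of ℤ _ (FreeGroup.of x)⁻¹ * (foxWord j u - (if x = j then 1 else 0))

open scoped Classical in
/-- The Fox derivative `∂w/∂x_j` in `ℤ[F]` of an element `w` of the free group `F` on `X`. -/
noncomputable def foxDeriv {X : Type} (j : X) (w : FreeGroup X) :
    MonoidAlgebra ℤ (FreeGroup X) :=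
  foxWord j w.toWord

/-- The second symmetric power `Sym² : SL(2, ℂ) → GL(3, ℂ)` (which is the adjoint representation),
as matrices with respect to the basis `e₁², e₁ e₂, e₂²` of `Sym² ℂ²`. -/
def symSq : SL(2, ℂ) →* Matrix (Fin 3) (Fin 3) ℂ where
  toFun g :=
    !![g 0 0 ^ 2, g 0 0 * g 0 1, g 0 1 ^ 2;
       2 * g 0 0 * g 1 0, g 0 0 * g 1 1 + g 0 1 * g 1 0, 2 * g 0 1 * g 1 1;
       g 1 0 ^ 2, g 1 0 * g 1 1, g 1 1 ^ 2]
  map_one' := by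
    ext i j; fin_cases i <;> fin_cases j <;> simp
  map_mul' g h := by
    simp only [Matrix.SpecialLinearGroup.coe_mul, Matrix.mul_apply, Fin.sum_univ_two]
    ext i j; fin_cases i <;> fin_cases j <;> simp [Matrix.mul_apply, Fin.sum_univ_three] <;> ring

variable {G : Type} [Group G] {k : ℕ}

/-- The tensor product `R ⊗ α` of a representation `R : G → GL(k, ℂ)` and a homomorphism
`α : G → ℤ`: the element `g` is sent to `t ^ α(g) R(g)`. -/
noncomputable def twist (R : G →* Matrix (Fin k) (Fin k) ℂ) (α : G →* Multiplicative ℤ) :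
    G →* Matrix (Fin k) (Fin k) ℂ[T;T⁻¹] where
  toFun g := (LaurentPolynomial.T (α g).toAdd : ℂ[T;T⁻¹]) • (R g).map LaurentPolynomial.C
  map_one' := by
    simp
  map_mul' g h := by
    simp only [map_mul, toAdd_mul, LaurentPolynomial.T_add, Matrix.map_mul, smul_mul_smul_comm]

/-- The ring homomorphism `Φ : ℤ[F] → M_k(ℂ[t, t⁻¹])` induced by `R ⊗ α`, where `F` is the free
group on the generators `gen` of `G`. -/
noncomputable def foxEval {X : Type} (R : G →* Matrix (Fin k) (Fin k) ℂ)
    (α : G →* Multiplicative ℤ) (gen : X → G) :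
    MonoidAlgebra ℤ (FreeGroup X) →ₐ[ℤ] Matrix (Fin k) (Fin k) ℂ[T;T⁻¹] :=
  MonoidAlgebra.lift ℤ _ _ ((twist R α).comp (FreeGroup.lift gen))

/-- `⟨X | rel⟩` is a presentation of `G`, the generators being sent to `gen`. -/
def IsPresentation {X Y : Type} (gen : X → G) (rel : Y → FreeGroup X) : Prop :=
  Function.Surjective (FreeGroup.lift gen) ∧
    (FreeGroup.lift gen).ker = Subgroup.normalClosure (Set.range rel)

/-- The numerator of Wada's invariant for a presentation of deficiency one: the determinant of the
matrix of the blocks `Φ(∂r_i/∂x_l)` for `l ≠ j`.  The bijection `e` puts the columns in order. -/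
noncomputable def wadaNum {X Y : Type} [Fintype Y] [DecidableEq Y]
    (R : G →* Matrix (Fin k) (Fin k) ℂ) (α : G →* Multiplicative ℤ) (gen : X → G)
    (rel : Y → FreeGroup X) (j : X) (e : Y ≃ {l : X // l ≠ j}) : ℂ[T;T⁻¹] :=
  Matrix.det (Matrix.of fun p q : Y × Fin k =>
    foxEval R α gen (foxDeriv (e q.1).1 (rel p.1)) p.2 q.2)

/-- The denominator `det Φ(1 - x_j)` of Wada's invariant. -/
noncomputable def wadaDen {X : Type}
    (R : G →* Matrix (Fin k) (Fin k) ℂ) (α : G →* Multiplicative ℤ) (gen : X → G) (j : X) :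
    ℂ[T;T⁻¹] :=
  Matrix.det (foxEval R α gen (1 - MonoidAlgebra.of ℤ _ (FreeGroup.of j)))

/-- Wada's invariant of a presentation of deficiency one of `G` and the representation `R ⊗ α` is
defined and equal to `p`, up to a sign and a power of `t`. -/
def HasWadaInvariant {X Y : Type} [Fintype Y] [DecidableEq Y]
    (R : G →* Matrix (Fin k) (Fin k) ℂ) (α : G →* Multiplicative ℤ) (gen : X → G)
    (rel : Y → FreeGroup X) (p : ℂ[T;T⁻¹]) : Prop :=
  (∃ j, wadaDen R α gen j ≠ 0) ∧
    ∀ j, wadaDen R α gen j ≠ 0 → ∀ e : Y ≃ {l : X // l ≠ j}, ∃ (ε : ℤˣ) (m : ℤ),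
      wadaNum R α gen rel j e =
        ((ε : ℤ) : ℂ[T;T⁻¹]) * LaurentPolynomial.T m * (p * wadaDen R α gen j)

/-- A presentation `⟨x_1, ..., x_m, s | s x_i s⁻¹ = w_i⟩` of `G` of deficiency one, where
`x_1, ..., x_m` is a free basis of the kernel of `α`, the `w_i` are words in the `x_l`, and
`α(s) = 1`. For the fundamental group of a mapping torus and the class `α` of the fibration, the
kernel of `α` is the (free) fundamental group of the fiber. The generator `s` is `none`. -/
structure IsFibrePresentation (α : G →* Multiplicative ℤ) {m : ℕ} (gen : Option (Fin m) → G)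
    (rel : Fin m → FreeGroup (Option (Fin m))) : Prop where
  presentation : IsPresentation gen rel
  injective : Function.Injective (FreeGroup.lift fun i => gen (some i))
  range_eq : (FreeGroup.lift fun i => gen (some i)).range = α.ker
  alpha_none : α (gen none) = Multiplicative.ofAdd 1
  rel_eq : ∀ i, ∃ w : FreeGroup (Fin m), rel i =
    FreeGroup.of none * FreeGroup.of (some i) * (FreeGroup.of none)⁻¹ * (FreeGroup.map some w)⁻¹

/-- The twisted Alexander polynomial of `G` associated to `R ⊗ α` is `p`, up to a sign and a power
of `t`. As Wada's invariant does not depend on the presentation of the group, it is taken from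
presentations as above; they exist, and each of them has the invariant `p`. -/
def IsTwistedAlexanderPolynomial (R : G →* Matrix (Fin k) (Fin k) ℂ) (α : G →* Multiplicative ℤ)
    (p : ℂ[T;T⁻¹]) : Prop :=
  (∃ (m : ℕ) (gen : Option (Fin m) → G) (rel : Fin m → FreeGroup (Option (Fin m))),
    IsFibrePresentation α gen rel) ∧
  ∀ (m : ℕ) (gen : Option (Fin m) → G) (rel : Fin m → FreeGroup (Option (Fin m))),
    IsFibrePresentation α gen rel → HasWadaInvariant R α gen rel p

end Torsion

/-- A homomorphism to `SL(2, ℂ)` as a representation on `ℂ²`. -/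
noncomputable def stdRep {G : Type} [Group G] (ρ : G →* SL(2, ℂ)) :
    Representation ℂ G (Fin 2 → ℂ) where
  toFun g := Matrix.toLin' (ρ g : Matrix (Fin 2) (Fin 2) ℂ)
  map_one' := by simp; rfl
  map_mul' g h := by simp [Matrix.toLin'_mul]; rfl

/-!
Wada's invariant of a presentation `⟨x₁, ..., x_m, s ∣ s x_i s⁻¹ = w_i(x)⟩` is computed by
removing the column of `s`: since every element of `SL(2, ℂ)` fixes a vector of `Sym²`, the
denominators of the other columns vanish. With the column of `s` removed, the Fox matrix is, up to
a factor of determinant one, `t - A`, where `A` is the matrix of the monodromy on the space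
`Z¹(π₁(Σ); Sym² ρ)` of crossed homomorphisms, and the denominator is up to sign the characteristic
polynomial of `Sym² ρ(s)⁻¹` (`IsFibrePresentation.hasWadaInvariant`). So the theorem amounts to
the identity `charpoly A = charpoly J * charpoly (Sym² ρ(s)⁻¹)`, where `J` is the derivative of the
Ptolemy variables of the top surface (`FibreFrame.charpoly_crossedMonodromy`).

For the identity the crossed homomorphisms are replaced by the twisted cocycles on the truncated
surface: such a cocycle is a crossed homomorphism together with a vector at each vertex of the
truncated surface. The vectors at the vertices contribute `b³` to the characteristic polynomial of
the monodromy, where `b` is the characteristic polynomial of the monodromy on functions on the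
vertices (`FibreFrame.charpoly_cochainMonodromy`). The labels of the short edges are upper
triangular, so the values of a cocycle on the short edges may be filtered by weights.

* The lowest and the middle weight components give two copies of the space of functions on the
  short edges. The monodromy on it has the characteristic polynomial `b` again, because it is
  related to the functions on the vertices by the cohomology of the boundary circles of the
  surface, whose groups `H⁰` and `H¹` are both the space of functions on the set of circles
  (`LayeredTriangulation.charpoly_vertexTotal`).
* If both components vanish, the cocycle is an infinitesimal deformation of the cocycle of the
  Ptolemy assignment, as an assignment of Ptolemy variables: the middle component `λ` on a long
  edge with Ptolemy variable `c` is the change `c λ` of `c`. The relations of the hexagons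
  determine the changes of the entries of the short edges
  (`FibreFrame.IsHorizontal.entryChange_eq`), and the relation of a tetrahedron becomes the
  derivative of its Ptolemy equation (`FibreFrame.IsHorizontal.varChange_self`). So the monodromy
  acts by `J` on these changes.
* The cocycles which do not change the Ptolemy variables are given by a vector at the base point
  and by highest weight vectors at the vertices (`FibreFrame.exists_eq_parabolic_iff`). They
  contribute `charpoly (Sym² ρ(s)⁻¹) * b`.

The maps to the graded pieces are surjective by a count of dimensions, for which it suffices that
the rank of `π₁(Σ)` is at least `n + 1` (`BasePaths.le_of_range_eq`). Comparing the two
computations, the factors `b³` cancel.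

It remains to understand the kernel of the class of the fibration `α`. When the paths from the
base point are chosen such that all long edges and all vertical edges become trivial loops, a flip
acts on the loops of the short edges by an explicit substitution
(`SurfaceTriangulation.cornerStep`, `exists_paths`). Hence the kernel of `α` is generated by the
loops of the short edges of the bottom surface (`BasePaths.fibre_eq_ker`). Collapsing all long
edges maps it to a free group of rank `4 n`, of which it is a retract
(`BasePaths.freeLift_toFree`), so it is free of finite rank (`BasePaths.exists_basis`) and the
required presentations exist (`exists_isFibrePresentation`). The map is defined on the fundamental
group of the mapping torus, because the substitutions of the flips give an automorphism of the
free group.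
-/

/-! ### Characteristic polynomials in exact sequences -/

section Charpoly

variable {K : Type*} [Field K] {A B C : Type*} [AddCommGroup A] [Module K A] [FiniteDimensional K A]
  [AddCommGroup B] [Module K B] [FiniteDimensional K B]
  [AddCommGroup C] [Module K C] [FiniteDimensional K C]

/-- The characteristic polynomial is multiplicative in short exact sequences of spaces with an
endomorphism. -/
theorem charpoly_of_exact (i : A →ₗ[K] B) (p : B →ₗ[K] C) (hi : Function.Injective i)
    (hp : Function.Surjective p) (hip : ∀ b, p b = 0 ↔ ∃ a, i a = b)
    (f : A →ₗ[K] A) (g : B →ₗ[K] B) (h : C →ₗ[K] C)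
    (hf : ∀ a, g (i a) = i (f a)) (hh : ∀ b, p (g b) = h (p b)) :
    g.charpoly = f.charpoly * h.charpoly := by
  -- In a basis adapted to a splitting `B = A ⊕ C` the matrix of `g` is block triangular.
  obtain ⟨s, hs⟩ := p.exists_rightInverse_of_surjective (LinearMap.range_eq_top.2 hp)
  have hs' : ∀ c, p (s c) = c := fun c => LinearMap.congr_fun hs c
  have hpi : ∀ a, p (i a) = 0 := fun a => (hip _).2 ⟨a, rfl⟩
  let e : (A × C) ≃ₗ[K] B := LinearEquiv.ofBijective (i.coprod s) ⟨by
      rw [← LinearMap.ker_eq_bot, LinearMap.ker_eq_bot']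
      rintro ⟨a, c⟩ hac
      simp only [LinearMap.coprod_apply] at hac
      have hc : c = 0 := by
        have := congrArg p hac
        rwa [map_add, hpi, hs', zero_add, map_zero] at this
      subst hc
      rw [map_zero, add_zero] at hac
      rw [hi (hac.trans (map_zero i).symm)]; rfl, by
      intro b
      obtain ⟨a, ha⟩ := (hip (b - s (p b))).1 (by rw [map_sub, hs', sub_self])
      exact ⟨(a, p b), by simp [ha]⟩⟩
  have he : ∀ a c, e (a, c) = i a + s c := fun _ _ => rfl
  rw [← LinearEquiv.charpoly_conj e.symm g]
  let bA := Module.Free.chooseBasis K A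
  let bC := Module.Free.chooseBasis K C
  set G : Module.End K (A × C) := e.symm.conj g with hG
  have hG' : ∀ x, e (G x) = g (e x) := fun x => by simp [hG, LinearEquiv.conj_apply]
  have h1 : ∀ a, G (a, 0) = (f a, 0) := fun a => e.injective (by
    rw [hG', he, he, map_zero, add_zero, add_zero, hf])
  have h2 : ∀ x, (G x).2 = h x.2 := fun x => by
    have := congrArg p (hG' x)
    rw [hh, ← Prod.mk.eta (p := G x), ← Prod.mk.eta (p := x), he, he, map_add, map_add, hpi, hpi,
      hs', hs', zero_add, zero_add] at this
    exact this
  rw [← LinearMap.charpoly_toMatrix G (bA.prod bC), ← LinearMap.charpoly_toMatrix f bA,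
    ← LinearMap.charpoly_toMatrix h bC,
    ← Matrix.fromBlocks_toBlocks (LinearMap.toMatrix (bA.prod bC) (bA.prod bC) G)]
  have e1 : (LinearMap.toMatrix (bA.prod bC) (bA.prod bC) G).toBlocks₁₁ =
      LinearMap.toMatrix bA bA f := by
    ext k l
    simp [Matrix.toBlocks₁₁, LinearMap.toMatrix_apply, h1]
  have e2 : (LinearMap.toMatrix (bA.prod bC) (bA.prod bC) G).toBlocks₂₁ = 0 := by
    ext k l
    simp [Matrix.toBlocks₂₁, LinearMap.toMatrix_apply, h1]
  have e3 : (LinearMap.toMatrix (bA.prod bC) (bA.prod bC) G).toBlocks₂₂ =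
      LinearMap.toMatrix bC bC h := by
    ext k l
    simp [Matrix.toBlocks₂₂, LinearMap.toMatrix_apply, h2]
  rw [e1, e2, e3, Matrix.charpoly_fromBlocks_zero₂₁]

/-- The version of `charpoly_of_exact` for a linear map defined on an invariant subspace. -/
theorem charpoly_restrict_eq (f : B →ₗ[K] B) (M M' : Submodule K B) (hM : ∀ x ∈ M, f x ∈ M)
    (hM' : ∀ x ∈ M', f x ∈ M') (p : B →ₗ[K] C) (g : C →ₗ[K] C)
    (hMM' : ∀ x, x ∈ M' ↔ x ∈ M ∧ p x = 0) (hg : ∀ x ∈ M, p (f x) = g (p x))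
    (hp : ∀ y, ∃ x ∈ M, p x = y) :
    (f.restrict hM).charpoly = (f.restrict hM').charpoly * g.charpoly := by
  refine charpoly_of_exact (Submodule.inclusion fun x hx => ((hMM' x).1 hx).1)
    (p.comp M.subtype) (Submodule.inclusion_injective _) ?_ ?_ _ _ _ ?_ ?_
  · intro y
    obtain ⟨x, hx, h⟩ := hp y
    exact ⟨⟨x, hx⟩, h⟩
  · rintro ⟨b, hb⟩
    constructor
    · intro h
      exact ⟨⟨b, (hMM' b).2 ⟨hb, h⟩⟩, rfl⟩
    · rintro ⟨⟨a, ha⟩, h⟩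
      have : a = b := congrArg Subtype.val h
      subst this
      exact ((hMM' a).1 ha).2
  · intro a; rfl
  · rintro ⟨b, hb⟩
    exact hg b hb

theorem charpoly_restrict_top (f : B →ₗ[K] B)
    (h : ∀ x ∈ (⊤ : Submodule K B), f x ∈ (⊤ : Submodule K B)) :
    (f.restrict h).charpoly = f.charpoly := by
  rw [← LinearEquiv.charpoly_conj (Submodule.topEquiv (R := K) (M := B)) (f.restrict h)]
  congr 1

omit [FiniteDimensional K C] in
theorem finrank_eq_add_finrank_range (M M' : Submodule K B) (p : B →ₗ[K] C)
    (hMM' : ∀ x, x ∈ M' ↔ x ∈ M ∧ p x = 0) :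
    Module.finrank K M =
      Module.finrank K M' + Module.finrank K (LinearMap.range (p.comp M.subtype)) := by
  have h := (p.comp M.subtype).finrank_range_add_finrank_ker
  have e : Module.finrank K (LinearMap.ker (p.comp M.subtype)) = Module.finrank K M' := by
    refine LinearEquiv.finrank_eq (LinearEquiv.ofBijective
      ((M.subtype.comp (LinearMap.ker (p.comp M.subtype)).subtype).codRestrict M' ?_) ⟨?_, ?_⟩)
    · rintro ⟨⟨x, hx⟩, h⟩
      exact (hMM' x).2 ⟨hx, h⟩
    · rintro ⟨⟨x, hx⟩, h⟩ ⟨⟨y, hy⟩, h'⟩ hxy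
      have : x = y := congrArg Subtype.val hxy
      subst this; rfl
    · rintro ⟨x, hx⟩
      exact ⟨⟨⟨x, ((hMM' x).1 hx).1⟩, ((hMM' x).1 hx).2⟩, rfl⟩
  omega

/-- If an endomorphism of `ι → K³` respects the filtration by the coordinates, and acts by `b` on
each of the graded pieces, then its characteristic polynomial is the cube of that of `b`. -/
theorem charpoly_filtered {ι : Type*} [Fintype ι] (f : (ι → Fin 3 → K) →ₗ[K] (ι → Fin 3 → K))
    (b : (ι → K) →ₗ[K] (ι → K))
    (h2 : ∀ x, (fun j => f x j 2) = b (fun j => x j 2))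
    (h1 : ∀ x, (∀ j, x j 2 = 0) → (fun j => f x j 1) = b (fun j => x j 1))
    (h0 : ∀ x, (∀ j, x j 2 = 0) → (∀ j, x j 1 = 0) → (fun j => f x j 0) = b (fun j => x j 0)) :
    f.charpoly = b.charpoly * b.charpoly * b.charpoly := by
  let c : Fin 3 → (ι → Fin 3 → K) →ₗ[K] (ι → K) := fun k =>
    { toFun := fun x j => x j k, map_add' := fun _ _ => rfl, map_smul' := fun _ _ => rfl }
  let M2 : Submodule K (ι → Fin 3 → K) := LinearMap.ker (c 2)
  let M1 : Submodule K (ι → Fin 3 → K) := M2 ⊓ LinearMap.ker (c 1)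
  have m2 : ∀ x, x ∈ M2 ↔ ∀ j, x j 2 = 0 := fun x => by simp [M2, c, funext_iff]
  have m1 : ∀ x, x ∈ M1 ↔ (∀ j, x j 2 = 0) ∧ ∀ j, x j 1 = 0 := fun x => by
    simp [M1, m2, c, funext_iff]
  have i2 : ∀ x ∈ M2, f x ∈ M2 := fun x hx => by
    rw [m2] at hx ⊢
    have := h2 x
    simp only [hx] at this
    rw [show (fun _ : ι => (0 : K)) = 0 from rfl, map_zero] at this
    exact fun j => congrFun this j
  have i1 : ∀ x ∈ M1, f x ∈ M1 := fun x hx => by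
    have hx' := (m1 x).1 hx
    rw [m1]
    refine ⟨(m2 _).1 (i2 x hx.1), ?_⟩
    have := h1 x hx'.1
    simp only [hx'.2] at this
    rw [show (fun _ : ι => (0 : K)) = 0 from rfl, map_zero] at this
    exact fun j => congrFun this j
  have it : ∀ x ∈ (⊤ : Submodule K (ι → Fin 3 → K)), f x ∈ (⊤ : Submodule K (ι → Fin 3 → K)) :=
    fun _ _ => trivial
  rw [← charpoly_restrict_top f it,
    charpoly_restrict_eq f ⊤ M2 it i2 (c 2) b (fun x => by simp [M2]) (fun x _ => h2 x)
      (fun y => ⟨fun j => ![0, 0, y j], trivial, by ext; simp [c]⟩),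
    charpoly_restrict_eq f M2 M1 i2 i1 (c 1) b (fun x => by simp [M1])
      (fun x hx => h1 x ((m2 x).1 hx))
      (fun y => ⟨fun j => ![0, y j, 0], (m2 _).2 (by simp), by ext; simp [c]⟩)]
  congr 2
  have hb : ∀ y : ι → K, (fun j => ![y j, 0, 0]) ∈ M1 := fun y => (m1 _).2 (by simp)
  let e : (ι → K) ≃ₗ[K] M1 := LinearEquiv.ofBijective
    ({ toFun := fun y => ⟨fun j => ![y j, 0, 0], hb y⟩
       map_add' := fun y z => by ext j k; fin_cases k <;> simp
       map_smul' := fun y z => by ext j k; fin_cases k <;> simp } : (ι → K) →ₗ[K] M1) ⟨by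
      intro y z h
      ext j
      exact congrFun (congrFun (congrArg Subtype.val h) j) 0, by
      rintro ⟨x, hx⟩
      have hx' := (m1 x).1 hx
      refine ⟨fun j => x j 0, Subtype.ext ?_⟩
      ext j k
      fin_cases k <;> simp [hx'.1, hx'.2]⟩
  rw [← LinearEquiv.charpoly_conj e b]
  congr 1
  refine LinearMap.ext fun x => Subtype.ext ?_
  obtain ⟨y, rfl⟩ := e.surjective x
  have hy := (m1 _).1 (hb y)
  have h := h0 _ hy.1 hy.2
  have hf := (m1 _).1 (i1 _ (hb y))
  simp only [LinearEquiv.conj_apply, LinearMap.comp_apply, LinearEquiv.coe_coe,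
    LinearEquiv.symm_apply_apply]
  ext j k
  fin_cases k
  · exact congrFun h j
  · exact hf.2 j
  · exact hf.1 j

/-- Two endomorphisms which are linked by an exact sequence `0 → H → A → B → H → 0` have the same
characteristic polynomial: with `H = ker d` and `I = im d`, both have a filtration with the graded
pieces `H` and `I`. -/
theorem charpoly_eq_of_exact_loop (hd : Module.finrank K A = Module.finrank K B)
    (d : A →ₗ[K] B) (s : B →ₗ[K] A)
    (hds : ∀ b, d (s b) = 0) (hsd : ∀ a, s (d a) = 0) (hs : ∀ a, d a = 0 → ∃ b, s b = a)
    (f : A →ₗ[K] A) (g : B →ₗ[K] B) (hf : ∀ a, d (f a) = g (d a))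
    (hg : ∀ b, s (g b) = f (s b)) : f.charpoly = g.charpoly := by
  have hk : ∀ x ∈ LinearMap.ker d, f x ∈ LinearMap.ker d := fun x hx => by
    rw [LinearMap.mem_ker] at hx ⊢; rw [hf, hx, map_zero]
  have hr : ∀ x ∈ LinearMap.range d, g x ∈ LinearMap.range d := by
    rintro _ ⟨x, rfl⟩; exact ⟨f x, hf x⟩
  have e1 : f.charpoly = (f.restrict hk).charpoly * (g.restrict hr).charpoly := by
    refine charpoly_of_exact (LinearMap.ker d).subtype d.rangeRestrict
      (Submodule.subtype_injective _) d.surjective_rangeRestrict ?_ _ _ _ (fun _ => rfl)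
      fun b => Subtype.ext (hf b)
    intro b
    constructor
    · intro h
      exact ⟨⟨b, congrArg Subtype.val h⟩, rfl⟩
    · rintro ⟨⟨a, ha⟩, rfl⟩
      exact Subtype.ext ha
  have hrange : LinearMap.range s = LinearMap.ker d := by
    ext x
    constructor
    · rintro ⟨b, rfl⟩; exact hds b
    · intro hx
      obtain ⟨b, hb⟩ := hs x hx
      exact ⟨b, hb⟩
  have hker : LinearMap.range d = LinearMap.ker s := by
    refine Submodule.eq_of_le_of_finrank_eq ?_ ?_
    · rintro _ ⟨x, rfl⟩; exact hsd x
    · have h1 := d.finrank_range_add_finrank_ker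
      have h2 := s.finrank_range_add_finrank_ker
      rw [hrange] at h2
      omega
  have e2 : g.charpoly = (g.restrict hr).charpoly * (f.restrict hk).charpoly := by
    refine charpoly_of_exact (LinearMap.range d).subtype (s.codRestrict (LinearMap.ker d) hds)
      (Submodule.subtype_injective _) ?_ ?_ _ _ _ (fun _ => rfl) fun b => Subtype.ext (hg b)
    · rintro ⟨x, hx⟩
      obtain ⟨b, hb⟩ := hs x hx
      exact ⟨b, Subtype.ext hb⟩
    · intro b
      constructor
      · intro h
        have hb : b ∈ LinearMap.ker s := congrArg Subtype.val h
        rw [← hker] at hb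
        exact ⟨⟨b, hb⟩, rfl⟩
      · rintro ⟨⟨a, x, rfl⟩, rfl⟩
        exact Subtype.ext (hsd x)
  rw [e1, e2, mul_comm]

end Charpoly

/-! ### The boundary circles of the truncated surfaces under flips -/

/-- Reversal of oriented edges as a permutation. -/
def Dart.revEquiv (n : ℕ) : Equiv.Perm (Dart n) :=
  ⟨Dart.rev, Dart.rev, Dart.rev_rev, Dart.rev_rev⟩

namespace SurfaceTriangulation

variable {n : ℕ}

section IsFlip

variable {T T' : SurfaceTriangulation n} {e : Fin (3 * n)} (h : T.IsFlip T' e)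
include h

theorem IsFlip.next_edge_ne {y : Dart n} (hy : y.1 = e) : (T.next y).1 ≠ e :=
  PtolemyAssignment.next_ne_edge h hy

theorem IsFlip.next_next_edge_ne {y : Dart n} (hy : y.1 = e) : (T.next (T.next y)).1 ≠ e :=
  PtolemyAssignment.next_next_ne h hy

theorem IsFlip.next_next_eq {y : Dart n} (hy : y.1 = e) : T'.next (T.next y) = y.rev := by
  have := h.next_rev y.rev hy
  rwa [Dart.rev_rev] at this

omit h in
/-- An oriented edge is flipped, or it follows a flipped one in its triangle, or it precedes a
flipped one, or its triangle is not touched by the flip. -/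
theorem dart_cases (T : SurfaceTriangulation n) (e : Fin (3 * n)) (d : Dart n) (p : Prop)
    (h1 : d.1 = e → p)
    (h2 : ∀ y : Dart n, y.1 = e → d = T.next y → p)
    (h3 : ∀ y : Dart n, y.1 = e → d = T.next (T.next y) → p)
    (h4 : ¬ T.Touches e d → p) : p := by
  by_cases k1 : d.1 = e
  · exact h1 k1
  by_cases k2 : (T.next d).1 = e
  · exact h3 _ k2 (T.next_next_next d).symm
  by_cases k3 : (T.next (T.next d)).1 = e
  · exact h2 _ k3 (T.next_next_next d).symm
  exact h4 (by rintro (h | h | h) <;> contradiction)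

end IsFlip

variable (T : SurfaceTriangulation n)

/-- Two vertices of the truncated surface (represented by the oriented edges starting there) lie on
the same boundary circle.  The short edges lead from `d.rev` to `T.next d`, so this is expressed by
the sets of vertices which are unions of connected components of the graph of short edges. -/
def SameCusp (v w : Dart n) : Prop :=
  ∀ f : Dart n → Prop, (∀ u, f (T.next u) ↔ f u.rev) → (f v ↔ f w)

variable {T} in
theorem sameCusp_next {u w : Dart n} : T.SameCusp (T.next u) w ↔ T.SameCusp u.rev w :=
  ⟨fun h f hf => (hf u).symm.trans (h f hf), fun h f hf => (hf u).trans (h f hf)⟩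

variable {T} in
theorem SameCusp.symm {v w : Dart n} (h : T.SameCusp v w) : T.SameCusp w v :=
  fun f hf => (h f hf).symm

variable {T} in
theorem sameCusp_next_right {u w : Dart n} : T.SameCusp w (T.next u) ↔ T.SameCusp w u.rev :=
  ⟨fun h => (sameCusp_next.1 h.symm).symm, fun h => (sameCusp_next.2 h.symm).symm⟩

section IsFlip

variable {T} {T' : SurfaceTriangulation n} {e : Fin (3 * n)} (h : T.IsFlip T' e)
include h

/-- A flip removes the two vertices on the flipped edge and creates two others; the remaining
vertices stay on their circles. A union of circles before the flip is adjusted at these two vertices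
to give a union of circles after it, and conversely. -/
theorem IsFlip.sameCusp_iff {v w : Dart n} (hv : v.1 ≠ e) (hw : w.1 ≠ e) :
    T'.SameCusp v w ↔ T.SameCusp v w := by
  constructor
  · intro k f hf
    have := k (fun u => if u.1 = e then f (T.next (T.next u.rev)) else f u) ?_
    · simpa [hv, hw] using this
    intro u
    refine T.dart_cases e u _ (fun hu => ?_) (fun y hy hu => ?_) (fun y hy hu => ?_) fun hu => ?_
    · rw [h.next_self u hu, if_neg (h.next_next_edge_ne hu), if_pos (show u.rev.1 = e from hu),
        Dart.rev_rev]
    · subst hu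
      rw [h.next_next_eq hy, if_pos (show y.rev.1 = e from hy), Dart.rev_rev,
        if_neg (show (T.next y).rev.1 ≠ e from h.next_edge_ne hy)]
      exact hf _
    · subst hu
      rw [h.next_third y hy, if_neg (h.next_edge_ne (show y.rev.1 = e from hy)),
        if_neg (show (T.next (T.next y)).rev.1 ≠ e from h.next_next_edge_ne hy),
        hf, Dart.rev_rev, ← hf, T.next_next_next]
    · rw [h.next_other u hu, if_neg (fun k => hu (Or.inr (Or.inl k))),
        if_neg (show u.rev.1 ≠ e from fun k => hu (Or.inl k)), hf]
  · intro k f hf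
    have := k (fun u => if u.1 = e then f (T.next u.rev) else f u) ?_
    · simpa [hv, hw] using this
    intro u
    refine T.dart_cases e u _ (fun hu => ?_) (fun y hy hu => ?_) (fun y hy hu => ?_) fun hu => ?_
    · rw [if_neg (h.next_edge_ne hu), if_pos (show u.rev.1 = e from hu),
        Dart.rev_rev]
    · subst hu
      rw [if_neg (h.next_next_edge_ne hy),
        if_neg (show (T.next y).rev.1 ≠ e from h.next_edge_ne hy), ← hf, h.next_next_eq hy,
        ← hf, h.next_self y hy]
    · subst hu
      rw [T.next_next_next, if_pos hy,
        if_neg (show (T.next (T.next y)).rev.1 ≠ e from h.next_next_edge_ne hy),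
        ← h.next_third y hy, hf]
    · rw [if_neg (fun k => hu (Or.inr (Or.inl k))),
        if_neg (show u.rev.1 ≠ e from fun k => hu (Or.inl k)), ← hf, h.next_other u hu]

end IsFlip

/-- The effect of a flip at `e` on the functions on the vertices of the truncated surface. The value
at a new vertex is chosen such that the coboundary keeps its values at the flipped edge, as in
`shortStep`. -/
noncomputable def vertexStep (e : Fin (3 * n)) : (Dart n → ℂ) →ₗ[ℂ] (Dart n → ℂ) where
  toFun f d := if d.1 = e then f d - f (T.next d.rev) + f (T.next (T.next d.rev)) else f d
  map_add' f g := by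
    ext d
    simp only [Pi.add_apply]
    split_ifs <;> ring
  map_smul' a f := by
    ext d
    simp only [Pi.smul_apply, smul_eq_mul, RingHom.id_apply]
    split_ifs <;> ring

/-- The effect of a flip at `e` on the functions on the short edges of the truncated surface.  The
value at a flipped edge, which is a matter of choice, is kept. -/
noncomputable def shortStep (e : Fin (3 * n)) : (Dart n → ℂ) →ₗ[ℂ] (Dart n → ℂ) where
  toFun a d := a d + (if (T.next d).1 = e then a (T.next d).rev else 0) -
    (if (T.next (T.next d)).1 = e then a (T.next (T.next d)) else 0)
  map_add' f g := by
    ext d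
    simp only [Pi.add_apply]
    split_ifs <;> ring
  map_smul' a f := by
    ext d
    simp only [Pi.smul_apply, smul_eq_mul, RingHom.id_apply]
    split_ifs <;> ring

/-- The coboundary of a function on the vertices of the truncated surface, on the short edges. -/
noncomputable def cuspCoboundary : (Dart n → ℂ) →ₗ[ℂ] (Dart n → ℂ) where
  toFun f d := f d.rev - f (T.next d)
  map_add' f g := by ext d; simp only [Pi.add_apply]; ring
  map_smul' a f := by ext d; simp only [Pi.smul_apply, smul_eq_mul, RingHom.id_apply]; ring

open scoped Classical in
/-- The sum of a function on the short edges over each of the boundary circles, as a function on the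
vertices. -/
noncomputable def cuspSum : (Dart n → ℂ) →ₗ[ℂ] (Dart n → ℂ) where
  toFun a v := ∑ d : Dart n, (if T.SameCusp d.rev v then 1 else 0) * a d
  map_add' f g := by ext d; simp only [Pi.add_apply, mul_add, Finset.sum_add_distrib]
  map_smul' a f := by
    ext d
    simp only [Pi.smul_apply, smul_eq_mul, RingHom.id_apply, Finset.mul_sum, mul_left_comm]

theorem vertexStep_apply (e : Fin (3 * n)) (f : Dart n → ℂ) (d : Dart n) : T.vertexStep e f d =
    if d.1 = e then f d - f (T.next d.rev) + f (T.next (T.next d.rev)) else f d := rfl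

theorem shortStep_apply (e : Fin (3 * n)) (a : Dart n → ℂ) (d : Dart n) :
    T.shortStep e a d = a d + (if (T.next d).1 = e then a (T.next d).rev else 0) -
      (if (T.next (T.next d)).1 = e then a (T.next (T.next d)) else 0) := rfl

theorem cuspCoboundary_apply (f : Dart n → ℂ) (d : Dart n) :
    T.cuspCoboundary f d = f d.rev - f (T.next d) := rfl

open scoped Classical in
theorem cuspSum_apply (a : Dart n → ℂ) (v : Dart n) :
    T.cuspSum a v = ∑ d : Dart n, (if T.SameCusp d.rev v then 1 else 0) * a d := rfl

theorem cuspSum_next (a : Dart n → ℂ) (v : Dart n) :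
    T.cuspSum a (T.next v) = T.cuspSum a v.rev := by
  classical
  rw [cuspSum_apply, cuspSum_apply]
  refine Finset.sum_congr rfl fun d _ => ?_
  congr 1
  exact if_congr sameCusp_next_right rfl rfl

theorem cuspCoboundary_cuspSum (a : Dart n → ℂ) : T.cuspCoboundary (T.cuspSum a) = 0 := by
  ext d
  rw [cuspCoboundary_apply, cuspSum_next, sub_self]; rfl

theorem cuspSum_cuspCoboundary (f : Dart n → ℂ) : T.cuspSum (T.cuspCoboundary f) = 0 := by
  classical
  ext v
  simp only [cuspSum_apply, cuspCoboundary_apply, mul_sub, Finset.sum_sub_distrib]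
  rw [Pi.zero_apply, sub_eq_zero]
  have e1 := Equiv.sum_comp (Dart.revEquiv n) fun d => (if T.SameCusp d v then 1 else 0) * f d
  have e2 := Equiv.sum_comp T.next fun d => (if T.SameCusp d v then 1 else 0) * f d
  refine e1.trans (e2.symm.trans (Finset.sum_congr rfl fun d _ => ?_))
  congr 1
  exact if_congr sameCusp_next rfl rfl

/-- A function which is constant on each circle is in the image of `cuspSum`, by dividing it by the
numbers of short edges of the circles. -/
theorem exists_cuspSum (f : Dart n → ℂ) (hf : T.cuspCoboundary f = 0) :
    ∃ a, T.cuspSum a = f := by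
  classical
  refine ⟨fun d => f d.rev / ∑ u : Dart n, (if T.SameCusp u.rev d.rev then 1 else 0), ?_⟩
  have hf' : ∀ v w, T.SameCusp v w → f v = f w := fun v w h =>
    ((h (fun u => f u = f w) fun u => by
      rw [sub_eq_zero.1 (congrFun hf u)])).2 rfl
  ext v
  have hne : (∑ u : Dart n, (if T.SameCusp u.rev v then (1 : ℂ) else 0)) ≠ 0 := by
    rw [Finset.sum_boole, Nat.cast_ne_zero]
    refine Finset.card_ne_zero.2 ⟨v.rev, Finset.mem_filter.2 ⟨Finset.mem_univ _, ?_⟩⟩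
    rw [Dart.rev_rev]
    exact fun _ _ => Iff.rfl
  rw [cuspSum_apply]
  have : ∀ d : Dart n, (if T.SameCusp d.rev v then (1 : ℂ) else 0) *
      (f d.rev / ∑ u : Dart n, (if T.SameCusp u.rev d.rev then 1 else 0)) =
      (if T.SameCusp d.rev v then 1 else 0) *
        (f v / ∑ u : Dart n, (if T.SameCusp u.rev v then 1 else 0)) := by
    intro d
    split_ifs with hd
    · have hs : ∀ u : Dart n, T.SameCusp u.rev d.rev ↔ T.SameCusp u.rev v := fun u =>
        ⟨fun k g hg => (k g hg).trans (hd g hg), fun k g hg => (k g hg).trans (hd g hg).symm⟩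
      simp only [hs, hf' _ _ hd]
    · simp
  rw [Finset.sum_congr rfl fun d _ => this d, ← Finset.sum_mul]
  field_simp

section IsFlip

variable {T} {T' : SurfaceTriangulation n} {e : Fin (3 * n)} (h : T.IsFlip T' e)
include h

/-- The effects of a flip on functions on vertices and on short edges are compatible with the
coboundary. -/
theorem IsFlip.cuspCoboundary_vertexStep (f : Dart n → ℂ) :
    T'.cuspCoboundary (T.vertexStep e f) = T.shortStep e (T.cuspCoboundary f) := by
  ext d
  refine T.dart_cases e d _ (fun hu => ?_) (fun y hy hu => ?_) (fun y hy hu => ?_) fun hu => ?_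
  · have h1 := h.next_edge_ne hu
    have h2 := h.next_next_edge_ne hu
    have h3 : d.rev.1 = e := hu
    simp only [cuspCoboundary_apply, vertexStep_apply, shortStep_apply, h.next_self d hu, h1, h2,
      h3, if_true, if_false, Dart.rev_rev]
    ring
  · subst hu
    have h1 : (T.next y).rev.1 ≠ e := h.next_edge_ne hy
    have h2 := h.next_next_edge_ne hy
    have h3 : y.rev.1 = e := hy
    simp only [cuspCoboundary_apply, vertexStep_apply, shortStep_apply, h.next_next_eq hy, h1, h2,
      h3, hy, if_true, if_false, Dart.rev_rev, T.next_next_next]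
    ring
  · subst hu
    have h1 : (T.next (T.next y)).rev.1 ≠ e := h.next_next_edge_ne hy
    have h2 := h.next_edge_ne (show y.rev.1 = e from hy)
    have h3 := h.next_edge_ne hy
    simp only [cuspCoboundary_apply, vertexStep_apply, shortStep_apply, h.next_third y hy, h1, h2,
      h3, hy, if_true, if_false, Dart.rev_rev, T.next_next_next]
    ring
  · have h1 : d.rev.1 ≠ e := fun k => hu (Or.inl k)
    have h2 : (T.next d).1 ≠ e := fun k => hu (Or.inr (Or.inl k))
    have h3 : (T.next (T.next d)).1 ≠ e := fun k => hu (Or.inr (Or.inr k))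
    simp only [cuspCoboundary_apply, vertexStep_apply, shortStep_apply, h.next_other d hu, h1, h2,
      h3, if_false]
    ring

omit h in
/-- The transpose of `shortStep`. -/
theorem sum_mul_shortStep (g a : Dart n → ℂ) : ∑ d : Dart n, g d * T.shortStep e a d =
    ∑ d : Dart n,
      (g d + if d.1 = e then g (T.next (T.next d.rev)) - g (T.next d) else 0) * a d := by
  have e1 : ∑ d : Dart n, g d * (if (T.next d).1 = e then a (T.next d).rev else 0) =
      ∑ d : Dart n, (if d.1 = e then g (T.next (T.next d.rev)) else 0) * a d := by
    rw [← Equiv.sum_comp (T.next.trans (Dart.revEquiv n)) (fun d : Dart n =>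
      (if d.1 = e then g (T.next (T.next d.rev)) else 0) * a d)]
    refine Finset.sum_congr rfl fun d _ => ?_
    change _ = (if (T.next d).1 = e then g (T.next (T.next (T.next d).rev.rev)) else 0) *
      a (T.next d).rev
    rw [Dart.rev_rev, T.next_next_next]
    split_ifs <;> simp
  have e2 : ∑ d : Dart n, g d * (if (T.next (T.next d)).1 = e then a (T.next (T.next d)) else 0) =
      ∑ d : Dart n, (if d.1 = e then g (T.next d) else 0) * a d := by
    rw [← Equiv.sum_comp (T.next.trans T.next) (fun d : Dart n =>
      (if d.1 = e then g (T.next d) else 0) * a d)]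
    refine Finset.sum_congr rfl fun d _ => ?_
    simp only [Equiv.trans_apply, T.next_next_next]
    split_ifs <;> simp
  simp only [shortStep_apply, mul_sub, mul_add, Finset.sum_sub_distrib, Finset.sum_add_distrib, e1,
    e2]
  rw [← Finset.sum_add_distrib, ← Finset.sum_sub_distrib]
  refine Finset.sum_congr rfl fun d _ => ?_
  split_ifs <;> ring

/-- The effect of a flip on functions on the short edges does not change their sums over the
boundary circles. -/
theorem IsFlip.cuspSum_shortStep (a : Dart n → ℂ) :
    T'.cuspSum (T.shortStep e a) = T.vertexStep e (T.cuspSum a) := by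
  classical
  have key : ∀ v : Dart n, v.1 ≠ e → T'.cuspSum (T.shortStep e a) v = T.cuspSum a v := by
    intro v hv
    rw [cuspSum_apply, cuspSum_apply, sum_mul_shortStep]
    refine Finset.sum_congr rfl fun d _ => ?_
    congr 1
    by_cases hd : d.1 = e
    · have h1 : (if T'.SameCusp (T.next d).rev v then (1 : ℂ) else 0) =
          if T'.SameCusp d.rev v then 1 else 0 := by
        refine if_congr ?_ rfl rfl
        rw [← sameCusp_next, h.next_next_eq hd]
      have h2 : (if T'.SameCusp (T.next (T.next d.rev)).rev v then (1 : ℂ) else 0) =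
          if T.SameCusp d.rev v then 1 else 0 := by
        refine if_congr ?_ rfl rfl
        rw [h.sameCusp_iff (v := (T.next (T.next d.rev)).rev)
          (h.next_next_edge_ne (show d.rev.1 = e from hd)) hv, ← sameCusp_next,
          T.next_next_next]
      rw [if_pos hd, h1, h2]
      ring
    · rw [if_neg hd, add_zero]
      exact if_congr (h.sameCusp_iff hd hv) rfl rfl
  ext v
  by_cases hv : v.1 = e
  · have h2 : v = T'.next (T.next v.rev) := (h.next_rev v hv).symm
    rw [vertexStep_apply, if_pos hv, cuspSum_next, Dart.rev_rev, sub_self, zero_add]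
    have h3 : T'.next v.rev = T.next (T.next v.rev) := h.next_self v.rev hv
    rw [← key _ (h.next_next_edge_ne (show v.rev.1 = e from hv)), ← h3, cuspSum_next, Dart.rev_rev]
  · rw [vertexStep_apply, if_neg hv, key v hv]

end IsFlip

end SurfaceTriangulation

namespace LayeredTriangulation

open SurfaceTriangulation

variable {n : ℕ} (L : LayeredTriangulation n)

/-- The composition of the effects of the flips on functions on the vertices. -/
noncomputable def vertexLevel (i : Fin (L.N + 1)) : (Dart n → ℂ) →ₗ[ℂ] (Dart n → ℂ) :=
  Fin.induction (motive := fun _ => (Dart n → ℂ) →ₗ[ℂ] (Dart n → ℂ)) LinearMap.id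
    (fun j f => ((L.tri j.castSucc).vertexStep (L.flipAt j)).comp f) i

/-- The composition of the effects of the flips on functions on the short edges. -/
noncomputable def shortLevel (i : Fin (L.N + 1)) : (Dart n → ℂ) →ₗ[ℂ] (Dart n → ℂ) :=
  Fin.induction (motive := fun _ => (Dart n → ℂ) →ₗ[ℂ] (Dart n → ℂ)) LinearMap.id
    (fun j f => ((L.tri j.castSucc).shortStep (L.flipAt j)).comp f) i

theorem vertexLevel_zero : L.vertexLevel 0 = LinearMap.id := rfl

theorem vertexLevel_succ (j : Fin L.N) (f : Dart n → ℂ) : L.vertexLevel j.succ f =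
    (L.tri j.castSucc).vertexStep (L.flipAt j) (L.vertexLevel j.castSucc f) := rfl

theorem shortLevel_zero : L.shortLevel 0 = LinearMap.id := rfl

theorem shortLevel_succ (j : Fin L.N) (f : Dart n → ℂ) : L.shortLevel j.succ f =
    (L.tri j.castSucc).shortStep (L.flipAt j) (L.shortLevel j.castSucc f) := rfl

/-- The monodromy on the functions on the vertices. -/
noncomputable def vertexTotal : (Dart n → ℂ) →ₗ[ℂ] (Dart n → ℂ) :=
  (LinearMap.funLeft ℂ ℂ L.mono).comp (L.vertexLevel (Fin.last L.N))

/-- The monodromy on the functions on the short edges. -/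
noncomputable def shortTotal : (Dart n → ℂ) →ₗ[ℂ] (Dart n → ℂ) :=
  (LinearMap.funLeft ℂ ℂ L.mono).comp (L.shortLevel (Fin.last L.N))

theorem vertexTotal_apply (f : Dart n → ℂ) (d : Dart n) :
    L.vertexTotal f d = L.vertexLevel (Fin.last L.N) f (L.mono d) := rfl

theorem shortTotal_apply (f : Dart n → ℂ) (d : Dart n) :
    L.shortTotal f d = L.shortLevel (Fin.last L.N) f (L.mono d) := rfl

theorem sameCusp_mono (v w : Dart n) :
    (L.tri (Fin.last L.N)).SameCusp (L.mono v) (L.mono w) ↔ (L.tri 0).SameCusp v w := by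
  constructor
  · intro h f hf
    have := h (fun u => f (L.mono.symm u)) fun u => by
      obtain ⟨u, rfl⟩ := L.mono.surjective u
      rw [L.mono_next, ← L.mono_rev, Equiv.symm_apply_apply, Equiv.symm_apply_apply, hf]
    simpa using this
  · intro h f hf
    exact h (fun u => f (L.mono u)) fun u => by rw [← L.mono_next, hf, L.mono_rev]

/-- The monodromies on the functions on vertices and on short edges of the boundary circles have the
same characteristic polynomial, as the zeroth and the first cohomology of the circles are both the
space of functions on the set of circles. -/
theorem charpoly_vertexTotal : L.vertexTotal.charpoly = L.shortTotal.charpoly := by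
  refine charpoly_eq_of_exact_loop rfl (L.tri 0).cuspCoboundary (L.tri 0).cuspSum
    (cuspCoboundary_cuspSum _) (cuspSum_cuspCoboundary _) (exists_cuspSum _) _ _ ?_ ?_
  · intro f
    have key : ∀ i, (L.tri i).cuspCoboundary (L.vertexLevel i f) =
        L.shortLevel i ((L.tri 0).cuspCoboundary f) := by
      intro i
      induction i using Fin.induction with
      | zero => rfl
      | succ j ih =>
        rw [vertexLevel_succ, (L.isFlip j).cuspCoboundary_vertexStep, ih, shortLevel_succ]
    ext d
    rw [shortTotal_apply, ← key, cuspCoboundary_apply, cuspCoboundary_apply, vertexTotal_apply,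
      vertexTotal_apply, L.mono_rev, L.mono_next]
  · intro f
    have key : ∀ i, (L.tri i).cuspSum (L.shortLevel i f) =
        L.vertexLevel i ((L.tri 0).cuspSum f) := by
      intro i
      induction i using Fin.induction with
      | zero => rfl
      | succ j ih => rw [shortLevel_succ, (L.isFlip j).cuspSum_shortStep, ih, vertexLevel_succ]
    classical
    ext v
    rw [vertexTotal_apply, ← key, cuspSum_apply, cuspSum_apply]
    refine Eq.trans ?_ (Equiv.sum_comp L.mono _)
    refine Finset.sum_congr rfl fun d _ => ?_
    congr 1
    refine if_congr ?_ rfl rfl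
    rw [← L.mono_rev, sameCusp_mono]

end LayeredTriangulation

/-! ### The derivatives of the Ptolemy variables -/

/-- The linear functional `z ↦ onDart z d`. -/
noncomputable def onDartLinear {n : ℕ} (d : Dart n) : (Fin (3 * n) → ℂ) →L[ℂ] ℂ :=
  if d.2 then ContinuousLinearMap.proj d.1 else - ContinuousLinearMap.proj d.1

theorem onDartLinear_apply {n : ℕ} (d : Dart n) (z : Fin (3 * n) → ℂ) :
    onDartLinear d z = onDart z d := by
  rcases d with ⟨e, _ | _⟩ <;> simp [onDartLinear, onDart]

theorem hasFDerivAt_onDart {n : ℕ} (d : Dart n) (z : Fin (3 * n) → ℂ) :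
    HasFDerivAt (fun z => onDart z d) (onDartLinear d) z := by
  simpa only [← onDartLinear_apply] using (onDartLinear d).hasFDerivAt

/-- The derivative of `ptolemyRest` at `z`. -/
noncomputable def ptolemyRestDeriv {n : ℕ} (T : SurfaceTriangulation n) (s s' : Dart n → ℤˣ)
    (z : Fin (3 * n) → ℂ) (x : Dart n) : (Fin (3 * n) → ℂ) →L[ℂ] ℂ :=
  (- sgn (s' x * s' x.rev * s (T.next (T.next x.rev)) * s (T.next (T.next x)))) •
      (onDart z (T.next (T.next x)) • onDartLinear (T.next (T.next x.rev)) +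
        onDart z (T.next (T.next x.rev)) • onDartLinear (T.next (T.next x))) +
    sgn (s' (T.next x.rev) * s' (T.next x) * s x * s x.rev) •
      (onDart z (T.next x.rev) • onDartLinear (T.next x) +
        onDart z (T.next x) • onDartLinear (T.next x.rev))

theorem hasFDerivAt_ptolemyRest {n : ℕ} (T : SurfaceTriangulation n) (s s' : Dart n → ℤˣ)
    (z : Fin (3 * n) → ℂ) (x : Dart n) :
    HasFDerivAt (fun z => ptolemyRest T s s' z x) (ptolemyRestDeriv T s s' z x) z :=
  (((hasFDerivAt_onDart _ z).mul (hasFDerivAt_onDart _ z)).const_mul _).add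
    (((hasFDerivAt_onDart _ z).mul (hasFDerivAt_onDart _ z)).const_mul _)

/-- The derivative of `flipVars` at `z`. -/
noncomputable def flipVarsDeriv {n : ℕ} (T : SurfaceTriangulation n) (s s' : Dart n → ℤˣ)
    (e : Fin (3 * n)) (z : Fin (3 * n) → ℂ) : (Fin (3 * n) → ℂ) →L[ℂ] (Fin (3 * n) → ℂ) :=
  ContinuousLinearMap.pi fun k => if k = e then
    (z e)⁻¹ • (ptolemyRestDeriv T s s' z (e, true) -
      (ptolemyRest T s s' z (e, true) / z e) • ContinuousLinearMap.proj e)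
  else ContinuousLinearMap.proj k

theorem flipVarsDeriv_other {n : ℕ} {T : SurfaceTriangulation n} {s s' : Dart n → ℤˣ}
    {e : Fin (3 * n)} {z w : Fin (3 * n) → ℂ} {k : Fin (3 * n)} (hk : k ≠ e) :
    flipVarsDeriv T s s' e z w k = w k := by
  simp [flipVarsDeriv, hk]

theorem flipVarsDeriv_self {n : ℕ} {T : SurfaceTriangulation n} {s s' : Dart n → ℤˣ}
    {e : Fin (3 * n)} {z w : Fin (3 * n) → ℂ} :
    flipVarsDeriv T s s' e z w e = (z e)⁻¹ * (ptolemyRestDeriv T s s' z (e, true) w -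
      ptolemyRest T s s' z (e, true) / z e * w e) := by
  simp [flipVarsDeriv]

theorem hasFDerivAt_flipVars {n : ℕ} (T : SurfaceTriangulation n) (s s' : Dart n → ℤˣ)
    (e : Fin (3 * n)) (z : Fin (3 * n) → ℂ) (hz : z e ≠ 0) :
    HasFDerivAt (flipVars T s s' e) (flipVarsDeriv T s s' e z) z := by
  rw [hasFDerivAt_pi']
  intro k
  by_cases hk : k = e
  · subst hk
    have h := (hasFDerivAt_ptolemyRest T s s' z (k, true)).mul
      ((hasDerivAt_inv hz).comp_hasFDerivAt z (hasFDerivAt_apply (𝕜 := ℂ) k z))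
    have e1 : (fun z => flipVars T s s' k z k) =
        fun z : Fin (3 * n) → ℂ => ptolemyRest T s s' z (k, true) * (z k)⁻¹ := by
      ext z; simp [flipVars, div_eq_mul_inv]
    rw [e1]
    refine h.congr_fderiv (ContinuousLinearMap.ext fun w => ?_)
    refine Eq.trans ?_ flipVarsDeriv_self.symm
    change ptolemyRest T s s' z (k, true) * (-(z k ^ 2)⁻¹ * w k) +
      (z k)⁻¹ * ptolemyRestDeriv T s s' z (k, true) w = _
    field_simp
    ring
  · have e1 : (fun z => flipVars T s s' e z k) = fun z : Fin (3 * n) → ℂ => z k := by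
      ext z; simp [flipVars, hk]
    rw [e1]
    refine (hasFDerivAt_apply (𝕜 := ℂ) k z).congr_fderiv (ContinuousLinearMap.ext fun w => ?_)
    exact (flipVarsDeriv_other hk).symm

namespace PtolemyAssignment

variable {n : ℕ} {L : LayeredTriangulation n} {σ : BoundarySign L} (c : PtolemyAssignment L σ)

/-- Solving the Ptolemy equation of a tetrahedron for the new variable. -/
theorem flipVars_val (j : Fin L.N) : flipVars (L.tri j.castSucc) (σ.sign j.castSucc)
    (σ.sign j.succ) (L.flipAt j) (c.val j.castSucc) = c.val j.succ := by
  ext k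
  by_cases hk : k = L.flipAt j
  · subst hk
    have h := c.ptolemy j (L.flipAt j, true) rfl
    have hne := c.ne_zero j.castSucc (L.flipAt j)
    rw [onDart_rev] at h
    simp only [onDart, if_true] at h
    simp only [flipVars, Function.update_self]
    field_simp
    linear_combination h
  · rw [flipVars, Function.update_of_ne hk, c.val_other j k hk]

theorem levelVars_val (i : Fin (L.N + 1)) : levelVars L σ i (c.val 0) = c.val i := by
  induction i using Fin.induction with
  | zero => rfl
  | succ j ih =>
    change flipVars _ _ _ _ (levelVars L σ j.castSucc (c.val 0)) = _
    rw [ih, flipVars_val]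

/-- The derivative of `levelVars` at a Ptolemy assignment. -/
noncomputable def varLevel (i : Fin (L.N + 1)) : (Fin (3 * n) → ℂ) →L[ℂ] (Fin (3 * n) → ℂ) :=
  Fin.induction (motive := fun _ => (Fin (3 * n) → ℂ) →L[ℂ] (Fin (3 * n) → ℂ))
    (ContinuousLinearMap.id ℂ _)
    (fun j f => (flipVarsDeriv (L.tri j.castSucc) (σ.sign j.castSucc) (σ.sign j.succ)
      (L.flipAt j) (c.val j.castSucc)).comp f) i

theorem varLevel_succ (j : Fin L.N) (w : Fin (3 * n) → ℂ) : c.varLevel j.succ w =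
    flipVarsDeriv (L.tri j.castSucc) (σ.sign j.castSucc) (σ.sign j.succ)
      (L.flipAt j) (c.val j.castSucc) (c.varLevel j.castSucc w) := rfl

theorem varLevel_zero (w : Fin (3 * n) → ℂ) : c.varLevel 0 w = w := rfl

theorem hasFDerivAt_levelVars (i : Fin (L.N + 1)) :
    HasFDerivAt (levelVars L σ i) (c.varLevel i) (c.val 0) := by
  induction i using Fin.induction with
  | zero => exact hasFDerivAt_id _
  | succ j ih =>
    have h := hasFDerivAt_flipVars (L.tri j.castSucc) (σ.sign j.castSucc) (σ.sign j.succ)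
      (L.flipAt j) (c.val j.castSucc) (c.ne_zero _ _)
    rw [← levelVars_val] at h
    have h' := h.comp (c.val 0) ih
    rw [levelVars_val] at h'
    exact h'

/-- The derivative of `topVars` at a Ptolemy assignment. -/
noncomputable def varTotal : (Fin (3 * n) → ℂ) →L[ℂ] (Fin (3 * n) → ℂ) :=
  ContinuousLinearMap.pi fun k =>
    (onDartLinear (L.mono (k, true))).comp (c.varLevel (Fin.last L.N))

theorem varTotal_apply (w : Fin (3 * n) → ℂ) (k : Fin (3 * n)) :
    c.varTotal w k = onDart (c.varLevel (Fin.last L.N) w) (L.mono (k, true)) := by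
  simp [varTotal, onDartLinear_apply]

theorem hasFDerivAt_topVars : HasFDerivAt (topVars L σ) c.varTotal (c.val 0) := by
  rw [hasFDerivAt_pi']
  intro k
  exact (hasFDerivAt_onDart (L.mono (k, true)) _).comp (c.val 0)
    (c.hasFDerivAt_levelVars (Fin.last L.N))

theorem topJacobian_charpoly : (topJacobian L σ (c.val 0)).charpoly =
    LinearMap.charpoly (c.varTotal : (Fin (3 * n) → ℂ) →ₗ[ℂ] (Fin (3 * n) → ℂ)) := by
  rw [topJacobian, c.hasFDerivAt_topVars.fderiv, ← Matrix.charpoly_toLin', Matrix.toLin'_toMatrix']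

end PtolemyAssignment

/-! ### Fox calculus -/

section Fox

variable {X : Type}

theorem foxWord_append (j : X) (u v : List (X × Bool)) : foxWord j (u ++ v) =
    foxWord j u + MonoidAlgebra.of ℤ _ (FreeGroup.mk u) * foxWord j v := by
  induction u with
  | nil =>
    rw [List.nil_append, ← FreeGroup.one_eq_mk, map_one, one_mul, foxWord, zero_add]
  | cons a u ih =>
    obtain ⟨x, b⟩ := a
    have e : FreeGroup.mk ((x, b) :: u) = FreeGroup.mk [(x, b)] * FreeGroup.mk u := by
      rw [FreeGroup.mul_mk]; rfl
    cases b
    · have e' : FreeGroup.mk [(x, false)] = (FreeGroup.of x)⁻¹ := rfl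
      rw [List.cons_append, foxWord, foxWord, ih, e, e', map_mul]
      noncomm_ring
    · have e' : FreeGroup.mk [(x, true)] = FreeGroup.of x := rfl
      rw [List.cons_append, foxWord, foxWord, ih, e, e', map_mul]
      noncomm_ring

theorem foxWord_step (j : X) {u v : List (X × Bool)} (h : FreeGroup.Red.Step u v) :
    foxWord j u = foxWord j v := by
  obtain @⟨L₁, L₂, x, b⟩ := h
  rw [foxWord_append, foxWord_append]
  congr 2
  have h1 : MonoidAlgebra.of ℤ (FreeGroup X) (FreeGroup.of x) *
      MonoidAlgebra.of ℤ (FreeGroup X) (FreeGroup.of x)⁻¹ = 1 := by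
    rw [← map_mul, mul_inv_cancel, map_one]
  have h2 : MonoidAlgebra.of ℤ (FreeGroup X) (FreeGroup.of x)⁻¹ *
      MonoidAlgebra.of ℤ (FreeGroup X) (FreeGroup.of x) = 1 := by
    rw [← map_mul, inv_mul_cancel, map_one]
  cases b
  · simp only [Bool.not_false, foxWord]
    rw [add_sub_cancel_left, ← mul_assoc, h2, one_mul]
  · simp only [Bool.not_true, foxWord]
    rw [← mul_assoc, h1, one_mul, add_sub_cancel]

theorem foxWord_red (j : X) {u v : List (X × Bool)} (h : FreeGroup.Red u v) :
    foxWord j u = foxWord j v := by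
  induction h with
  | refl => rfl
  | tail _ h ih => exact ih.trans (foxWord_step j h)

theorem foxDeriv_mk (j : X) (u : List (X × Bool)) :
    foxDeriv j (FreeGroup.mk u) = foxWord j u := by
  classical
  obtain ⟨c, h1, h2⟩ := FreeGroup.Red.exact.1
    (FreeGroup.mk_toWord (x := FreeGroup.mk u))
  exact (foxWord_red j h1).trans (foxWord_red j h2).symm

theorem foxDeriv_mul (j : X) (u v : FreeGroup X) :
    foxDeriv j (u * v) = foxDeriv j u + MonoidAlgebra.of ℤ _ u * foxDeriv j v := by
  obtain ⟨a, rfl⟩ := Quot.exists_rep u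
  obtain ⟨b, rfl⟩ := Quot.exists_rep v
  change foxDeriv j (FreeGroup.mk a * FreeGroup.mk b) = foxDeriv j (FreeGroup.mk a) +
    MonoidAlgebra.of ℤ _ (FreeGroup.mk a) * foxDeriv j (FreeGroup.mk b)
  rw [FreeGroup.mul_mk, foxDeriv_mk, foxDeriv_mk, foxDeriv_mk, foxWord_append]

open scoped Classical in
theorem foxDeriv_of (j x : X) : foxDeriv j (FreeGroup.of x) = if x = j then 1 else 0 := by
  change foxDeriv j (FreeGroup.mk [(x, true)]) = _
  rw [foxDeriv_mk, foxWord, foxWord, mul_zero, add_zero]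

theorem foxDeriv_one (j : X) : foxDeriv j (1 : FreeGroup X) = 0 := by
  change foxDeriv j (FreeGroup.mk []) = _
  rw [foxDeriv_mk, foxWord]

theorem foxDeriv_inv (j : X) (u : FreeGroup X) :
    foxDeriv j u⁻¹ = - (MonoidAlgebra.of ℤ _ u⁻¹ * foxDeriv j u) := by
  have h := foxDeriv_mul j u⁻¹ u
  rw [inv_mul_cancel, foxDeriv_one] at h
  exact eq_neg_of_add_eq_zero_left h.symm

/-- A crossed homomorphism on a free group is determined by its values on the generators. -/
theorem crossed_ext {M : Type*} [AddGroup M] (a : FreeGroup X → M → M) (ha : ∀ x, a 1 x = x)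
    (f g : FreeGroup X → M) (hf : ∀ u v, f (u * v) = f u + a u (f v))
    (hg : ∀ u v, g (u * v) = g u + a u (g v))
    (h : ∀ x, f (FreeGroup.of x) = g (FreeGroup.of x)) (u : FreeGroup X) : f u = g u := by
  have key : ∀ f : FreeGroup X → M, (∀ u v, f (u * v) = f u + a u (f v)) → f 1 = 0 := by
    intro f hf
    have := hf 1 1
    rwa [mul_one, ha, left_eq_add] at this
  have kinv : ∀ f : FreeGroup X → M, (∀ u v, f (u * v) = f u + a u (f v)) → ∀ u,
      f u⁻¹ = - a u⁻¹ (f u) := by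
    intro f hf u
    have := hf u⁻¹ u
    rw [inv_mul_cancel, key f hf] at this
    exact eq_neg_of_add_eq_zero_left this.symm
  induction u using FreeGroup.induction_on with
  | C1 => rw [key f hf, key g hg]
  | of x => exact h x
  | inv_of x _ => rw [kinv f hf, kinv g hg, h]
  | mul x y hx hy => rw [hf, hg, hx, hy]

end Fox

/-! ### Wada's invariant of a fibre presentation -/

section Wada

variable {G : Type} [Group G] {k m : ℕ}

/-- The value in a representation of the Fox derivative of a word in the generators of the fibre. -/
noncomputable def foxMatrix {X : Type} (R : G →* Matrix (Fin k) (Fin k) ℂ) (gen : X → G) (l : X)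
    (w : FreeGroup X) : Matrix (Fin k) (Fin k) ℂ :=
  MonoidAlgebra.lift ℤ _ _ (R.comp (FreeGroup.lift gen)) (foxDeriv l w)

variable (R : G →* Matrix (Fin k) (Fin k) ℂ) (α : G →* Multiplicative ℤ)

theorem foxMatrix_mul {X : Type} (gen : X → G) (l : X) (u v : FreeGroup X) :
    foxMatrix R gen l (u * v) =
      foxMatrix R gen l u + R (FreeGroup.lift gen u) * foxMatrix R gen l v := by
  rw [foxMatrix, foxDeriv_mul, map_add, map_mul, MonoidAlgebra.lift_of]
  rfl

theorem foxMatrix_of {X : Type} [DecidableEq X] (gen : X → G) (l i : X) :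
    foxMatrix R gen l (FreeGroup.of i) = if i = l then 1 else 0 := by
  rw [foxMatrix, foxDeriv_of]
  split_ifs <;> simp

theorem foxEval_of {X : Type} (gen : X → G) (u : FreeGroup X) :
    foxEval R α gen (MonoidAlgebra.of ℤ _ u) = twist R α (FreeGroup.lift gen u) := by
  rw [foxEval, MonoidAlgebra.lift_of]; rfl

theorem twist_of_ker {g : G} (hg : α g = 1) : twist R α g = (R g).map LaurentPolynomial.C := by
  change (LaurentPolynomial.T (α g).toAdd : ℂ[T;T⁻¹]) • (R g).map LaurentPolynomial.C = _
  rw [hg, toAdd_one, LaurentPolynomial.T_zero, one_smul]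

theorem lift_map_some (gen : Option (Fin m) → G) (w : FreeGroup (Fin m)) :
    FreeGroup.lift gen (FreeGroup.map some w) = FreeGroup.lift (fun i => gen (some i)) w := by
  have : (FreeGroup.lift gen).comp (FreeGroup.map some) = FreeGroup.lift (fun i => gen (some i)) :=
    FreeGroup.ext_hom _ _ fun i => by simp
  exact DFunLike.congr_fun this w

variable {α} {gen : Option (Fin m) → G} {rel : Fin m → FreeGroup (Option (Fin m))}
  (hp : IsFibrePresentation α gen rel)
include hp

theorem IsFibrePresentation.alpha_lift (w : FreeGroup (Fin m)) :
    α (FreeGroup.lift (fun i => gen (some i)) w) = 1 := by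
  have : FreeGroup.lift (fun i => gen (some i)) w ∈ α.ker := by
    rw [← hp.range_eq]; exact ⟨w, rfl⟩
  exact this

/-- On words in the generators of the fibre the variable `t` does not occur in the Fox matrix. -/
theorem IsFibrePresentation.foxEval_some (l : Fin m) (w : FreeGroup (Fin m)) :
    foxEval R α gen (foxDeriv (some l) (FreeGroup.map some w)) =
      (foxMatrix R (fun i => gen (some i)) l w).map LaurentPolynomial.C := by
  classical
  refine crossed_ext (fun u x => (R (FreeGroup.lift (fun i => gen (some i)) u)).map
    LaurentPolynomial.C * x) (fun x => ?_)
    (fun w => foxEval R α gen (foxDeriv (some l) (FreeGroup.map some w)))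
    (fun w => (foxMatrix R (fun i => gen (some i)) l w).map LaurentPolynomial.C)
    (fun u v => ?_) (fun u v => ?_) (fun i => ?_) w
  · rw [map_one, map_one, Matrix.map_one _ (map_zero _) (map_one _), one_mul]
  · rw [map_mul, foxDeriv_mul, map_add, map_mul, foxEval_of, lift_map_some,
      twist_of_ker R α (hp.alpha_lift _)]
  · rw [foxMatrix_mul, Matrix.map_add _ (map_add _), Matrix.map_mul]
  · rw [FreeGroup.map.of, foxDeriv_of, foxMatrix_of]
    by_cases h : i = l
    · rw [if_pos h, if_pos (congrArg some h), map_one, Matrix.map_one _ (map_zero _) (map_one _)]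
    · rw [if_neg h, if_neg (fun h' => h (Option.some_injective _ h')), map_zero,
        Matrix.map_zero _ (map_zero _)]

/-- A word in the generators of the fibre for the conjugate of a generator by the stable letter. -/
noncomputable def IsFibrePresentation.word (i : Fin m) : FreeGroup (Fin m) := (hp.rel_eq i).choose

theorem IsFibrePresentation.rel_word (i : Fin m) : rel i =
    FreeGroup.of none * FreeGroup.of (some i) * (FreeGroup.of none)⁻¹ *
      (FreeGroup.map some (hp.word i))⁻¹ :=
  (hp.rel_eq i).choose_spec

theorem IsFibrePresentation.lift_rel (i : Fin m) : FreeGroup.lift gen (rel i) = 1 := by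
  have : rel i ∈ (FreeGroup.lift gen).ker := by
    rw [hp.presentation.2]
    exact Subgroup.subset_normalClosure ⟨i, rfl⟩
  exact this

theorem IsFibrePresentation.lift_word (i : Fin m) :
    FreeGroup.lift (fun i => gen (some i)) (hp.word i) =
      gen none * gen (some i) * (gen none)⁻¹ := by
  have h := hp.lift_rel i
  rw [hp.rel_word i, map_mul, map_mul, map_mul, map_inv, map_inv, lift_map_some,
    FreeGroup.lift_apply_of, FreeGroup.lift_apply_of, mul_inv_eq_one] at h
  exact h.symm

/-- The matrix of the action of the stable letter on the crossed homomorphisms on the fibre group,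
which are given by their values on the generators. -/
noncomputable def IsFibrePresentation.monodromy : Matrix (Fin m × Fin k) (Fin m × Fin k) ℂ :=
  Matrix.of fun p q => (R (gen none)⁻¹ *
    foxMatrix R (fun i => gen (some i)) q.1 (hp.word p.1)) p.2 q.2

/-- The Fox derivatives of the relations `s x_i s⁻¹ w_i⁻¹`. -/
theorem IsFibrePresentation.foxEval_rel (i l : Fin m) :
    foxEval R α gen (foxDeriv (some l) (rel i)) =
      (if i = l then twist R α (gen none) else 0) -
        (foxMatrix R (fun i => gen (some i)) l (hp.word i)).map LaurentPolynomial.C := by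
  have h1 := hp.lift_rel i
  rw [hp.rel_word i] at h1 ⊢
  rw [foxDeriv_mul, foxDeriv_inv, foxDeriv_mul, foxDeriv_inv, foxDeriv_mul, foxDeriv_of,
    foxDeriv_of, if_neg (by simp : ¬ (none : Option (Fin m)) = some l)]
  simp only [mul_neg, mul_zero, neg_zero, add_zero, zero_add]
  rw [← mul_assoc, ← map_mul, map_add, map_neg, map_mul (foxEval R α gen),
    foxEval_of, map_mul (foxEval R α gen), foxEval_of, h1, map_one, one_mul, hp.foxEval_some,
    FreeGroup.lift_apply_of, ← sub_eq_add_neg]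
  congr 1
  by_cases h : i = l
  · rw [if_pos h, if_pos (congrArg some h), map_one, mul_one]
  · rw [if_neg h, if_neg (fun h' => h (Option.some_injective _ h')), map_zero, mul_zero]

omit hp in
theorem det_T_sub {ι : Type*} [Fintype ι] [DecidableEq ι] (M : Matrix ι ι ℂ) :
    Matrix.det ((LaurentPolynomial.T 1 : ℂ[T;T⁻¹]) • 1 - M.map LaurentPolynomial.C) =
      Polynomial.toLaurent M.charpoly := by
  rw [Matrix.charpoly, RingHom.map_det]
  congr 1
  ext i j : 1
  by_cases h : i = j
  · subst h
    simp [Matrix.charmatrix_apply_eq]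
  · simp [h]

theorem IsFibrePresentation.twist_none :
    twist R α (gen none) = (LaurentPolynomial.T 1 : ℂ[T;T⁻¹]) •
      (R (gen none)).map LaurentPolynomial.C := by
  change (LaurentPolynomial.T (α (gen none)).toAdd : ℂ[T;T⁻¹]) •
    (R (gen none)).map LaurentPolynomial.C = _
  rw [hp.alpha_none]; rfl

theorem IsFibrePresentation.wadaDen_none (hdet : (R (gen none)).det = 1) :
    wadaDen R α gen none = (-1) ^ k * Polynomial.toLaurent (R (gen none)⁻¹).charpoly := by
  have e : (1 : Matrix (Fin k) (Fin k) ℂ[T;T⁻¹]) - twist R α (gen none) =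
      (-(R (gen none)).map LaurentPolynomial.C) * ((LaurentPolynomial.T 1 : ℂ[T;T⁻¹]) • 1 -
        (R (gen none)⁻¹).map LaurentPolynomial.C) := by
    rw [hp.twist_none, mul_sub, neg_mul, neg_mul, ← Matrix.map_mul, ← map_mul, mul_inv_cancel,
      map_one, Matrix.map_one _ (map_zero _) (map_one _), Matrix.mul_smul, mul_one]
    abel
  rw [wadaDen, map_sub, map_one, foxEval_of, FreeGroup.lift_apply_of, e, Matrix.det_mul, det_T_sub,
    Matrix.det_neg, Fintype.card_fin]
  have : ((R (gen none)).map LaurentPolynomial.C).det = (1 : ℂ[T;T⁻¹]) := by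
    rw [← RingHom.mapMatrix_apply, ← RingHom.map_det, hdet, map_one]
  rw [this, mul_one]

theorem IsFibrePresentation.det_foxEval (hdet : (R (gen none)).det = 1) :
    Matrix.det (Matrix.of fun p q : Fin m × Fin k =>
      foxEval R α gen (foxDeriv (some q.1) (rel p.1)) p.2 q.2) =
    Polynomial.toLaurent (hp.monodromy R).charpoly := by
  have e : (Matrix.of fun p q : Fin m × Fin k =>
      foxEval R α gen (foxDeriv (some q.1) (rel p.1)) p.2 q.2) =
      ((Matrix.kronecker 1 (R (gen none))).map LaurentPolynomial.C) *
        ((LaurentPolynomial.T 1 : ℂ[T;T⁻¹]) • 1 - (hp.monodromy R).map LaurentPolynomial.C) := by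
    have e1 : Matrix.kronecker (1 : Matrix (Fin m) (Fin m) ℂ) (R (gen none)) * hp.monodromy R =
        Matrix.of fun p q : Fin m × Fin k =>
          foxMatrix R (fun i => gen (some i)) q.1 (hp.word p.1) p.2 q.2 := by
      ext ⟨i, p⟩ ⟨l, q⟩
      rw [Matrix.mul_apply, Fintype.sum_prod_type, Finset.sum_eq_single i]
      · have : foxMatrix R (fun i => gen (some i)) l (hp.word i) = R (gen none) *
            (R (gen none)⁻¹ * foxMatrix R (fun i => gen (some i)) l (hp.word i)) := by
          rw [← mul_assoc, ← map_mul, mul_inv_cancel, map_one, one_mul]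
        rw [Matrix.of_apply, this, Matrix.mul_apply]
        refine Finset.sum_congr rfl fun r _ => ?_
        simp [Matrix.kroneckerMap_apply, IsFibrePresentation.monodromy]
      · intro j _ hj
        refine Finset.sum_eq_zero fun r _ => ?_
        simp [Matrix.kroneckerMap_apply, Matrix.one_apply_ne (Ne.symm hj)]
      · intro h; exact absurd (Finset.mem_univ _) h
    rw [mul_sub, ← Matrix.map_mul, e1, Matrix.mul_smul, mul_one]
    ext ⟨i, p⟩ ⟨l, q⟩ : 1
    rw [Matrix.of_apply, hp.foxEval_rel, hp.twist_none]
    by_cases h : i = l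
    · subst h
      simp [Matrix.kroneckerMap_apply]
    · simp [Matrix.kroneckerMap_apply, h, Matrix.one_apply_ne h]
  rw [e, Matrix.det_mul, det_T_sub, ← RingHom.mapMatrix_apply, ← RingHom.map_det]
  have : (Matrix.kronecker (1 : Matrix (Fin m) (Fin m) ℂ) (R (gen none))).det = 1 := by
    refine (Matrix.det_kronecker _ _).trans ?_
    rw [hdet]; simp
  rw [this, map_one, one_mul]

/-- If no generator of the fibre acts without a fixed vector, then Wada's invariant of a fibre
presentation is determined by the action of the stable letter on the crossed homomorphisms on the
fibre group and on the principal ones. -/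
theorem IsFibrePresentation.hasWadaInvariant (hdet : (R (gen none)).det = 1)
    (hfix : ∀ g, α g = 1 → (1 - R g).det = 0) (P : Polynomial ℂ)
    (hP : (hp.monodromy R).charpoly = P * (R (gen none)⁻¹).charpoly) :
    HasWadaInvariant R α gen rel (Polynomial.toLaurent P) := by
  have hden := hp.wadaDen_none R hdet
  refine ⟨⟨none, ?_⟩, ?_⟩
  · rw [hden]
    refine mul_ne_zero (pow_ne_zero _ (neg_ne_zero.2 one_ne_zero)) ?_
    rw [Ne, Polynomial.toLaurent_eq_zero]
    exact (Matrix.charpoly_monic _).ne_zero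
  · rintro (_ | j) hj e
    -- The column of the stable letter is removed; `e` permutes the remaining columns.
    · let s : {l : Option (Fin m) // l ≠ none} ≃ Fin m :=
        { toFun := fun l => l.1.get (Option.isSome_iff_ne_none.2 l.2)
          invFun := fun i => ⟨some i, by simp⟩
          left_inv := fun l => Subtype.ext (Option.some_get _)
          right_inv := fun i => rfl }
      have hs : ∀ i, (e i).1 = some (s (e i)) := fun i => (Option.some_get _).symm
      let τ : Equiv.Perm (Fin m × Fin k) := (e.trans s).prodCongr (Equiv.refl _)
      have e1 : wadaNum R α gen rel none e = Matrix.det ((Matrix.of fun p q : Fin m × Fin k =>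
          foxEval R α gen (foxDeriv (some q.1) (rel p.1)) p.2 q.2).submatrix id τ) := by
        rw [wadaNum]
        congr 1
        ext ⟨i, p⟩ ⟨l, q⟩ : 1
        simp only [Matrix.of_apply, Matrix.submatrix_apply, hs]
        rfl
      refine ⟨Equiv.Perm.sign τ * (-1) ^ k, 0, ?_⟩
      rw [e1, Matrix.det_permute', hp.det_foxEval R hdet, hP, hden, map_mul,
        LaurentPolynomial.T_zero, mul_one]
      have h1 : ((-1 : ℂ[T;T⁻¹]) ^ k) * (-1) ^ k = 1 := by rw [← mul_pow]; simp
      push_cast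
      linear_combination (-((Equiv.Perm.sign τ : ℤ) : ℂ[T;T⁻¹]) * Polynomial.toLaurent P *
        Polynomial.toLaurent (R (gen none)⁻¹).charpoly) * h1
    -- The denominator of a generator of the fibre vanishes, because it fixes a vector.
    · refine absurd ?_ hj
      have h1 : α (gen (some j)) = 1 := by
        have := hp.alpha_lift (FreeGroup.of j)
        rwa [FreeGroup.lift_apply_of] at this
      rw [wadaDen, map_sub, map_one, foxEval_of, FreeGroup.lift_apply_of, twist_of_ker R α h1]
      have : (1 : Matrix (Fin k) (Fin k) ℂ[T;T⁻¹]) - (R (gen (some j))).map LaurentPolynomial.C =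
          (1 - R (gen (some j))).map LaurentPolynomial.C := by
        rw [Matrix.map_sub _ (map_sub _), Matrix.map_one _ (map_zero _) (map_one _)]
      rw [this, ← RingHom.mapMatrix_apply, ← RingHom.map_det, hfix _ h1, map_zero]

end Wada

/-! ### Fibre presentations of extensions of the infinite cyclic group -/

section Extension

variable {G : Type} [Group G] {m : ℕ}

/-- An extension of the infinite cyclic group by a free group of finite rank has a fibre
presentation. -/
theorem exists_isFibrePresentation (α : G →* Multiplicative ℤ) (s : G)
    (hs : α s = Multiplicative.ofAdd 1) (x : Fin m → G)
    (hinj : Function.Injective (FreeGroup.lift x)) (hrange : (FreeGroup.lift x).range = α.ker) :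
    ∃ (gen : Option (Fin m) → G) (rel : Fin m → FreeGroup (Option (Fin m))),
      IsFibrePresentation α gen rel := by
  have hx : ∀ u, α (FreeGroup.lift x u) = 1 := fun u => by
    have : FreeGroup.lift x u ∈ α.ker := by rw [← hrange]; exact ⟨u, rfl⟩
    exact this
  have hker : ∀ g, α g = 1 → ∃ u, FreeGroup.lift x u = g := fun g hg => by
    have : g ∈ (FreeGroup.lift x).range := by rw [hrange]; exact hg
    exact this
  choose w hw using fun i => hker (s * x i * s⁻¹) (by
    have := hx (FreeGroup.of i)
    rw [FreeGroup.lift_apply_of] at this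
    rw [map_mul, map_mul, this, mul_one, ← map_mul, mul_inv_cancel, map_one])
  let gen : Option (Fin m) → G := fun o => o.elim s x
  let rel : Fin m → FreeGroup (Option (Fin m)) := fun i =>
    FreeGroup.of none * FreeGroup.of (some i) * (FreeGroup.of none)⁻¹ * (FreeGroup.map some (w i))⁻¹
  have hgs : ∀ u, FreeGroup.lift gen (FreeGroup.map some u) = FreeGroup.lift x u :=
    lift_map_some gen
  have hgn : FreeGroup.lift gen (FreeGroup.of none) = s := FreeGroup.lift_apply_of
  have hN : Subgroup.normalClosure (Set.range rel) ≤ (FreeGroup.lift gen).ker := by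
    refine Subgroup.normalClosure_le_normal ?_
    rintro _ ⟨i, rfl⟩
    change FreeGroup.lift gen _ = 1
    rw [map_mul, map_mul, map_mul, map_inv, map_inv, hgs, hw, hgn, FreeGroup.lift_apply_of]
    exact mul_inv_cancel _
  let N := Subgroup.normalClosure (Set.range rel)
  let π : FreeGroup (Option (Fin m)) →* FreeGroup (Option (Fin m)) ⧸ N := QuotientGroup.mk' N
  let τ := π (FreeGroup.of none)
  let ι : FreeGroup (Fin m) →* FreeGroup (Option (Fin m)) ⧸ N := π.comp (FreeGroup.map some)
  -- Conjugation by `s`, in terms of words in the fibre.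
  let θ : FreeGroup (Fin m) →* FreeGroup (Fin m) := FreeGroup.lift w
  have hθ : ∀ u, FreeGroup.lift x (θ u) = s * FreeGroup.lift x u * s⁻¹ := by
    intro u
    have : (FreeGroup.lift x).comp θ = (MulAut.conj s).toMonoidHom.comp (FreeGroup.lift x) :=
      FreeGroup.ext_hom _ _ fun i => by simp [θ, hw]
    exact DFunLike.congr_fun this u
  have hτ : ∀ u, τ * ι u * τ⁻¹ = ι (θ u) := by
    intro u
    have : (MulAut.conj τ).toMonoidHom.comp ι = ι.comp θ := FreeGroup.ext_hom _ _ fun i => by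
      have h : π (rel i) = 1 :=
        (QuotientGroup.eq_one_iff _).2 (Subgroup.subset_normalClosure ⟨i, rfl⟩)
      simp only [rel, map_mul, map_inv, mul_inv_eq_one] at h
      simpa [θ, ι, τ] using h
    exact DFunLike.congr_fun this u
  -- As `θ` is surjective, the presented group may also be conjugated by the inverse of `s`.
  have hτ' : ∀ u, ∃ u', τ⁻¹ * ι u = ι u' * τ⁻¹ := by
    intro u
    obtain ⟨u', hu'⟩ := hker (s⁻¹ * FreeGroup.lift x u * s) (by
      rw [map_mul, map_mul, hx, mul_one, ← map_mul, inv_mul_cancel, map_one])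
    have : θ u' = u := hinj (by rw [hθ, hu']; group)
    refine ⟨u', ?_⟩
    rw [← this, ← hτ]
    group
  -- In the presented group every element is a product of a word in the fibre and a power of `s`.
  have hform : ∀ g : FreeGroup (Option (Fin m)), ∀ (u : FreeGroup (Fin m)) (k : ℤ), ∃ u' k',
      π g * (ι u * τ ^ k) = ι u' * τ ^ (k' : ℤ) := by
    intro g
    induction g using FreeGroup.induction_on with
    | C1 => exact fun u k => ⟨u, k, by rw [map_one, one_mul]⟩
    | of o =>
      intro u k
      rcases o with _ | i
      · refine ⟨θ u, 1 + k, ?_⟩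
        rw [← hτ, zpow_add, zpow_one]
        simp only [mul_assoc, inv_mul_cancel_left]
        rfl
      · exact ⟨FreeGroup.of i * u, k, by rw [map_mul, mul_assoc]; simp [ι]⟩
    | inv_of o _ =>
      intro u k
      rcases o with _ | i
      · obtain ⟨u', hu'⟩ := hτ' u
        refine ⟨u', -1 + k, ?_⟩
        rw [map_inv, ← mul_assoc, hu', zpow_add, zpow_neg_one, mul_assoc]
      · exact ⟨(FreeGroup.of i)⁻¹ * u, k, by rw [map_mul, mul_assoc]; simp [ι]⟩
    | mul g h hg hh =>
      intro u k
      obtain ⟨u', k', h1⟩ := hh u k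
      obtain ⟨u'', k'', h2⟩ := hg u' k'
      exact ⟨u'', k'', by rw [map_mul, mul_assoc, h1, h2]⟩
  refine ⟨gen, rel, ⟨⟨?_, ?_⟩, ?_, ?_, hs, fun i => ⟨w i, rfl⟩⟩⟩
  · intro g
    obtain ⟨u, hu⟩ := hker (g * (s ^ (α g).toAdd)⁻¹) (by
      rw [map_mul, map_inv, map_zpow, hs, ← ofAdd_zsmul, smul_eq_mul, mul_one, ofAdd_toAdd,
        mul_inv_cancel])
    refine ⟨FreeGroup.map some u * FreeGroup.of none ^ (α g).toAdd, ?_⟩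
    rw [map_mul, map_zpow, hgs, hgn, hu]
    group
  · refine le_antisymm ?_ hN
    intro g hg
    obtain ⟨u, k, h⟩ := hform g 1 0
    rw [map_one, zpow_zero, mul_one, mul_one] at h
    have h' : FreeGroup.lift gen g = FreeGroup.lift x u * s ^ k := by
      have h1 : π g = π (FreeGroup.map some u * FreeGroup.of none ^ k) := by
        rw [h, map_mul, map_zpow]; rfl
      have h2 := hN (QuotientGroup.eq.1 h1)
      have h3 : FreeGroup.lift gen (g⁻¹ * (FreeGroup.map some u * FreeGroup.of none ^ k)) = 1 := h2
      rw [map_mul, map_inv, inv_mul_eq_one, map_mul, map_zpow, hgs, hgn] at h3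
      exact h3
    rw [show FreeGroup.lift gen g = 1 from hg] at h'
    have hk : k = 0 := by
      have := congrArg α h'
      rw [map_one, map_mul, hx, one_mul, map_zpow, hs, ← ofAdd_zsmul, smul_eq_mul, mul_one] at this
      exact (Multiplicative.ofAdd.injective this).symm
    subst hk
    rw [zpow_zero, mul_one] at h'
    have hu : u = 1 := hinj (by rw [← h', map_one])
    subst hu
    rw [map_one, zpow_zero, mul_one] at h
    exact (QuotientGroup.eq_one_iff g).1 h
  · exact hinj
  · exact hrange

/-- A finitely generated free group has a finite basis: it has only finitely many homomorphisms to
a group of order two. -/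
theorem finite_of_fg_freeGroup {B : Type*} [hB : Group.FG (FreeGroup B)] : Finite B := by
  classical
  obtain ⟨S, hS⟩ := hB.out
  have h1 : Function.Injective fun (φ : B → Multiplicative (ZMod 2)) (g : S) =>
      FreeGroup.lift φ g.1 := by
    intro φ ψ h
    have : FreeGroup.lift φ = FreeGroup.lift ψ :=
      MonoidHom.eq_of_eqOn_dense hS fun g hg => congrFun h ⟨g, hg⟩
    exact FreeGroup.lift.injective this
  have h2 : Finite (B → Multiplicative (ZMod 2)) := Finite.of_injective _ h1
  refine Finite.of_injective
    (fun b : B => (Pi.mulSingle b (Multiplicative.ofAdd 1) : B → Multiplicative (ZMod 2))) ?_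
  intro b b' h
  by_contra hne
  have := congrFun h b
  simp only [Pi.mulSingle_eq_same, Pi.mulSingle_eq_of_ne hne] at this
  exact absurd this (by decide)

end Extension

/-! ### Morphisms of the fundamental groupoid -/

section Groupoid

variable {n : ℕ} {L : LayeredTriangulation n}

/-- A vertex of the cell structure as an object of the fundamental groupoid. -/
abbrev TVertex.ob (x : TVertex L) : TGroupoid L := ⟨(Quiver.FreeGroupoid.of (TVertex L)).obj x⟩

/-- An edge of the cell structure as a morphism of the fundamental groupoid. -/
def TEdge.mor {x y : TVertex L} (f : TEdge L x y) : x.ob ⟶ y.ob :=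
  (CategoryTheory.Quotient.functor (TRel L)).map f.gen

/-- Every morphism of the fundamental groupoid is a composition of edges and their inverses. -/
theorem TGroupoid.hom_induction {x : TVertex L} (P : ∀ y : TVertex L, (x.ob ⟶ y.ob) → Prop)
    (h1 : P x (𝟙 _))
    (h2 : ∀ (y z : TVertex L) (f : x.ob ⟶ y.ob) (e : TEdge L y z), P y f → P z (f ≫ e.mor))
    (h3 : ∀ (y z : TVertex L) (f : x.ob ⟶ y.ob) (e : TEdge L z y), P y f → P z (f ≫ inv e.mor))
    (y : TVertex L) (f : x.ob ⟶ y.ob) : P y f := by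
  obtain ⟨f, rfl⟩ := (CategoryTheory.Quotient.functor (TRel L)).map_surjective
    (X := (Quiver.FreeGroupoid.of (TVertex L)).obj x)
    (Y := (Quiver.FreeGroupoid.of (TVertex L)).obj y) f
  obtain ⟨f, rfl⟩ := Quot.exists_rep f
  change Quiver.Path (V := Quiver.Symmetrify (TVertex L)) x y at f
  induction f with
  | nil => exact h1
  | cons p e ih =>
    rcases e with e | e
    · exact h2 _ _ _ e ih
    · have := h3 _ _ _ e ih
      rw [← Groupoid.inv_eq_inv] at this
      exact this

variable {H : Type} [Group H] (w : ∀ {x y : TVertex L}, TEdge L x y → H)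
  (hw : ∀ (x y : Quiver.FreeGroupoid (TVertex L)) (f g : x ⟶ y), TRel L f g →
      (TEdge.labelFunctor w).map f = (TEdge.labelFunctor w).map g)

/-- The product of the labels along a morphism of the fundamental groupoid. -/
def TGroupoid.eval {x y : TGroupoid L} (f : x ⟶ y) : H :=
  MulOpposite.unop (show Hᵐᵒᵖ from
    (CategoryTheory.Quotient.lift (TRel L) (TEdge.labelFunctor w) hw).map f)

theorem TGroupoid.eval_comp {x y z : TGroupoid L} (f : x ⟶ y) (g : y ⟶ z) :
    TGroupoid.eval w hw (f ≫ g) = TGroupoid.eval w hw f * TGroupoid.eval w hw g :=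
  congrArg MulOpposite.unop
    ((CategoryTheory.Quotient.lift (TRel L) (TEdge.labelFunctor w) hw).map_comp f g)

theorem TGroupoid.eval_id (x : TGroupoid L) : TGroupoid.eval w hw (𝟙 x) = 1 :=
  congrArg MulOpposite.unop
    ((CategoryTheory.Quotient.lift (TRel L) (TEdge.labelFunctor w) hw).map_id x)

theorem TGroupoid.eval_inv {x y : TGroupoid L} (f : x ⟶ y) :
    TGroupoid.eval w hw (inv f) = (TGroupoid.eval w hw f)⁻¹ := by
  rw [eq_inv_iff_mul_eq_one, ← TGroupoid.eval_comp, IsIso.inv_hom_id, TGroupoid.eval_id]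

theorem TGroupoid.eval_mor {x y : TVertex L} (f : TEdge L x y) :
    TGroupoid.eval w hw f.mor = w f :=
  congrArg MulOpposite.unop (TEdge.labelFunctor_gen w f)

end Groupoid

/-! ### Labels in a group -/

/-- Labels in a group `H` on the edges of the cell structure, compatible with the 2-cells. Long and
short edges are indexed by oriented edges of the surfaces `tri i`; the label `up i d` is only
relevant if `d` is not flipped. The fields starting with `long_rev` are the relations of the
2-cells, which are listed in `TRel`. -/
structure GroupLabels {n : ℕ} (L : LayeredTriangulation n) (H : Type) [Group H] where
  long : Fin (L.N + 1) → Dart n → H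
  short : Fin (L.N + 1) → Dart n → H
  up : Fin L.N → Dart n → H
  close : Dart n → H
  long_rev : ∀ i d, long i d * long i d.rev = 1
  hexagon : ∀ i d, long i d * short i d * (long i ((L.tri i).next d) * short i ((L.tri i).next d)) *
    (long i ((L.tri i).next ((L.tri i).next d)) * short i ((L.tri i).next ((L.tri i).next d))) = 1
  up_long : ∀ (i : Fin L.N) d, d.1 ≠ L.flipAt i →
    up i d * long i.succ d = long i.castSucc d * up i d.rev
  up_short : ∀ (i : Fin L.N) d, ¬ (L.tri i.castSucc).Touches (L.flipAt i) d →
    up i d.rev * short i.succ d = short i.castSucc d * up i ((L.tri i.castSucc).next d)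
  below : ∀ (i : Fin L.N) y, y.1 = L.flipAt i →
    short i.castSucc ((L.tri i.castSucc).next ((L.tri i.castSucc).next y)) *
      short i.castSucc y.rev * up i ((L.tri i.castSucc).next y.rev) =
    up i ((L.tri i.castSucc).next ((L.tri i.castSucc).next y)).rev *
      short i.succ ((L.tri i.castSucc).next ((L.tri i.castSucc).next y))
  above : ∀ (i : Fin L.N) y, y.1 = L.flipAt i →
    up i ((L.tri i.castSucc).next y).rev * short i.succ ((L.tri i.castSucc).next y) *
      short i.succ y =
    short i.castSucc ((L.tri i.castSucc).next y) *
      up i ((L.tri i.castSucc).next ((L.tri i.castSucc).next y))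
  close_long : ∀ d, close d * long 0 d = long (Fin.last L.N) (L.mono d) * close d.rev
  close_short : ∀ d, close d.rev * short 0 d =
    short (Fin.last L.N) (L.mono d) * close ((L.tri 0).next d)

section LoopLabels

variable {n : ℕ} {L : LayeredTriangulation n} {d₀ : Dart n}

/-- Given paths from the base point to all vertices, every edge of the cell structure becomes a
loop. -/
noncomputable def TEdge.loop (p : ∀ x : TVertex L, TGroupoid.base L d₀ ⟶ x.ob) {x y : TVertex L}
    (f : TEdge L x y) : TGroup L d₀ :=
  p x ≫ f.mor ≫ inv (p y)

theorem TEdge.loop_mul (p : ∀ x : TVertex L, TGroupoid.base L d₀ ⟶ x.ob) {x y z : TVertex L}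
    (f : x.ob ⟶ y.ob) (g : y.ob ⟶ z.ob) :
    ((p x ≫ f ≫ inv (p y) : TGroup L d₀) * (p y ≫ g ≫ inv (p z) : TGroup L d₀) : TGroup L d₀) =
      p x ≫ (f ≫ g) ≫ inv (p z) := by
  change (p x ≫ f ≫ inv (p y)) ≫ (p y ≫ g ≫ inv (p z)) = _
  simp

theorem TEdge.loop_one (p : ∀ x : TVertex L, TGroupoid.base L d₀ ⟶ x.ob) (x : TVertex L) :
    (p x ≫ 𝟙 x.ob ≫ inv (p x) : TGroup L d₀) = 1 := by
  rw [Category.id_comp, IsIso.hom_inv_id]; rfl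

theorem TEdge.loop_long (p : ∀ x : TVertex L, TGroupoid.base L d₀ ⟶ x.ob) {i : Fin (L.N + 1)}
    {d d' : Dart n} (h : d.rev = d') :
    (TEdge.long i d d.rev rfl).loop p = (TEdge.long i d d' h).loop p := by
  subst h; rfl

theorem TEdge.loop_short (p : ∀ x : TVertex L, TGroupoid.base L d₀ ⟶ x.ob) {i : Fin (L.N + 1)}
    {d r d' : Dart n} (hr : d.rev = r) (h : (L.tri i).next d = d') :
    (TEdge.short i d d.rev _ rfl rfl).loop p = (TEdge.short i d r d' hr h).loop p := by
  subst hr h; rfl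

/-- The loops of the edges of the cell structure, as labels in the fundamental group. -/
noncomputable def loopLabels (p : ∀ x : TVertex L, TGroupoid.base L d₀ ⟶ x.ob) :
    GroupLabels L (TGroup L d₀) where
  long i d := (TEdge.long i d d.rev rfl).loop p
  short i d := (TEdge.short i d d.rev _ rfl rfl).loop p
  up i d := open scoped Classical in if h : d.1 ≠ L.flipAt i then (TEdge.up i d h).loop p else 1
  close d := (TEdge.close d _ rfl).loop p
  long_rev i d := by
    rw [TEdge.loop_long p (Dart.rev_rev d)]
    simp only [TEdge.loop, TEdge.loop_mul]
    rw [← TEdge.loop_one p]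
    congr 2
    exact CategoryTheory.Quotient.sound _ (TRel.long i d d.rev rfl (Dart.rev_rev d))
  hexagon i d := by
    rw [TEdge.loop_short p rfl ((L.tri i).next_next_next d)]
    simp only [TEdge.loop, TEdge.loop_mul]
    rw [← TEdge.loop_one p]
    congr 2
    have := CategoryTheory.Quotient.sound _ (TRel.hexagon i d _ _ _ _ _ rfl rfl rfl rfl rfl
      ((L.tri i).next_next_next d))
    refine Eq.trans ?_ this
    simp only [Functor.map_comp, Category.assoc]
    rfl
  up_long i d h := by
    rw [dif_pos h, dif_pos (show d.rev.1 ≠ _ from h)]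
    simp only [TEdge.loop, TEdge.loop_mul]
    congr 2
    exact CategoryTheory.Quotient.sound _ (TRel.upLong i d d.rev rfl h h)
  up_short i d h := by
    have h1 : d.1 ≠ L.flipAt i := fun k => h (Or.inl k)
    have h2 : ((L.tri i.castSucc).next d).1 ≠ L.flipAt i := fun k => h (Or.inr (Or.inl k))
    have h3 := (L.isFlip i).next_other d h
    rw [dif_pos (show d.rev.1 ≠ _ from h1), dif_pos h2, TEdge.loop_short p rfl h3]
    simp only [TEdge.loop, TEdge.loop_mul]
    congr 2
    exact CategoryTheory.Quotient.sound _ (TRel.upShort i d d.rev _ rfl rfl h3 h1 h2 h)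
  below i y hy := by
    have h1 := (L.isFlip i).next_next_edge_ne hy
    have h2 := (L.isFlip i).next_edge_ne (show y.rev.1 = L.flipAt i from hy)
    have h3 := (L.isFlip i).next_third y hy
    have h4 := (L.tri i.castSucc).next_next_next y
    rw [dif_pos h2, dif_pos (show ((L.tri i.castSucc).next ((L.tri i.castSucc).next y)).rev.1 ≠ _
      from h1), TEdge.loop_short p rfl h3, TEdge.loop_short p rfl h4,
      TEdge.loop_short p (Dart.rev_rev y) rfl]
    simp only [TEdge.loop, TEdge.loop_mul]
    congr 2
    have := CategoryTheory.Quotient.sound _ (TRel.below i y y.rev _ _ _ hy (Dart.rev_rev y) rfl h4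
      rfl h3 h1 h2)
    refine Eq.trans ?_ this
    simp only [Functor.map_comp, Category.assoc]
    rfl
  above i y hy := by
    have h1 := (L.isFlip i).next_edge_ne hy
    have h2 := (L.isFlip i).next_next_edge_ne hy
    have h3 := (L.isFlip i).next_next_eq hy
    have h4 := (L.isFlip i).next_self y hy
    rw [dif_pos h2, dif_pos (show ((L.tri i.castSucc).next y).rev.1 ≠ _ from h1),
      TEdge.loop_short p rfl h3, TEdge.loop_short p rfl h4]
    simp only [TEdge.loop, TEdge.loop_mul]
    congr 2
    have := CategoryTheory.Quotient.sound _ (TRel.above i y.rev y _ _ _ hy rfl rfl h3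
      h4 rfl h1 h2)
    refine Eq.trans ?_ this
    simp only [Functor.map_comp, Category.assoc]
    rfl
  close_long d := by
    rw [TEdge.loop_long p (L.mono_rev d).symm]
    simp only [TEdge.loop, TEdge.loop_mul]
    congr 2
    exact CategoryTheory.Quotient.sound _ (TRel.closeLong d d.rev _ _ rfl rfl rfl
      (L.mono_rev d).symm)
  close_short d := by
    rw [TEdge.loop_short p (L.mono_rev d).symm (L.mono_next d)]
    simp only [TEdge.loop, TEdge.loop_mul]
    congr 2
    exact CategoryTheory.Quotient.sound _ (TRel.closeShort d d.rev _ _ _ _ rfl rfl rfl rfl rfl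
      (L.mono_rev d).symm (L.mono_next d))

end LoopLabels

/-! ### Labels of the short edges under flips -/

namespace SurfaceTriangulation

variable {n : ℕ} {H : Type} [Group H] {K : Type} [Group K]

/-- Labels of the short edges which satisfy the hexagon relations, when all long edges have the
trivial label. -/
def IsTriangular (T : SurfaceTriangulation n) (s : Dart n → H) : Prop :=
  ∀ d, s d * s (T.next d) * s (T.next (T.next d)) = 1

/-- The effect of a flip at `e` on the labels of the short edges, when all long edges and all
vertical edges have the trivial label. The 2-cells of the tetrahedron leave one label free, as new
vertices are created; the choice made at the flipped edge has the same form for both of its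
orientations. -/
def cornerStep (T : SurfaceTriangulation n) (e : Fin (3 * n)) (s : Dart n → H) (d : Dart n) : H :=
  if d.1 = e then (s (T.next (T.next d)))⁻¹
  else if (T.next (T.next d)).1 = e then (s (T.next (T.next d)))⁻¹
  else if (T.next d).1 = e then s d * s (T.next d).rev
  else s d

/-- The inverse of `cornerStep`. -/
def cornerBack (T : SurfaceTriangulation n) (e : Fin (3 * n)) (t : Dart n → H) (d : Dart n) : H :=
  if d.1 = e then (t (T.next d))⁻¹
  else if (T.next (T.next d)).1 = e then t d * t (T.next (T.next d))
  else if (T.next d).1 = e then (t (T.next d))⁻¹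
  else t d

theorem map_cornerStep (f : H →* K) (T : SurfaceTriangulation n) (e : Fin (3 * n))
    (s : Dart n → H) (d : Dart n) :
    f (T.cornerStep e s d) = T.cornerStep e (fun d => f (s d)) d := by
  unfold cornerStep
  split_ifs <;> simp

theorem map_cornerBack (f : H →* K) (T : SurfaceTriangulation n) (e : Fin (3 * n))
    (s : Dart n → H) (d : Dart n) :
    f (T.cornerBack e s d) = T.cornerBack e (fun d => f (s d)) d := by
  unfold cornerBack
  split_ifs <;> simp

variable {T T' : SurfaceTriangulation n} {e : Fin (3 * n)}

theorem cornerStep_self (s : Dart n → H) {y : Dart n} (hy : y.1 = e) :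
    T.cornerStep e s y = (s (T.next (T.next y)))⁻¹ := by
  rw [cornerStep, if_pos hy]

theorem cornerStep_other (s : Dart n → H) {d : Dart n} (hd : ¬ T.Touches e d) :
    T.cornerStep e s d = s d := by
  rw [cornerStep, if_neg fun k => hd (Or.inl k), if_neg fun k => hd (Or.inr (Or.inr k)),
    if_neg fun k => hd (Or.inr (Or.inl k))]

theorem cornerBack_self (s : Dart n → H) {y : Dart n} (hy : y.1 = e) :
    T.cornerBack e s y = (s (T.next y))⁻¹ := by
  rw [cornerBack, if_pos hy]

theorem cornerBack_other (s : Dart n → H) {d : Dart n} (hd : ¬ T.Touches e d) :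
    T.cornerBack e s d = s d := by
  rw [cornerBack, if_neg fun k => hd (Or.inl k), if_neg fun k => hd (Or.inr (Or.inr k)),
    if_neg fun k => hd (Or.inr (Or.inl k))]

section IsFlip

variable (h : T.IsFlip T' e)
include h

theorem IsFlip.cornerStep_next (s : Dart n → H) {y : Dart n} (hy : y.1 = e) :
    T.cornerStep e s (T.next y) = (s y)⁻¹ := by
  rw [cornerStep, if_neg (h.next_edge_ne hy), T.next_next_next, if_pos hy]

theorem IsFlip.cornerStep_third (s : Dart n → H) {y : Dart n} (hy : y.1 = e) :
    T.cornerStep e s (T.next (T.next y)) = s (T.next (T.next y)) * s y.rev := by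
  rw [cornerStep, if_neg (h.next_next_edge_ne hy), T.next_next_next,
    if_neg (h.next_edge_ne hy), T.next_next_next, if_pos hy]

theorem IsFlip.cornerBack_next (s : Dart n → H) {y : Dart n} (hy : y.1 = e) :
    T.cornerBack e s (T.next y) = s (T.next y) * s y := by
  rw [cornerBack, if_neg (h.next_edge_ne hy), T.next_next_next, if_pos hy]

theorem IsFlip.cornerBack_third (s : Dart n → H) {y : Dart n} (hy : y.1 = e) :
    T.cornerBack e s (T.next (T.next y)) = (s y)⁻¹ := by
  rw [cornerBack, if_neg (h.next_next_edge_ne hy), T.next_next_next,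
    if_neg (h.next_edge_ne hy), T.next_next_next, if_pos hy]

theorem IsFlip.isTriangular_cornerStep {s : Dart n → H} (hs : T.IsTriangular s) :
    T'.IsTriangular (T.cornerStep e s) := by
  have key : ∀ y : Dart n, y.1 = e → T.cornerStep e s (T.next (T.next y)) *
      T.cornerStep e s (T.next y.rev) * T.cornerStep e s y = 1 := by
    intro y hy
    rw [h.cornerStep_third s hy, h.cornerStep_next s (show y.rev.1 = e from hy),
      cornerStep_self s hy]
    group
  intro d
  refine T.dart_cases e d _ (fun hu => ?_) (fun y hy hu => ?_) (fun y hy hu => ?_) fun hu => ?_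
  · rw [h.next_self d hu, h.next_third d hu, mul_assoc, mul_eq_one_comm]
    exact key d hu
  · subst hu
    rw [h.next_next_eq hy, h.next_self y.rev hy, mul_eq_one_comm, ← mul_assoc]
    have := key y.rev hy
    rwa [Dart.rev_rev] at this
  · subst hu
    rw [h.next_third y hy, h.next_rev y hy]
    exact key y hy
  · have h1 := PtolemyAssignment.touches_next hu
    have h2 := PtolemyAssignment.touches_next h1
    rw [h.next_other d hu, h.next_other _ h1, cornerStep_other s hu, cornerStep_other s h1,
      cornerStep_other s h2]
    exact hs d

theorem IsFlip.isTriangular_cornerBack {t : Dart n → H} (ht : T'.IsTriangular t) :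
    T.IsTriangular (T.cornerBack e t) := by
  have key : ∀ y : Dart n, y.1 = e → T.cornerBack e t y *
      T.cornerBack e t (T.next y) * T.cornerBack e t (T.next (T.next y)) = 1 := by
    intro y hy
    rw [h.cornerBack_third t hy, h.cornerBack_next t hy, cornerBack_self t hy]
    group
  intro d
  refine T.dart_cases e d _ (fun hu => ?_) (fun y hy hu => ?_) (fun y hy hu => ?_) fun hu => ?_
  · exact key d hu
  · subst hu
    rw [T.next_next_next, mul_eq_one_comm, ← mul_assoc]
    exact key y hy
  · subst hu
    rw [T.next_next_next, mul_assoc, mul_eq_one_comm]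
    exact key y hy
  · have h1 := PtolemyAssignment.touches_next hu
    have h2 := PtolemyAssignment.touches_next h1
    rw [cornerBack_other t hu, cornerBack_other t h1, cornerBack_other t h2]
    have := ht d
    rwa [h.next_other d hu, h.next_other _ h1] at this

theorem IsFlip.cornerBack_cornerStep {s : Dart n → H} (hs : T.IsTriangular s) :
    T.cornerBack e (T.cornerStep e s) = s := by
  ext d
  refine T.dart_cases e d _ (fun hu => ?_) (fun y hy hu => ?_) (fun y hy hu => ?_) fun hu => ?_
  · rw [cornerBack_self _ hu, h.cornerStep_next s hu, inv_inv]
  · subst hu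
    rw [h.cornerBack_next _ hy, h.cornerStep_next s hy, cornerStep_self s hy]
    have := hs y
    rw [mul_assoc] at this
    rw [eq_inv_of_mul_eq_one_left this]
    group
  · subst hu
    rw [h.cornerBack_third _ hy, cornerStep_self s hy, inv_inv]
  · rw [cornerBack_other _ hu, cornerStep_other s hu]

theorem IsFlip.cornerStep_cornerBack {t : Dart n → H} (ht : T'.IsTriangular t) :
    T.cornerStep e (T.cornerBack e t) = t := by
  ext d
  refine T.dart_cases e d _ (fun hu => ?_) (fun y hy hu => ?_) (fun y hy hu => ?_) fun hu => ?_
  · rw [cornerStep_self _ hu, h.cornerBack_third t hu, inv_inv]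
  · subst hu
    rw [h.cornerStep_next _ hy, cornerBack_self t hy, inv_inv]
  · subst hu
    rw [h.cornerStep_third _ hy, h.cornerBack_third t hy, cornerBack_self t
      (show y.rev.1 = e from hy)]
    have := ht (T.next (T.next y))
    rw [h.next_third y hy, h.next_rev y hy] at this
    rw [← mul_inv_rev, inv_eq_iff_mul_eq_one, mul_eq_one_comm, ← mul_assoc]
    exact this
  · rw [cornerStep_other _ hu, cornerBack_other t hu]

end IsFlip

end SurfaceTriangulation

namespace LayeredTriangulation

open SurfaceTriangulation

variable {n : ℕ} (L : LayeredTriangulation n) {H : Type} [Group H] {K : Type} [Group K]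

/-- The composition of the effects of the flips on the labels of the short edges. -/
def cornerLevel (s : Dart n → H) (i : Fin (L.N + 1)) : Dart n → H :=
  Fin.induction (motive := fun _ => Dart n → H) s
    (fun j t => (L.tri j.castSucc).cornerStep (L.flipAt j) t) i

/-- The inverse of `cornerLevel`. -/
def cornerLevelBack (i : Fin (L.N + 1)) : (Dart n → H) → (Dart n → H) :=
  Fin.induction (motive := fun _ => (Dart n → H) → (Dart n → H)) id
    (fun j f t => f ((L.tri j.castSucc).cornerBack (L.flipAt j) t)) i

theorem cornerLevel_zero (s : Dart n → H) : L.cornerLevel s 0 = s := rfl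

theorem cornerLevel_succ (s : Dart n → H) (j : Fin L.N) : L.cornerLevel s j.succ =
    (L.tri j.castSucc).cornerStep (L.flipAt j) (L.cornerLevel s j.castSucc) := rfl

theorem cornerLevelBack_succ (t : Dart n → H) (j : Fin L.N) : L.cornerLevelBack j.succ t =
    L.cornerLevelBack j.castSucc ((L.tri j.castSucc).cornerBack (L.flipAt j) t) := rfl

theorem map_cornerLevel (f : H →* K) (s : Dart n → H) (i : Fin (L.N + 1)) (d : Dart n) :
    f (L.cornerLevel s i d) = L.cornerLevel (fun d => f (s d)) i d := by
  induction i using Fin.induction generalizing d with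
  | zero => rfl
  | succ j ih => simp only [cornerLevel_succ, map_cornerStep, ih]

theorem map_cornerLevelBack (f : H →* K) (i : Fin (L.N + 1)) (t : Dart n → H) (d : Dart n) :
    f (L.cornerLevelBack i t d) = L.cornerLevelBack i (fun d => f (t d)) d := by
  induction i using Fin.induction generalizing t with
  | zero => rfl
  | succ j ih => simp only [cornerLevelBack_succ, map_cornerBack, ih]

theorem isTriangular_cornerLevel {s : Dart n → H} (hs : (L.tri 0).IsTriangular s)
    (i : Fin (L.N + 1)) : (L.tri i).IsTriangular (L.cornerLevel s i) := by
  induction i using Fin.induction with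
  | zero => exact hs
  | succ j ih => exact (L.isFlip j).isTriangular_cornerStep ih

theorem isTriangular_cornerLevelBack (i : Fin (L.N + 1)) {t : Dart n → H}
    (ht : (L.tri i).IsTriangular t) : (L.tri 0).IsTriangular (L.cornerLevelBack i t) := by
  induction i using Fin.induction generalizing t with
  | zero => exact ht
  | succ j ih => exact ih ((L.isFlip j).isTriangular_cornerBack ht)

theorem cornerLevelBack_cornerLevel {s : Dart n → H} (hs : (L.tri 0).IsTriangular s)
    (i : Fin (L.N + 1)) : L.cornerLevelBack i (L.cornerLevel s i) = s := by
  induction i using Fin.induction with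
  | zero => rfl
  | succ j ih =>
    rw [cornerLevelBack_succ, cornerLevel_succ,
      (L.isFlip j).cornerBack_cornerStep (L.isTriangular_cornerLevel hs _), ih]

theorem cornerLevel_cornerLevelBack (i : Fin (L.N + 1)) {t : Dart n → H}
    (ht : (L.tri i).IsTriangular t) : L.cornerLevel (L.cornerLevelBack i t) i = t := by
  induction i using Fin.induction generalizing t with
  | zero => rfl
  | succ j ih =>
    rw [cornerLevelBack_succ, cornerLevel_succ, ih ((L.isFlip j).isTriangular_cornerBack ht),
      (L.isFlip j).cornerStep_cornerBack ht]

theorem isTriangular_comp_mono {t : Dart n → H}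
    (ht : (L.tri (Fin.last L.N)).IsTriangular t) :
    (L.tri 0).IsTriangular fun d => t (L.mono d) := fun d => by
  beta_reduce
  rw [← L.mono_next ((L.tri 0).next d), ← L.mono_next d]
  exact ht _

theorem isTriangular_comp_mono_symm {t : Dart n → H} (ht : (L.tri 0).IsTriangular t) :
    (L.tri (Fin.last L.N)).IsTriangular fun d => t (L.mono.symm d) := fun d => by
  obtain ⟨d, rfl⟩ := L.mono.surjective d
  rw [L.mono_next, L.mono_next]
  simpa using ht d

end LayeredTriangulation

/-! ### Free groups with triangular generators -/

namespace SurfaceTriangulation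

variable {n : ℕ} (T : SurfaceTriangulation n) {H : Type} [Group H]

/-- A choice of one oriented edge in each triangle. -/
def IsMarked (d : Dart n) : Prop :=
  Fintype.equivFin (Dart n) d < Fintype.equivFin (Dart n) (T.next d) ∧
    Fintype.equivFin (Dart n) d < Fintype.equivFin (Dart n) (T.next (T.next d))

/-- In each triangle exactly one of the three oriented edges is marked. -/
theorem isMarked_cases (d : Dart n) :
    (T.IsMarked d ∧ ¬ T.IsMarked (T.next d) ∧ ¬ T.IsMarked (T.next (T.next d))) ∨
    (¬ T.IsMarked d ∧ T.IsMarked (T.next d) ∧ ¬ T.IsMarked (T.next (T.next d))) ∨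
    (¬ T.IsMarked d ∧ ¬ T.IsMarked (T.next d) ∧ T.IsMarked (T.next (T.next d))) := by
  have hne : ∀ d, Fintype.equivFin (Dart n) d ≠ Fintype.equivFin (Dart n) (T.next d) :=
    fun d h => T.next_ne d ((Fintype.equivFin (Dart n)).injective h).symm
  have h1 := hne d
  have h2 := hne (T.next d)
  have h3 := hne (T.next (T.next d))
  unfold IsMarked
  rw [T.next_next_next] at h3 ⊢
  omega

open scoped Classical in
/-- The triangular labels in the free group on the oriented edges which are not marked. -/
noncomputable def freeLabel (d : Dart n) : FreeGroup {d : Dart n // ¬ T.IsMarked d} :=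
  if h : T.IsMarked d then
    (if h1 : T.IsMarked (T.next d) then 1 else if h2 : T.IsMarked (T.next (T.next d)) then 1 else
      (FreeGroup.of ⟨T.next d, h1⟩ * FreeGroup.of ⟨T.next (T.next d), h2⟩)⁻¹)
  else FreeGroup.of ⟨d, h⟩

theorem freeLabel_of_not_isMarked {d : Dart n} (h : ¬ T.IsMarked d) :
    T.freeLabel d = FreeGroup.of ⟨d, h⟩ := dif_neg h

theorem isTriangular_freeLabel : T.IsTriangular T.freeLabel := by
  have key : ∀ d, T.IsMarked d →
      T.freeLabel d * T.freeLabel (T.next d) * T.freeLabel (T.next (T.next d)) = 1 := by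
    intro d hd
    rcases T.isMarked_cases d with ⟨-, h1, h2⟩ | ⟨h, -⟩ | ⟨h, -⟩
    · rw [T.freeLabel_of_not_isMarked h1, T.freeLabel_of_not_isMarked h2, freeLabel, dif_pos hd,
        dif_neg h1, dif_neg h2, mul_assoc, inv_mul_cancel]
    · exact absurd hd h
    · exact absurd hd h
  intro d
  rcases T.isMarked_cases d with ⟨h, -⟩ | ⟨-, h, -⟩ | ⟨-, -, h⟩
  · exact key d h
  · rw [mul_assoc, mul_eq_one_comm]
    have := key _ h
    rwa [T.next_next_next] at this
  · rw [mul_eq_one_comm, ← mul_assoc]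
    have := key _ h
    rwa [T.next_next_next] at this

/-- The homomorphism with given triangular values. -/
noncomputable def freeLift (s : Dart n → H) : FreeGroup {d : Dart n // ¬ T.IsMarked d} →* H :=
  FreeGroup.lift fun d => s d.1

theorem freeLift_freeLabel {s : Dart n → H} (hs : T.IsTriangular s) (d : Dart n) :
    T.freeLift s (T.freeLabel d) = s d := by
  by_cases h : T.IsMarked d
  · rcases T.isMarked_cases d with ⟨-, h1, h2⟩ | ⟨h', -⟩ | ⟨h', -⟩
    · rw [freeLabel, dif_pos h, dif_neg h1, dif_neg h2, freeLift, map_inv, map_mul,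
        FreeGroup.lift_apply_of, FreeGroup.lift_apply_of, inv_eq_iff_mul_eq_one, mul_eq_one_comm,
        ← mul_assoc]
      exact hs d
    · exact absurd h h'
    · exact absurd h h'
  · rw [T.freeLabel_of_not_isMarked h, freeLift, FreeGroup.lift_apply_of]

theorem freeGroup_hom_ext {f g : FreeGroup {d : Dart n // ¬ T.IsMarked d} →* H}
    (h : ∀ d, f (T.freeLabel d) = g (T.freeLabel d)) : f = g :=
  FreeGroup.ext_hom _ _ fun d => by
    have := h d.1
    rwa [T.freeLabel_of_not_isMarked d.2] at this

open scoped Classical in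
/-- Each of the `2n` triangles contains two oriented edges which are not marked. -/
theorem card_not_isMarked : Fintype.card {d : Dart n // ¬ T.IsMarked d} = 4 * n := by
  have h1 : ∑ d : Dart n, ((if T.IsMarked d then 1 else 0) +
      (if T.IsMarked (T.next d) then 1 else 0) +
      (if T.IsMarked (T.next (T.next d)) then 1 else 0)) = ∑ d : Dart n, 1 := by
    refine Finset.sum_congr rfl fun d _ => ?_
    rcases T.isMarked_cases d with ⟨h1, h2, h3⟩ | ⟨h1, h2, h3⟩ | ⟨h1, h2, h3⟩ <;> simp [h1, h2, h3]
  rw [Finset.sum_add_distrib, Finset.sum_add_distrib,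
    Equiv.sum_comp T.next (fun d => if T.IsMarked d then 1 else 0),
    show ∑ d, (if T.IsMarked (T.next (T.next d)) then 1 else 0) = ∑ d, if T.IsMarked d then 1 else 0
      from Equiv.sum_comp (T.next.trans T.next) (fun d => if T.IsMarked d then 1 else 0)] at h1
  have h2 : Fintype.card (Dart n) = 6 * n := by
    simp only [Fintype.card_prod, Fintype.card_fin, Fintype.card_bool]; ring
  rw [Finset.sum_boole, Finset.sum_const, smul_eq_mul, mul_one, Finset.card_univ, h2] at h1
  rw [Fintype.card_subtype_compl, h2, Fintype.card_subtype]
  simp only [Nat.cast_id] at h1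
  omega

end SurfaceTriangulation

namespace LayeredTriangulation

open SurfaceTriangulation

variable {n : ℕ} (L : LayeredTriangulation n)

/-- The monodromy of the layered triangulation as an automorphism of the fundamental group of the
bottom surface with all long edges collapsed to points. -/
noncomputable def freeMonodromy : MulAut (FreeGroup {d : Dart n // ¬ (L.tri 0).IsMarked d}) :=
  have h1 := L.isTriangular_comp_mono
    (L.isTriangular_cornerLevel (L.tri 0).isTriangular_freeLabel (Fin.last L.N))
  have h2 := L.isTriangular_cornerLevelBack (Fin.last L.N)
    (L.isTriangular_comp_mono_symm (L.tri 0).isTriangular_freeLabel)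
  MonoidHom.toMulEquiv
    ((L.tri 0).freeLift fun d => L.cornerLevel (L.tri 0).freeLabel (Fin.last L.N) (L.mono d))
    ((L.tri 0).freeLift (L.cornerLevelBack (Fin.last L.N)
      fun d => (L.tri 0).freeLabel (L.mono.symm d)))
    ((L.tri 0).freeGroup_hom_ext fun d => by
      rw [MonoidHom.comp_apply, freeLift_freeLabel _ h1, map_cornerLevel, MonoidHom.id_apply]
      simp only [freeLift_freeLabel _ h2]
      rw [L.cornerLevel_cornerLevelBack _
        (L.isTriangular_comp_mono_symm (L.tri 0).isTriangular_freeLabel)]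
      exact congrArg _ (L.mono.symm_apply_apply d))
    ((L.tri 0).freeGroup_hom_ext fun d => by
      rw [MonoidHom.comp_apply, freeLift_freeLabel _ h2, map_cornerLevelBack, MonoidHom.id_apply]
      simp only [freeLift_freeLabel _ h1, Equiv.apply_symm_apply]
      rw [L.cornerLevelBack_cornerLevel (L.tri 0).isTriangular_freeLabel])

theorem freeMonodromy_freeLabel (d : Dart n) : L.freeMonodromy ((L.tri 0).freeLabel d) =
    L.cornerLevel (L.tri 0).freeLabel (Fin.last L.N) (L.mono d) :=
  freeLift_freeLabel _ (L.isTriangular_comp_mono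
    (L.isTriangular_cornerLevel (L.tri 0).isTriangular_freeLabel (Fin.last L.N))) d

end LayeredTriangulation

/-! ### Homomorphisms from labels in a group -/

namespace GroupLabels

variable {n : ℕ} {L : LayeredTriangulation n} {H : Type} [Group H] (g : GroupLabels L H)

/-- The labels of the edges of the cell structure. -/
def label {x y : TVertex L} : TEdge L x y → H
  | .long i d _ _ => g.long i d
  | .short i d _ _ _ _ => g.short i d
  | .up i d _ => g.up i d
  | .close d _ _ => g.close d

theorem label_rel (x y : Quiver.FreeGroupoid (TVertex L)) (f f' : x ⟶ y) (h : TRel L f f') :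
    (TEdge.labelFunctor (H := H) g.label).map f = (TEdge.labelFunctor (H := H) g.label).map f' := by
  cases h with
  | long i d d' h h' =>
    subst h
    rw [Functor.map_comp, CategoryTheory.Functor.map_id, TEdge.labelFunctor_gen,
      TEdge.labelFunctor_gen]
    exact congrArg MulOpposite.op (g.long_rev i d)
  | hexagon i d₁ d₂ d₃ r₁ r₂ r₃ h₁ h₂ h₃ k₁ k₂ k₃ =>
    subst h₁ h₂ h₃ k₁ k₂
    simp only [Functor.map_comp, CategoryTheory.Functor.map_id]
    rw [TEdge.labelFunctor_gen, TEdge.labelFunctor_gen, TEdge.labelFunctor_gen,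
      TEdge.labelFunctor_gen, TEdge.labelFunctor_gen, TEdge.labelFunctor_gen]
    refine congrArg MulOpposite.op (Eq.trans ?_ (g.hexagon i d₁))
    simp only [mul_assoc]
    rfl
  | upLong i d r h hd hr =>
    subst h
    rw [Functor.map_comp, Functor.map_comp, TEdge.labelFunctor_gen, TEdge.labelFunctor_gen,
      TEdge.labelFunctor_gen, TEdge.labelFunctor_gen]
    exact congrArg MulOpposite.op (g.up_long i d hd)
  | upShort i d r d' h k k' hr hd' ht =>
    subst h k
    rw [Functor.map_comp, Functor.map_comp, TEdge.labelFunctor_gen, TEdge.labelFunctor_gen,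
      TEdge.labelFunctor_gen, TEdge.labelFunctor_gen]
    exact congrArg MulOpposite.op (g.up_short i d ht)
  | below i x y p r d hx hy h k l k' hr hd =>
    simp only [Functor.map_comp]
    rw [TEdge.labelFunctor_gen, TEdge.labelFunctor_gen,
      TEdge.labelFunctor_gen, TEdge.labelFunctor_gen, TEdge.labelFunctor_gen]
    have e : p = (L.tri i.castSucc).next ((L.tri i.castSucc).next x) := by
      rw [← k, (L.tri i.castSucc).next_next_next]
    have e' : y = x.rev := by rw [← hy, Dart.rev_rev]
    subst h l e e'
    exact congrArg MulOpposite.op ((mul_assoc _ _ _).symm.trans (g.below i x hx))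
  | above i x y p r d hx hy h k l k' hr hd =>
    simp only [Functor.map_comp]
    rw [TEdge.labelFunctor_gen, TEdge.labelFunctor_gen,
      TEdge.labelFunctor_gen, TEdge.labelFunctor_gen, TEdge.labelFunctor_gen]
    have hy' : y.1 = L.flipAt i := by rw [← hx, ← hy]; rfl
    have e : p = (L.tri i.castSucc).next y := by
      apply (L.tri i.succ).next.injective
      rw [(L.isFlip i).next_next_eq hy', k, hy]
    have e' : d = (L.tri i.castSucc).next p := k'.symm
    subst h e e'
    exact congrArg MulOpposite.op ((mul_assoc _ _ _).symm.trans (g.above i y hy'))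
  | closeLong d r e s h he hs h' =>
    subst h he hs
    rw [Functor.map_comp, Functor.map_comp, TEdge.labelFunctor_gen, TEdge.labelFunctor_gen,
      TEdge.labelFunctor_gen, TEdge.labelFunctor_gen]
    exact congrArg MulOpposite.op (g.close_long d)
  | closeShort d r d' e s e' h k he hs he' h' k' =>
    subst h k he hs he'
    rw [Functor.map_comp, Functor.map_comp, TEdge.labelFunctor_gen, TEdge.labelFunctor_gen,
      TEdge.labelFunctor_gen, TEdge.labelFunctor_gen]
    exact congrArg MulOpposite.op (g.close_short d)

open SurfaceTriangulation

/-- The labels given by triangular labels on the bottom surface, when all long edges and the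
vertical edges `up` have the trivial label. -/
def ofTriangular {s : Dart n → H} (hs : (L.tri 0).IsTriangular s) (τ : H)
    (hτ : ∀ d, τ * s d = L.cornerLevel s (Fin.last L.N) (L.mono d) * τ) : GroupLabels L H where
  long _ _ := 1
  short i d := L.cornerLevel s i d
  up _ _ := 1
  close _ := τ
  long_rev _ _ := mul_one 1
  hexagon i d := by
    simp only [one_mul]
    exact L.isTriangular_cornerLevel hs i d
  up_long _ _ _ := rfl
  up_short i d hd := by
    rw [one_mul, mul_one, L.cornerLevel_succ, cornerStep_other _ hd]
  below i y hy := by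
    rw [one_mul, mul_one, L.cornerLevel_succ, (L.isFlip i).cornerStep_third _ hy]
  above i y hy := by
    rw [one_mul, mul_one, L.cornerLevel_succ, (L.isFlip i).cornerStep_next _ hy,
      cornerStep_self _ hy]
    have := L.isTriangular_cornerLevel hs i.castSucc y
    rw [mul_eq_one_iff_eq_inv] at this
    rw [← this, inv_mul_cancel_left]
  close_long _ := by rw [mul_one, one_mul]
  close_short d := hτ d

/-- When all long edges and all vertical edges `up` have the trivial label, the labels of the short
edges are determined by those on the bottom surface if this holds for one of the two orientations
of each flipped edge. -/
theorem short_eq_cornerLevel (h1 : ∀ i d, g.long i d = 1) (h2 : ∀ i d, g.up i d = 1)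
    (h3 : ∀ i : Fin L.N, g.short i.succ (L.flipAt i, true) = (g.short i.castSucc
      ((L.tri i.castSucc).next ((L.tri i.castSucc).next (L.flipAt i, true))))⁻¹)
    (i : Fin (L.N + 1)) : g.short i = L.cornerLevel (g.short 0) i := by
  have ht : ∀ i, (L.tri i).IsTriangular (g.short i) := fun i d => by
    have := g.hexagon i d
    simpa only [h1, one_mul] using this
  induction i using Fin.induction with
  | zero => rfl
  | succ i ih =>
    rw [L.cornerLevel_succ, ← ih]
    have hF := L.isFlip i
    have t1 : ∀ y : Dart n, y.1 = L.flipAt i →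
        g.short i.succ ((L.tri i.castSucc).next ((L.tri i.castSucc).next y)) =
        g.short i.castSucc ((L.tri i.castSucc).next ((L.tri i.castSucc).next y)) *
          g.short i.castSucc y.rev := fun y hy => by
      have := g.below i y hy
      rwa [h2, h2, one_mul, mul_one, eq_comm] at this
    have t2 : ∀ y : Dart n, y.1 = L.flipAt i →
        g.short i.succ ((L.tri i.castSucc).next y) * g.short i.succ y =
        g.short i.castSucc ((L.tri i.castSucc).next y) := fun y hy => by
      have := g.above i y hy
      rwa [h2, h2, one_mul, mul_one] at this
    have t3 : ∀ y : Dart n, y.1 = L.flipAt i → g.short i.succ y =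
        (g.short i.castSucc ((L.tri i.castSucc).next ((L.tri i.castSucc).next y)))⁻¹ := by
      have key : ∀ y : Dart n, y.1 = L.flipAt i → g.short i.succ y =
          (g.short i.castSucc ((L.tri i.castSucc).next ((L.tri i.castSucc).next y)))⁻¹ →
          g.short i.succ y.rev = (g.short i.castSucc
            ((L.tri i.castSucc).next ((L.tri i.castSucc).next y.rev)))⁻¹ := by
        intro y hy hy'
        have k1 := ht i.succ y
        rw [hF.next_self y hy, hF.next_third y hy, t1 y hy, hy', mul_eq_one_comm, ← mul_assoc,
          ← mul_assoc, inv_mul_cancel_right, mul_eq_one_iff_eq_inv] at k1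
        have k2 := t2 y.rev hy
        have k3 := ht i.castSucc y.rev
        rw [k1] at k2
        rwa [← k2, mul_inv_cancel_left, mul_eq_one_iff_eq_inv] at k3
      intro y hy
      rcases PtolemyAssignment.dart_eq_or (x := (L.flipAt i, true)) hy with rfl | rfl
      · exact h3 i
      · exact key _ rfl (h3 i)
    ext d
    refine (L.tri i.castSucc).dart_cases (L.flipAt i) d _ (fun hu => ?_) (fun y hy hu => ?_)
      (fun y hy hu => ?_) fun hu => ?_
    · rw [cornerStep_self _ hu, t3 d hu]
    · subst hu
      rw [hF.cornerStep_next _ hy, eq_inv_iff_mul_eq_one, eq_mul_inv_of_mul_eq (t2 y hy), t3 y hy,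
        inv_inv, mul_eq_one_comm, ← mul_assoc]
      exact ht i.castSucc y
    · subst hu
      rw [hF.cornerStep_third _ hy, t1 y hy]
    · rw [cornerStep_other _ hu]
      have := g.up_short i d hu
      rwa [h2, h2, one_mul, mul_one] at this

end GroupLabels

/-! ### Paths from the base point -/

section Paths

variable {n : ℕ} {L : LayeredTriangulation n} {d₀ : Dart n}

theorem TEdge.long_comp {i : Fin (L.N + 1)} {d d' : Dart n} (h : d.rev = d') (h' : d'.rev = d) :
    (TEdge.long (L := L) i d d' h).mor ≫ (TEdge.long i d' d h').mor = 𝟙 _ :=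
  CategoryTheory.Quotient.sound _ (TRel.long i d d' h h')

/-- The paths from the base point in the bottom surface. -/
inductive LevelPath (L : LayeredTriangulation n) (d₀ : Dart n) :
    ∀ d : Dart n, (TGroupoid.base L d₀ ⟶ (⟨0, d⟩ : TVertex L).ob) → Prop
  | refl : LevelPath L d₀ d₀ (𝟙 _)
  | long (d d' : Dart n) (h : d.rev = d') (q : TGroupoid.base L d₀ ⟶ (⟨0, d⟩ : TVertex L).ob) :
      LevelPath L d₀ d q → LevelPath L d₀ d' (q ≫ (TEdge.long 0 d d' h).mor)
  | short (d : Dart n) (q : TGroupoid.base L d₀ ⟶ (⟨0, d.rev⟩ : TVertex L).ob) :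
      LevelPath L d₀ d.rev q → LevelPath L d₀ _ (q ≫ (TEdge.short 0 d d.rev _ rfl rfl).mor)

theorem exists_levelPath (d : Dart n) : ∃ q, LevelPath L d₀ d q := by
  have h := (L.tri 0).connected d₀ d
  induction h with
  | refl => exact ⟨_, LevelPath.refl⟩
  | tail _ h ih =>
    obtain ⟨q, hq⟩ := ih
    rcases h with rfl | rfl
    · exact ⟨_, LevelPath.short _ _ (LevelPath.long _ _ rfl _ hq)⟩
    · exact ⟨_, LevelPath.long _ _ rfl _ hq⟩

/-- The bottom surface is connected; the paths may be chosen such that all long edges become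
trivial loops. -/
theorem exists_levelPaths : ∃ q : ∀ d : Dart n, TGroupoid.base L d₀ ⟶ (⟨0, d⟩ : TVertex L).ob,
    (∀ d, LevelPath L d₀ d (q d)) ∧ q d₀ = 𝟙 _ ∧
      ∀ d, q d.rev = q d ≫ (TEdge.long 0 d d.rev rfl).mor := by
  classical
  have h0 : ∀ d, ∃ q, LevelPath L d₀ d q ∧ (d = d₀ → HEq q (𝟙 (TGroupoid.base L d₀))) := by
    intro d
    by_cases h : d = d₀
    · subst h
      exact ⟨_, LevelPath.refl, fun _ => HEq.rfl⟩
    · obtain ⟨q, hq⟩ := exists_levelPath (L := L) (d₀ := d₀) d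
      exact ⟨q, hq, fun h' => absurd h' h⟩
  choose q hq hq0 using h0
  replace hq0 := eq_of_heq (hq0 d₀ rfl)
  refine ⟨fun d => if d.2 = d₀.2 then q d else
      q d.rev ≫ (TEdge.long 0 d.rev d (Dart.rev_rev d)).mor,
    fun d => ?_, ?_, fun d => ?_⟩
  · beta_reduce
    split_ifs
    · exact hq d
    · exact LevelPath.long _ _ _ _ (hq _)
  · simpa using hq0
  · by_cases h : d.2 = d₀.2
    · have h' : d.rev.2 ≠ d₀.2 := by rw [← h]; simp [Dart.rev]
      simp only [if_pos h, if_neg h']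
      have key : ∀ d' (h : d'.rev = d.rev), d' = d → q d' ≫ (TEdge.long 0 d' d.rev h).mor =
          q d ≫ (TEdge.long 0 d d.rev rfl).mor := by
        rintro d' h rfl; rfl
      exact key _ _ (Dart.rev_rev d)
    · have h' : d.rev.2 = d₀.2 := by
        simp only [Dart.rev]
        revert h
        cases d.2 <;> cases d₀.2 <;> simp
      simp only [if_pos h', if_neg h]
      rw [Category.assoc, TEdge.long_comp, Category.comp_id]

/-- A path from the base point to the vertex `next (next e)` of the next surface, where `e` is one
of the orientations of the flipped edge. The inverse of the loop of the short edge at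
`next (next e)` precedes the path which is chosen in the present surface; when `pathOpp` is used to
reach the new vertices, then the loop of the short edge at `e` in the next surface becomes the
inverse of that loop, in accordance with `cornerStep_self`. -/
noncomputable def pathOpp (i : Fin L.N)
    (P : ∀ d : Dart n, TGroupoid.base L d₀ ⟶ (⟨i.castSucc, d⟩ : TVertex L).ob) :
    TGroupoid.base L d₀ ⟶ (⟨i.succ, (L.tri i.castSucc).next
      ((L.tri i.castSucc).next (L.flipAt i, true))⟩ : TVertex L).ob :=
  inv (P _ ≫ (TEdge.short i.castSucc ((L.tri i.castSucc).next
      ((L.tri i.castSucc).next (L.flipAt i, true))) _ (L.flipAt i, true) rfl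
      ((L.tri i.castSucc).next_next_next _)).mor ≫ inv (P (L.flipAt i, true))) ≫
    P _ ≫ (TEdge.up i _ ((L.isFlip i).next_next_edge_ne rfl)).mor

open scoped Classical in
/-- Paths from the base point to the vertices of the next surface: they are continued by vertical
edges to the vertices which persist, and the two vertices of the new edge are reached by means of
`pathOpp`. -/
noncomputable def pathStep (i : Fin L.N)
    (P : ∀ d : Dart n, TGroupoid.base L d₀ ⟶ (⟨i.castSucc, d⟩ : TVertex L).ob) (d : Dart n) :
    TGroupoid.base L d₀ ⟶ (⟨i.succ, d⟩ : TVertex L).ob :=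
  if hd : d.1 ≠ L.flipAt i then P d ≫ (TEdge.up i d hd).mor
  else if h : Dart.rev (L.flipAt i, true) = d then
    pathOpp i P ≫
      inv (TEdge.short i.succ (L.flipAt i, true) d _ h ((L.isFlip i).next_self _ rfl)).mor
  else (pathOpp i P ≫ inv (TEdge.short i.succ (L.flipAt i, true) _ _ rfl
      ((L.isFlip i).next_self _ rfl)).mor) ≫
    (TEdge.long i.succ _ d (by
      rcases PtolemyAssignment.dart_eq_or (x := (L.flipAt i, true)) (y := d) (not_not.1 hd)
        with h' | h'
      · rw [h', Dart.rev_rev]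
      · exact absurd h'.symm h)).mor

/-- There are paths from the base point to all vertices, such that the long edges and the vertical
edges `up` become trivial loops, and the loops of the short edges of all surfaces are determined by
those of the bottom surface. -/
theorem exists_paths : ∃ p : ∀ x : TVertex L, TGroupoid.base L d₀ ⟶ x.ob,
    (∀ d, LevelPath L d₀ d (p ⟨0, d⟩)) ∧ p ⟨0, d₀⟩ = 𝟙 _ ∧
      (∀ i d, (loopLabels p).long i d = 1) ∧ (∀ i d, (loopLabels p).up i d = 1) ∧
      ∀ i, (loopLabels p).short i = L.cornerLevel ((loopLabels p).short 0) i := by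
  obtain ⟨q, hq, hq0, hql⟩ := exists_levelPaths (L := L) (d₀ := d₀)
  let P : ∀ (i : Fin (L.N + 1)) (d : Dart n), TGroupoid.base L d₀ ⟶ (⟨i, d⟩ : TVertex L).ob :=
    fun i => Fin.induction (motive := fun i =>
      ∀ d : Dart n, TGroupoid.base L d₀ ⟶ (⟨i, d⟩ : TVertex L).ob) q pathStep i
  have hP : ∀ i : Fin L.N, P i.succ = pathStep i (P i.castSucc) := fun i => rfl
  have hup : ∀ (i : Fin L.N) (d : Dart n) (hd : d.1 ≠ L.flipAt i),
      P i.succ d = P i.castSucc d ≫ (TEdge.up i d hd).mor := fun i d hd => by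
    rw [hP, pathStep, dif_pos hd]
  have hflip : ∀ (i : Fin L.N) (x : Dart n) (hx : x = (L.flipAt i, true)), P i.succ x.rev =
      pathOpp i (P i.castSucc) ≫ inv (TEdge.short i.succ x x.rev
        ((L.tri i.castSucc).next ((L.tri i.castSucc).next (L.flipAt i, true))) rfl
        (by subst hx; exact (L.isFlip i).next_self _ rfl)).mor := by
    rintro i x rfl
    exact (dif_neg (not_not.2 rfl)).trans (dif_pos rfl)
  have hflip' : ∀ (i : Fin L.N) (x : Dart n) (hx : x = (L.flipAt i, true)), P i.succ x =
      (pathOpp i (P i.castSucc) ≫ inv (TEdge.short i.succ x x.rev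
        ((L.tri i.castSucc).next ((L.tri i.castSucc).next (L.flipAt i, true))) rfl
        (by subst hx; exact (L.isFlip i).next_self _ rfl)).mor) ≫
      (TEdge.long i.succ x.rev x (Dart.rev_rev x)).mor := by
    rintro i x rfl
    exact (dif_neg (not_not.2 rfl)).trans (dif_neg (by simp [Dart.rev]))
  have hlong : ∀ i d, P i d.rev = P i d ≫ (TEdge.long i d d.rev rfl).mor := by
    intro i
    induction i using Fin.induction with
    | zero => exact hql
    | succ i ih =>
      intro d
      by_cases hd : d.1 ≠ L.flipAt i
      · rw [hup i d.rev hd, hup i d hd, ih, Category.assoc, Category.assoc]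
        congr 1
        exact (CategoryTheory.Quotient.sound _ (TRel.upLong i d d.rev rfl hd hd)).symm
      · rw [not_not] at hd
        have key : ∀ (a : Dart n) (k : a = (L.flipAt i, true)), P i.succ a =
            P i.succ a.rev ≫ (TEdge.long i.succ a.rev a (Dart.rev_rev a)).mor := by
          rintro _ rfl
          rw [hflip' i _ rfl, hflip i _ rfl, Category.assoc]
        rcases PtolemyAssignment.dart_eq_or (x := (L.flipAt i, true)) hd with h | h
        · rw [key d h, Category.assoc, TEdge.long_comp, Category.comp_id]
        · have h' : d.rev = (L.flipAt i, true) := by rw [h, Dart.rev_rev]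
          have key' : ∀ (a b : Dart n) (h1 : a.rev = b), a = d → P i.succ b =
              P i.succ a ≫ (TEdge.long i.succ a b h1).mor → P i.succ d.rev =
                P i.succ d ≫ (TEdge.long i.succ d d.rev rfl).mor := by
            rintro a b rfl rfl hab
            exact hab
          exact key' _ _ _ (Dart.rev_rev d) (key _ h')
  have hl : ∀ i d, (loopLabels fun x => P x.level x.dart).long i d = 1 := by
    intro i d
    change P i d ≫ (TEdge.long i d d.rev rfl).mor ≫ inv (P i d.rev) = 𝟙 _
    rw [hlong, ← Category.assoc, IsIso.hom_inv_id]
  have hu : ∀ i d, (loopLabels fun x => P x.level x.dart).up i d = 1 := by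
    intro i d
    by_cases hd : d.1 ≠ L.flipAt i
    · refine (dif_pos hd).trans ?_
      change P i.castSucc d ≫ (TEdge.up i d hd).mor ≫ inv (P i.succ d) = 𝟙 _
      rw [hup i d hd, ← Category.assoc, IsIso.hom_inv_id]
    · exact dif_neg hd
  refine ⟨fun x => P x.level x.dart, hq, hq0, hl, hu,
    (loopLabels fun x => P x.level x.dart).short_eq_cornerLevel hl hu fun i => ?_⟩
  rw [eq_inv_iff_mul_eq_one]
  refine (congrArg₂ (· * ·) (TEdge.loop_short (fun x => P x.level x.dart) rfl
    ((L.isFlip i).next_self (L.flipAt i, true) rfl)) (TEdge.loop_short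
      (fun x => P x.level x.dart) rfl ((L.tri i.castSucc).next_next_next _))).trans ?_
  change (P i.succ (Dart.rev _) ≫ (TEdge.short i.succ _ _ _ rfl _).mor ≫ inv (P i.succ _)) ≫
    (P i.castSucc (Dart.rev _) ≫ (TEdge.short i.castSucc _ _ _ rfl _).mor ≫
      inv (P i.castSucc _)) = 𝟙 _
  rw [hflip i _ rfl, hup i _ ((L.isFlip i).next_next_edge_ne rfl)]
  simp [pathOpp]

end Paths

/-! ### Paths in the surfaces, as elements of a group -/

namespace SurfaceTriangulation

variable {n : ℕ} {H : Type} [Group H]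

/-- `SurfPath T s v w u` says that `u` is the product of the labels along a path from `v` to `w` in
the truncated surface, where `s` gives the labels of the short edges and the long edges have the
trivial label. -/
inductive SurfPath (T : SurfaceTriangulation n) (s : Dart n → H) : Dart n → Dart n → H → Prop
  | refl (v : Dart n) : SurfPath T s v v 1
  | long (d : Dart n) : SurfPath T s d d.rev 1
  | short (d : Dart n) : SurfPath T s d.rev (T.next d) (s d)
  | symm (v w : Dart n) (u : H) : SurfPath T s v w u → SurfPath T s w v u⁻¹
  | trans (v w z : Dart n) (u u' : H) :
      SurfPath T s v w u → SurfPath T s w z u' → SurfPath T s v z (u * u')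

variable {T T' : SurfaceTriangulation n} {e : Fin (3 * n)} {s : Dart n → H}

theorem SurfPath.congr {v w : Dart n} {u u' : H} (h : T.SurfPath s v w u) (hu : u = u') :
    T.SurfPath s v w u' := hu ▸ h

theorem SurfPath.mem {F : Subgroup H} (hs : ∀ d, s d ∈ F) {v w : Dart n} {u : H}
    (h : T.SurfPath s v w u) : u ∈ F := by
  induction h with
  | refl => exact one_mem _
  | long => exact one_mem _
  | short d => exact hs d
  | symm v w u _ ih => exact inv_mem ih
  | trans v w z u u' _ _ ih ih' => exact mul_mem ih ih'

/-- A path in the surface before a flip may be moved to the surface after the flip; its end is moved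
along a short edge if it lies on the flipped edge. -/
theorem IsFlip.surfPath_cornerStep (h : T.IsFlip T' e) (hs : T.IsTriangular s) {v w : Dart n}
    {u : H} (huvw : T.SurfPath s v w u) :
    T'.SurfPath (T.cornerStep e s) (if v.1 = e then T.next v.rev else v)
      (if w.1 = e then T.next w.rev else w)
      ((if v.1 = e then s v.rev else 1)⁻¹ * u * (if w.1 = e then s w.rev else 1)) := by
  induction huvw with
  | refl v =>
    exact (SurfPath.refl _).congr (by group)
  | long d =>
    by_cases hd : d.1 = e
    · have hd' : d.rev.1 = e := hd
      simp only [hd, hd', if_true, Dart.rev_rev, mul_one]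
      have h1 := SurfPath.short (T := T') (s := T.cornerStep e s) (T.next (T.next d))
      have h2 := SurfPath.short (T := T') (s := T.cornerStep e s) (T.next d)
      have h3 := SurfPath.short (T := T') (s := T.cornerStep e s) d
      rw [h.next_third d hd, h.cornerStep_third s hd] at h1
      rw [h.next_next_eq hd, h.cornerStep_next s hd] at h2
      rw [h.next_self d hd, cornerStep_self s hd] at h3
      have h4 := SurfPath.long (T := T') (s := T.cornerStep e s) (T.next d)
      have h5 := SurfPath.long (T := T') (s := T.cornerStep e s) (T.next (T.next d))
      refine ((h1.symm.trans _ _ _ _ _ h5.symm).trans _ _ _ _ _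
        ((h2.trans _ _ _ _ _ h3).symm.trans _ _ _ _ _ h4.symm)).congr ?_
      group
    · have hd' : d.rev.1 ≠ e := hd
      simp only [hd, hd', if_false]
      exact (SurfPath.long d).congr (by group)
  | short d =>
    refine T.dart_cases e d _ (fun hu => ?_) (fun y hy hu => ?_) (fun y hy hu => ?_) fun hu => ?_
    · have hd' : d.rev.1 = e := hu
      simp only [hd', h.next_edge_ne hu, if_true, if_false, Dart.rev_rev]
      exact (SurfPath.refl _).congr (by group)
    · subst hu
      have hd' : (T.next y).rev.1 ≠ e := h.next_edge_ne hy
      simp only [hd', h.next_next_edge_ne hy, if_false]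
      have h2 := SurfPath.short (T := T') (s := T.cornerStep e s) (T.next y)
      have h3 := SurfPath.short (T := T') (s := T.cornerStep e s) y
      rw [h.next_next_eq hy, h.cornerStep_next s hy] at h2
      rw [h.next_self y hy, cornerStep_self s hy] at h3
      refine (h2.trans _ _ _ _ _ h3).congr ?_
      have := hs y
      rw [mul_eq_one_iff_eq_inv] at this
      rw [← this]
      group
    · subst hu
      have hd' : (T.next (T.next y)).rev.1 ≠ e := h.next_next_edge_ne hy
      simp only [hd', T.next_next_next, hy, if_false, if_true]
      have h1 := SurfPath.short (T := T') (s := T.cornerStep e s) (T.next (T.next y))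
      rw [h.next_third y hy, h.cornerStep_third s hy] at h1
      exact h1.congr (by group)
    · have h1 : d.rev.1 ≠ e := fun k => hu (Or.inl k)
      have h2 : (T.next d).1 ≠ e := fun k => hu (Or.inr (Or.inl k))
      simp only [h1, h2, if_false]
      have h3 := SurfPath.short (T := T') (s := T.cornerStep e s) d
      rw [h.next_other d hu, cornerStep_other s hu] at h3
      exact h3.congr (by group)
  | symm v w u _ ih => exact ih.symm.congr (by group)
  | trans v w z u u' _ _ ih ih' => exact (ih.trans _ _ _ _ _ ih').congr (by group)

theorem cornerStep_mem {F : Subgroup H} (hs : ∀ d, s d ∈ F) (d : Dart n) :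
    T.cornerStep e s d ∈ F := by
  unfold cornerStep
  split_ifs
  · exact inv_mem (hs _)
  · exact inv_mem (hs _)
  · exact mul_mem (hs _) (hs _)
  · exact hs _

end SurfaceTriangulation

namespace LayeredTriangulation

open SurfaceTriangulation

variable {n : ℕ} (L : LayeredTriangulation n) {H : Type} [Group H] {s : Dart n → H}

theorem cornerLevel_mem {F : Subgroup H} (hs : ∀ d, s d ∈ F) (i : Fin (L.N + 1)) (d : Dart n) :
    L.cornerLevel s i d ∈ F := by
  induction i using Fin.induction generalizing d with
  | zero => exact hs d
  | succ j ih => exact cornerStep_mem ih d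

/-- If, on the bottom surface, every vertex is reached from `d₀` by a path with trivial product of
labels, then on every surface every element of the group generated by the labels is the product of
the labels along a path with given end points. -/
theorem surfPath_of_mem (hs : (L.tri 0).IsTriangular s) {d₀ : Dart n}
    (h0 : ∀ v, (L.tri 0).SurfPath s d₀ v 1) (i : Fin (L.N + 1)) {u : H}
    (hu : u ∈ Subgroup.closure (Set.range s)) (v w : Dart n) :
    (L.tri i).SurfPath (L.cornerLevel s i) v w u := by
  induction i using Fin.induction generalizing v w u with
  | zero =>
    have key : (L.tri 0).SurfPath s d₀ d₀ u := by
      induction hu using Subgroup.closure_induction with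
      | mem u hu =>
        obtain ⟨d, rfl⟩ := hu
        exact (((h0 _).trans _ _ _ _ _ (SurfPath.short d)).trans _ _ _ _ _ (h0 _).symm).congr
          (by group)
      | one => exact SurfPath.refl _
      | mul u u' _ _ h h' => exact h.trans _ _ _ _ _ h'
      | inv u _ h => exact h.symm
    exact (((h0 v).symm.trans _ _ _ _ _ key).trans _ _ _ _ _ (h0 w)).congr (by group)
  | succ i ih =>
    have hF := L.isFlip i
    have hT := L.isTriangular_cornerLevel hs i.castSucc
    have hs' : ∀ d, s d ∈ Subgroup.closure (Set.range s) := fun d =>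
      Subgroup.subset_closure ⟨d, rfl⟩
    -- The ends on the flipped edge are moved along a short edge.
    have h1 : ∀ v : Dart n, ∃ v' : Dart n, v'.1 ≠ L.flipAt i ∧
        ∃ u ∈ Subgroup.closure (Set.range s),
          (L.tri i.succ).SurfPath (L.cornerLevel s i.succ) v v' u := by
      intro v
      by_cases hv : v.1 = L.flipAt i
      · have h2 := SurfPath.short (T := L.tri i.succ) (s := L.cornerLevel s i.succ) v.rev
        rw [Dart.rev_rev, hF.next_self v.rev hv] at h2
        exact ⟨_, hF.next_next_edge_ne (show v.rev.1 = _ from hv), _,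
          L.cornerLevel_mem hs' _ _, h2⟩
      · exact ⟨v, hv, 1, one_mem _, SurfPath.refl v⟩
    obtain ⟨v', hv', a, ha, hva⟩ := h1 v
    obtain ⟨w', hw', b, hb, hwb⟩ := h1 w
    have h2 := hF.surfPath_cornerStep hT (ih (mul_mem (mul_mem (inv_mem ha) hu) hb) v' w')
    simp only [hv', hw', if_false] at h2
    exact ((hva.trans _ _ _ _ _ h2).trans _ _ _ _ _ hwb.symm).congr (by group)

variable {k : Dart n → H} (hk : ∀ d, k d.rev = k d)
  (hk' : ∀ d, k d.rev * s d = L.cornerLevel s (Fin.last L.N) (L.mono d) * k ((L.tri 0).next d))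
include hk hk'

/-- A path in the bottom surface may be moved to the top surface along the edges which identify the
two; these have the labels `k`. -/
theorem surfPath_mono {v w : Dart n} {u : H} (h : (L.tri 0).SurfPath s v w u) :
    (L.tri (Fin.last L.N)).SurfPath (L.cornerLevel s (Fin.last L.N)) (L.mono v) (L.mono w)
      (k v * u * (k w)⁻¹) := by
  induction h with
  | refl v => exact (SurfPath.refl _).congr (by group)
  | long d =>
    rw [L.mono_rev, hk]
    exact (SurfPath.long _).congr (by group)
  | short d =>
    rw [L.mono_rev, hk', ← L.mono_next]
    exact (SurfPath.short _).congr (by group)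
  | symm v w u _ ih => exact ih.symm.congr (by group)
  | trans v w z u u' _ _ ih ih' => exact (ih.trans _ _ _ _ _ ih').congr (by group)

theorem surfPath_mono_symm {v w : Dart n} {u : H}
    (h : (L.tri (Fin.last L.N)).SurfPath (L.cornerLevel s (Fin.last L.N)) v w u) :
    (L.tri 0).SurfPath s (L.mono.symm v) (L.mono.symm w)
      ((k (L.mono.symm v))⁻¹ * u * k (L.mono.symm w)) := by
  induction h with
  | refl v => exact (SurfPath.refl _).congr (by group)
  | long d =>
    obtain ⟨d, rfl⟩ := L.mono.surjective d
    rw [← L.mono_rev, Equiv.symm_apply_apply, Equiv.symm_apply_apply, hk]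
    exact (SurfPath.long _).congr (by group)
  | short d =>
    obtain ⟨d, rfl⟩ := L.mono.surjective d
    rw [← L.mono_rev, L.mono_next, Equiv.symm_apply_apply, Equiv.symm_apply_apply, mul_assoc, ← hk']
    exact (SurfPath.short _).congr (by group)
  | symm v w u _ ih => exact ih.symm.congr (by group)
  | trans v w z u u' _ _ ih ih' => exact (ih.trans _ _ _ _ _ ih').congr (by group)

/-- The subgroup generated by the labels of the bottom surface is normalized by the labels of the
edges from the top to the bottom. -/
theorem normalizes_closure (hs : (L.tri 0).IsTriangular s) {d₀ : Dart n}
    (h0 : ∀ v, (L.tri 0).SurfPath s d₀ v 1) :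
    (∀ v, k v * (k d₀)⁻¹ ∈ Subgroup.closure (Set.range s)) ∧
      ∀ u, u ∈ Subgroup.closure (Set.range s) ↔
        k d₀ * u * (k d₀)⁻¹ ∈ Subgroup.closure (Set.range s) := by
  have hs' : ∀ d, s d ∈ Subgroup.closure (Set.range s) := fun d => Subgroup.subset_closure ⟨d, rfl⟩
  have h1 : ∀ u ∈ Subgroup.closure (Set.range s), ∀ v w,
      k v * u * (k w)⁻¹ ∈ Subgroup.closure (Set.range s) := fun u hu v w =>
    (L.surfPath_mono hk hk' (L.surfPath_of_mem hs h0 0 hu v w)).mem (L.cornerLevel_mem hs' _)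
  refine ⟨fun v => ?_, fun u => ⟨fun hu => h1 u hu _ _, fun hu => ?_⟩⟩
  · have := h1 1 (one_mem _) v d₀
    rwa [mul_one] at this
  · have h2 := (L.surfPath_mono_symm hk hk' (L.surfPath_of_mem hs h0 (Fin.last L.N) hu
      (L.mono d₀) (L.mono d₀))).mem hs'
    rw [Equiv.symm_apply_apply] at h2
    convert h2 using 1
    group

end LayeredTriangulation

/-! ### The fundamental group of the fibre -/

/-- The fundamental group of `M_φ` as a type in its own right: instances are not found by unfolding
it. -/
def FundGroup {n : ℕ} (L : LayeredTriangulation n) (d₀ : Dart n) : Type := TGroup L d₀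

noncomputable instance {n : ℕ} (L : LayeredTriangulation n) (d₀ : Dart n) :
    Group (FundGroup L d₀) := inferInstanceAs (Group (TGroup L d₀))

/-- The homomorphism given by labels in a group. -/
noncomputable def FundGroup.hom {n : ℕ} {L : LayeredTriangulation n} {H : Type} [Group H]
    (w : ∀ {x y : TVertex L}, TEdge L x y → H)
    (hw : ∀ (x y : Quiver.FreeGroupoid (TVertex L)) (f g : x ⟶ y), TRel L f g →
      (TEdge.labelFunctor w).map f = (TEdge.labelFunctor w).map g) (d₀ : Dart n) :
    FundGroup L d₀ →* H := TGroup.hom w hw d₀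

/-- The class of the fibration. -/
noncomputable def FundGroup.alpha {n : ℕ} (L : LayeredTriangulation n) (d₀ : Dart n) :
    FundGroup L d₀ →* Multiplicative ℤ := FundGroup.hom TEdge.height TEdge.height_rel d₀

/-- Paths from the base point to all vertices, such that all long edges and all vertical edges `up`
become trivial loops. -/
structure BasePaths {n : ℕ} (L : LayeredTriangulation n) (d₀ : Dart n) where
  path : ∀ x : TVertex L, TGroupoid.base L d₀ ⟶ x.ob
  levelPath : ∀ d, LevelPath L d₀ d (path ⟨0, d⟩)
  path_base : path ⟨0, d₀⟩ = 𝟙 _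
  long_eq : ∀ i d, (loopLabels path).long i d = 1
  up_eq : ∀ i d, (loopLabels path).up i d = 1
  short_eq : ∀ i, (loopLabels path).short i = L.cornerLevel ((loopLabels path).short 0) i

theorem nonempty_basePaths {n : ℕ} (L : LayeredTriangulation n) (d₀ : Dart n) :
    Nonempty (BasePaths L d₀) := by
  obtain ⟨p, h1, h2, h3, h4, h5⟩ := exists_paths (L := L) (d₀ := d₀)
  exact ⟨⟨p, h1, h2, h3, h4, h5⟩⟩

namespace BasePaths

open SurfaceTriangulation

variable {n : ℕ} {L : LayeredTriangulation n} {d₀ : Dart n} (p : BasePaths L d₀)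

/-- The loops of the edges, as labels in the fundamental group. -/
noncomputable def labels : GroupLabels L (FundGroup L d₀) := loopLabels p.path

/-- The loops of the short edges of the bottom surface. -/
noncomputable def corner : Dart n → FundGroup L d₀ := p.labels.short 0

/-- The loops of the edges from the top to the bottom. -/
noncomputable def closing : Dart n → FundGroup L d₀ := p.labels.close

theorem labels_long (i : Fin (L.N + 1)) (d : Dart n) : p.labels.long i d = 1 := p.long_eq i d

theorem labels_short (i : Fin (L.N + 1)) : p.labels.short i = L.cornerLevel p.corner i :=
  p.short_eq i

theorem isTriangular_corner : (L.tri 0).IsTriangular p.corner := fun d => by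
  have := p.labels.hexagon 0 d
  simp only [p.labels_long, one_mul] at this
  exact this

theorem closing_rev (d : Dart n) : p.closing d.rev = p.closing d := by
  have := p.labels.close_long d
  rw [p.labels_long, p.labels_long, mul_one, one_mul] at this
  exact this.symm

theorem closing_corner (d : Dart n) : p.closing d.rev * p.corner d =
    L.cornerLevel p.corner (Fin.last L.N) (L.mono d) * p.closing ((L.tri 0).next d) := by
  have := p.labels.close_short d
  rw [p.labels_short (Fin.last L.N)] at this
  exact this

/-- The loop of an edge. -/
noncomputable def loop {x y : TVertex L} (f : TEdge L x y) : FundGroup L d₀ := f.loop p.path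

/-- The loop which is obtained from a path by returning along the chosen path. -/
noncomputable def close {x : TVertex L} (q : TGroupoid.base L d₀ ⟶ x.ob) : FundGroup L d₀ :=
  q ≫ inv (p.path x)

theorem close_comp {x y : TVertex L} (q : TGroupoid.base L d₀ ⟶ x.ob) (f : TEdge L x y) :
    p.close (q ≫ f.mor) = p.close q * p.loop f := by
  change (q ≫ f.mor) ≫ inv (p.path y) = (q ≫ inv (p.path x)) ≫ (p.path x ≫ f.mor ≫ inv (p.path y))
  simp

theorem close_comp_inv {x y : TVertex L} (q : TGroupoid.base L d₀ ⟶ y.ob) (f : TEdge L x y) :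
    p.close (q ≫ inv f.mor) = p.close q * (p.loop f)⁻¹ := by
  rw [eq_mul_inv_iff_mul_eq, ← close_comp]
  simp

theorem close_path (x : TVertex L) : p.close (p.path x) = 1 :=
  IsIso.hom_inv_id _

theorem close_id : p.close (x := ⟨0, d₀⟩) (𝟙 (TGroupoid.base L d₀)) = 1 :=
  (congrArg (p.close (x := ⟨0, d₀⟩)) p.path_base.symm).trans (p.close_path _)

theorem close_eq (γ : TGroupoid.base L d₀ ⟶ TGroupoid.base L d₀) :
    p.close (x := ⟨0, d₀⟩) γ = (γ : TGroup L d₀) := by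
  have h : p.path ⟨0, d₀⟩ ≫ inv (p.path ⟨0, d₀⟩) = 𝟙 (TGroupoid.base L d₀) := IsIso.hom_inv_id _
  have h' : inv (p.path ⟨0, d₀⟩) = 𝟙 (TGroupoid.base L d₀) := by
    refine Eq.trans ?_ h
    exact (Category.id_comp _).symm.trans (congrArg (· ≫ inv (p.path ⟨0, d₀⟩)) p.path_base.symm)
  exact (congrArg (γ ≫ ·) h').trans (Category.comp_id γ)

theorem loop_long {i : Fin (L.N + 1)} {d d' : Dart n} (h : d.rev = d') :
    p.loop (TEdge.long i d d' h) = 1 := by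
  subst h; exact p.long_eq i d

theorem loop_short {i : Fin (L.N + 1)} {d r d' : Dart n} (hr : d.rev = r)
    (h : (L.tri i).next d = d') :
    p.loop (TEdge.short i d r d' hr h) = L.cornerLevel p.corner i d := by
  subst hr h; exact congrFun (p.short_eq i) d

theorem loop_up {i : Fin L.N} {d : Dart n} (h : d.1 ≠ L.flipAt i) :
    p.loop (TEdge.up i d h) = 1 :=
  (dif_pos (c := d.1 ≠ L.flipAt i) h).symm.trans (p.up_eq i d)

theorem loop_close {d d' : Dart n} (h : L.mono d = d') :
    p.loop (TEdge.close d d' h) = p.closing d := by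
  subst h; rfl

theorem surfPath_levelPath {d : Dart n} {q : TGroupoid.base L d₀ ⟶ (⟨0, d⟩ : TVertex L).ob}
    (h : LevelPath L d₀ d q) : (L.tri 0).SurfPath p.corner d₀ d (p.close q) := by
  induction h with
  | refl => rw [p.close_id]; exact SurfPath.refl _
  | long d d' h q _ ih =>
    rw [close_comp, loop_long]
    subst h
    exact ih.trans _ _ _ _ _ (SurfPath.long d)
  | short d q _ ih =>
    rw [close_comp, loop_short]
    exact ih.trans _ _ _ _ _ (SurfPath.short d)

/-- The subgroup generated by the loops in the bottom surface. -/
noncomputable def fibre : Subgroup (FundGroup L d₀) := Subgroup.closure (Set.range p.corner)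

theorem corner_mem (d : Dart n) : p.corner d ∈ p.fibre := Subgroup.subset_closure ⟨d, rfl⟩

theorem normalizes_fibre : (∀ v, p.closing v * (p.closing d₀)⁻¹ ∈ p.fibre) ∧
    ∀ u, u ∈ p.fibre ↔ p.closing d₀ * u * (p.closing d₀)⁻¹ ∈ p.fibre :=
  L.normalizes_closure p.closing_rev p.closing_corner p.isTriangular_corner fun v => by
    have := p.surfPath_levelPath (p.levelPath v)
    rwa [close_path] at this

theorem zpow_closing_mem (u : FundGroup L d₀) (hu : u ∈ p.fibre) (j : ℤ) :
    (p.closing d₀) ^ j * u * ((p.closing d₀) ^ j)⁻¹ ∈ p.fibre := by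
  have h : p.closing d₀ ∈ Subgroup.normalizer (p.fibre : Set (FundGroup L d₀)) :=
    Subgroup.mem_normalizer_iff.2 p.normalizes_fibre.2
  exact (Subgroup.mem_normalizer_iff.1 (zpow_mem h j) u).1 hu

/-- Every loop is the product of a loop in the bottom surface and a power of a fixed loop. -/
theorem exists_eq_mul_zpow (γ : FundGroup L d₀) :
    ∃ u ∈ p.fibre, ∃ j : ℤ, γ = u * (p.closing d₀) ^ j := by
  have hloop : ∀ {x y : TVertex L} (f : TEdge L x y), ∃ u ∈ p.fibre, ∃ j : ℤ,
      p.loop f = u * (p.closing d₀) ^ j := by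
    intro x y f
    cases f with
    | long i d d' h => exact ⟨1, one_mem _, 0, by rw [loop_long]; simp⟩
    | short i d r d' hr h =>
      exact ⟨_, L.cornerLevel_mem p.corner_mem i d, 0, by rw [loop_short]; simp⟩
    | up i d h => exact ⟨1, one_mem _, 0, by rw [loop_up]; simp⟩
    | close d d' h => exact ⟨_, p.normalizes_fibre.1 d, 1, by rw [loop_close]; simp⟩
  rw [← show p.close (x := ⟨0, d₀⟩) γ = γ from p.close_eq γ]
  refine TGroupoid.hom_induction (x := ⟨0, d₀⟩)
    (fun y q => ∃ u ∈ p.fibre, ∃ j : ℤ, p.close q = u * (p.closing d₀) ^ j) ?_ ?_ ?_ ⟨0, d₀⟩ γ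
  · exact ⟨1, one_mem _, 0, p.close_id.trans (by simp)⟩
  · rintro y z q f ⟨u, hu, j, h⟩
    obtain ⟨u', hu', j', h'⟩ := hloop f
    refine ⟨_, mul_mem hu (p.zpow_closing_mem u' hu' j), j + j', (p.close_comp q f).trans ?_⟩
    rw [h, h']
    group
  · rintro y z q f ⟨u, hu, j, h⟩
    obtain ⟨u', hu', j', h'⟩ := hloop f
    refine ⟨_, mul_mem hu (p.zpow_closing_mem _ (inv_mem hu') (j - j')), j - j',
      (p.close_comp_inv q f).trans ?_⟩
    rw [h, h']
    group

section Eval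

variable {H : Type} [Group H] (w : ∀ {x y : TVertex L}, TEdge L x y → H)
  (hw : ∀ (x y : Quiver.FreeGroupoid (TVertex L)) (f g : x ⟶ y), TRel L f g →
      (TEdge.labelFunctor w).map f = (TEdge.labelFunctor w).map g)

/-- The product of the labels along the chosen path to a vertex. -/
noncomputable def frame (x : TVertex L) : H := TGroupoid.eval w hw (p.path x)

theorem hom_loop {x y : TVertex L} (f : TEdge L x y) : FundGroup.hom w hw d₀ (p.loop f) =
    p.frame w hw x * w f * (p.frame w hw y)⁻¹ := by
  change TGroupoid.eval w hw (p.path x ≫ f.mor ≫ inv (p.path y)) = _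
  rw [TGroupoid.eval_comp, TGroupoid.eval_comp, TGroupoid.eval_mor, TGroupoid.eval_inv, mul_assoc]
  rfl

theorem frame_base : p.frame w hw ⟨0, d₀⟩ = 1 := by
  exact (congrArg (TGroupoid.eval w hw) p.path_base).trans (TGroupoid.eval_id w hw _)

end Eval

/-- The chosen paths have height zero. This holds for the paths in the bottom surface; it passes to
the next surface along the edges `up`, whose loops are trivial, and to the new vertices along short
edges, whose loops lie in the bottom surface. -/
theorem height_frame (x : TVertex L) : p.frame TEdge.height TEdge.height_rel x = 1 := by
  obtain ⟨i, d⟩ := x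
  have hlong : ∀ i d, p.frame TEdge.height TEdge.height_rel ⟨i, Dart.rev d⟩ =
      p.frame TEdge.height TEdge.height_rel ⟨i, d⟩ := by
    intro i d
    have := p.hom_loop TEdge.height TEdge.height_rel (TEdge.long i d d.rev rfl)
    rw [loop_long, map_one, eq_comm, mul_inv_eq_one] at this
    exact this.symm.trans (mul_one _)
  have h0 : ∀ d (q : TGroupoid.base L d₀ ⟶ (⟨0, d⟩ : TVertex L).ob), LevelPath L d₀ d q →
      TGroupoid.eval TEdge.height TEdge.height_rel q = 1 := by
    intro d q h
    induction h with
    | refl => exact TGroupoid.eval_id _ _ _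
    | long d d' h q _ ih => rw [TGroupoid.eval_comp, ih, TGroupoid.eval_mor]; rfl
    | short d q _ ih => rw [TGroupoid.eval_comp, ih, TGroupoid.eval_mor]; rfl
  have hc : ∀ d, FundGroup.hom TEdge.height TEdge.height_rel d₀ (p.corner d) = 1 := by
    intro d
    have := p.hom_loop TEdge.height TEdge.height_rel (TEdge.short 0 d d.rev _ rfl rfl)
    rw [loop_short, L.cornerLevel_zero] at this
    rw [this, frame, frame, h0 _ _ (p.levelPath _), h0 _ _ (p.levelPath _)]
    rfl
  have hc' : ∀ i d, FundGroup.hom TEdge.height TEdge.height_rel d₀ (L.cornerLevel p.corner i d) =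
      1 := L.cornerLevel_mem (F := (FundGroup.hom TEdge.height TEdge.height_rel d₀).ker) hc
  induction i using Fin.induction generalizing d with
  | zero => exact h0 _ _ (p.levelPath d)
  | succ i ih =>
    have hup : ∀ d : Dart n, d.1 ≠ L.flipAt i →
        p.frame TEdge.height TEdge.height_rel ⟨i.succ, d⟩ = 1 := by
      intro d hd
      have := p.hom_loop TEdge.height TEdge.height_rel (TEdge.up i d hd)
      rw [loop_up, map_one, ih, eq_comm, mul_inv_eq_one] at this
      exact this.symm
    by_cases hd : d.1 ≠ L.flipAt i
    · exact hup d hd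
    · rw [not_not] at hd
      have := p.hom_loop TEdge.height TEdge.height_rel (TEdge.short i.succ d d.rev _ rfl
        ((L.isFlip i).next_self d hd))
      rw [loop_short, hc', hlong, hup _ ((L.isFlip i).next_next_edge_ne hd), inv_one,
        mul_one] at this
      exact (this.trans (mul_one _)).symm

theorem alpha_loop {x y : TVertex L} (f : TEdge L x y) :
    FundGroup.alpha L d₀ (p.loop f) = f.height := by
  rw [FundGroup.alpha, hom_loop, height_frame, height_frame, one_mul, inv_one, mul_one]

theorem alpha_closing (d : Dart n) : FundGroup.alpha L d₀ (p.closing d) = Multiplicative.ofAdd 1 :=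
  p.alpha_loop (TEdge.close d _ rfl)

theorem alpha_corner (d : Dart n) : FundGroup.alpha L d₀ (p.corner d) = 1 :=
  p.alpha_loop (TEdge.short 0 d d.rev _ rfl rfl)

/-- The fundamental group of the fibre is generated by the loops of the short edges of the bottom
surface. -/
theorem fibre_eq_ker : p.fibre = (FundGroup.alpha L d₀).ker := by
  have h1 : p.fibre ≤ (FundGroup.alpha L d₀).ker := by
    refine (Subgroup.closure_le _).2 ?_
    rintro _ ⟨d, rfl⟩
    exact p.alpha_corner d
  refine le_antisymm h1 fun γ hγ => ?_
  obtain ⟨u, hu, j, rfl⟩ := p.exists_eq_mul_zpow γ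
  have h2 : FundGroup.alpha L d₀ u = 1 := h1 hu
  have h3 : FundGroup.alpha L d₀ (u * p.closing d₀ ^ j) = 1 := hγ
  rw [map_mul, h2, one_mul, map_zpow, alpha_closing, ← ofAdd_zsmul, smul_eq_mul, mul_one,
    ofAdd_eq_one] at h3
  rw [h3, zpow_zero, mul_one]
  exact hu

end BasePaths

/-! ### The fundamental group of the fibre is free -/

namespace LayeredTriangulation

open SurfaceTriangulation

variable {n : ℕ} (L : LayeredTriangulation n)

/-- The mapping torus of the automorphism `freeMonodromy`. -/
abbrev FreeTorus : Type := FreeGroup {d : Dart n // ¬ (L.tri 0).IsMarked d} ⋊[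
    zpowersHom _ L.freeMonodromy] Multiplicative ℤ

/-- The labels in the mapping torus of the automorphism `freeMonodromy`. -/
noncomputable def freeLabels : GroupLabels L L.FreeTorus :=
  GroupLabels.ofTriangular (s := fun d => SemidirectProduct.inl ((L.tri 0).freeLabel d))
    (fun d => by rw [← map_mul, ← map_mul, (L.tri 0).isTriangular_freeLabel d, map_one])
    (SemidirectProduct.inr (Multiplicative.ofAdd 1)) fun d => by
      rw [← L.map_cornerLevel SemidirectProduct.inl, ← L.freeMonodromy_freeLabel]
      have h : zpowersHom _ L.freeMonodromy (Multiplicative.ofAdd 1) = L.freeMonodromy := by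
        rw [zpowersHom_apply, toAdd_ofAdd, zpow_one]
      have := SemidirectProduct.inl_aut (φ := zpowersHom _ L.freeMonodromy)
        (Multiplicative.ofAdd (1 : ℤ)) ((L.tri 0).freeLabel d)
      rw [h, map_inv, eq_mul_inv_iff_mul_eq] at this
      exact this.symm

end LayeredTriangulation

namespace BasePaths

open SurfaceTriangulation

variable {n : ℕ} {L : LayeredTriangulation n} {d₀ : Dart n} (p : BasePaths L d₀)

/-- The homomorphism to the mapping torus of the automorphism `freeMonodromy`: the long edges are
collapsed to points. -/
noncomputable def toFreeTorus (L : LayeredTriangulation n) (d₀ : Dart n) :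
    FundGroup L d₀ →* L.FreeTorus :=
  FundGroup.hom L.freeLabels.label L.freeLabels.label_rel d₀

/-- The product of the labels along the chosen path to a vertex of the bottom surface lies in the
free group, and it is mapped to `1` by the homomorphism from the free group to the fundamental group
of the fibre, as the loop of the path is trivial. -/
theorem exists_frame (d : Dart n) : ∃ a, p.frame L.freeLabels.label L.freeLabels.label_rel ⟨0, d⟩ =
    SemidirectProduct.inl a ∧ (L.tri 0).freeLift p.corner a = 1 := by
  have h0 : ∀ d (q : TGroupoid.base L d₀ ⟶ (⟨0, d⟩ : TVertex L).ob), LevelPath L d₀ d q →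
      ∃ a, TGroupoid.eval L.freeLabels.label L.freeLabels.label_rel q = SemidirectProduct.inl a ∧
        (L.tri 0).freeLift p.corner a = p.close q := by
    intro d q h
    induction h with
    | refl =>
      refine ⟨1, (TGroupoid.eval_id _ _ _).trans (map_one _).symm, ?_⟩
      rw [map_one]
      exact p.close_id.symm
    | long d d' h q _ ih =>
      obtain ⟨a, ha, ha'⟩ := ih
      refine ⟨a, ?_, ?_⟩
      · rw [TGroupoid.eval_comp, ha, TGroupoid.eval_mor]
        exact mul_one _
      · rw [close_comp, loop_long, ha', mul_one]
    | short d q _ ih =>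
      obtain ⟨a, ha, ha'⟩ := ih
      refine ⟨a * (L.tri 0).freeLabel d, ?_, ?_⟩
      · rw [TGroupoid.eval_comp, ha, TGroupoid.eval_mor, map_mul]
        rfl
      · rw [close_comp, loop_short, map_mul, ha', freeLift_freeLabel _ p.isTriangular_corner]
        rfl
  obtain ⟨a, ha, ha'⟩ := h0 d _ (p.levelPath d)
  exact ⟨a, ha, ha'.trans (p.close_path _)⟩

/-- The element of the free group given by the chosen path to a vertex of the bottom surface. -/
noncomputable def freeFrame (d : Dart n) : FreeGroup {d : Dart n // ¬ (L.tri 0).IsMarked d} :=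
  (p.exists_frame d).choose

theorem frame_eq_inl (d : Dart n) : p.frame L.freeLabels.label L.freeLabels.label_rel ⟨0, d⟩ =
    SemidirectProduct.inl (p.freeFrame d) := (p.exists_frame d).choose_spec.1

theorem freeLift_freeFrame (d : Dart n) : (L.tri 0).freeLift p.corner (p.freeFrame d) = 1 :=
  (p.exists_frame d).choose_spec.2

theorem freeFrame_base : p.freeFrame d₀ = 1 := by
  have := p.frame_base L.freeLabels.label L.freeLabels.label_rel
  rw [frame_eq_inl, ← map_one SemidirectProduct.inl] at this
  exact SemidirectProduct.inl_injective this

theorem freeFrame_rev (d : Dart n) : p.freeFrame d.rev = p.freeFrame d := by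
  have := p.hom_loop L.freeLabels.label L.freeLabels.label_rel (TEdge.long 0 d d.rev rfl)
  rw [loop_long, map_one, frame_eq_inl, frame_eq_inl, eq_comm, mul_inv_eq_one] at this
  exact (SemidirectProduct.inl_injective (this.symm.trans (mul_one _)))

theorem toFreeTorus_corner (d : Dart n) : toFreeTorus L d₀ (p.corner d) = SemidirectProduct.inl
    (p.freeFrame d.rev * (L.tri 0).freeLabel d * (p.freeFrame ((L.tri 0).next d))⁻¹) := by
  have := p.hom_loop L.freeLabels.label L.freeLabels.label_rel
    (TEdge.short 0 d d.rev _ rfl rfl)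
  rw [loop_short, frame_eq_inl, frame_eq_inl] at this
  rw [map_mul, map_mul, map_inv]
  exact this

/-- The homomorphism from the fundamental group of the fibre to the free group which is the
fundamental group of the surface with all long edges collapsed to points. -/
noncomputable def toFree : p.fibre →* FreeGroup {d : Dart n // ¬ (L.tri 0).IsMarked d} where
  toFun γ := (toFreeTorus L d₀ γ.1).left
  map_one' := by
    rw [OneMemClass.coe_one, map_one]; rfl
  map_mul' γ δ := by
    have h : p.fibre ≤ (SemidirectProduct.rightHom.comp (toFreeTorus L d₀)).ker := by
      refine (Subgroup.closure_le _).2 ?_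
      rintro _ ⟨d, rfl⟩
      change SemidirectProduct.rightHom (toFreeTorus L d₀ (p.corner d)) = 1
      rw [toFreeTorus_corner, SemidirectProduct.rightHom_inl]
    have h' : (toFreeTorus L d₀ γ.1).right = 1 := h γ.2
    rw [Subgroup.coe_mul, map_mul, SemidirectProduct.mul_left, h', map_one]
    rfl

theorem toFree_corner (d : Dart n) : p.toFree ⟨p.corner d, p.corner_mem d⟩ =
    p.freeFrame d.rev * (L.tri 0).freeLabel d * (p.freeFrame ((L.tri 0).next d))⁻¹ := by
  change (toFreeTorus L d₀ (p.corner d)).left = _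
  rw [toFreeTorus_corner, SemidirectProduct.left_inl]

/-- The fundamental group of the fibre is a retract of the fundamental group of the surface with all
long edges collapsed to points. -/
theorem freeLift_toFree (γ : p.fibre) : (L.tri 0).freeLift p.corner (p.toFree γ) = γ := by
  obtain ⟨γ, hγ⟩ := γ
  change _ = γ
  induction hγ using Subgroup.closure_induction with
  | mem γ h =>
    obtain ⟨d, rfl⟩ := h
    have := congrArg ((L.tri 0).freeLift p.corner) (p.toFree_corner d)
    rw [map_mul, map_mul, map_inv, freeLift_freeFrame, freeLift_freeFrame,
      freeLift_freeLabel _ p.isTriangular_corner, inv_one, mul_one, one_mul] at this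
    exact this
  | one =>
    have := map_one ((L.tri 0).freeLift p.corner)
    rw [← map_one p.toFree] at this
    exact this
  | mul γ δ hγ hδ h1 h2 =>
    have := map_mul ((L.tri 0).freeLift p.corner) (p.toFree ⟨γ, hγ⟩) (p.toFree ⟨δ, hδ⟩)
    rw [← map_mul, h1, h2] at this
    exact this
  | inv γ hγ h1 =>
    have := map_inv ((L.tri 0).freeLift p.corner) (p.toFree ⟨γ, hγ⟩)
    rw [← map_inv, h1] at this
    exact this

theorem toFree_injective : Function.Injective p.toFree := fun γ δ h => by
  apply Subtype.ext
  rw [← p.freeLift_toFree γ, h, p.freeLift_toFree]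

theorem isFreeGroup_fibre : IsFreeGroup p.fibre :=
  IsFreeGroup.ofMulEquiv (MonoidHom.ofInjective p.toFree_injective).symm

variable (L d₀) in
/-- The fundamental group of the fibre has a finite free basis. -/
theorem exists_basis : ∃ (m : ℕ) (x : Fin m → FundGroup L d₀),
    Function.Injective (FreeGroup.lift x) ∧
      (FreeGroup.lift x).range = (FundGroup.alpha L d₀).ker := by
  obtain ⟨p⟩ := nonempty_basePaths L d₀
  have h := p.isFreeGroup_fibre
  let e := IsFreeGroup.toFreeGroup p.fibre
  have hfg : Group.FG p.fibre := by
    rw [Group.fg_iff_subgroup_fg]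
    exact ⟨(Set.finite_range p.corner).toFinset, by rw [Set.Finite.coe_toFinset]; rfl⟩
  have : Group.FG (FreeGroup (IsFreeGroup.Generators p.fibre)) :=
    Group.fg_of_surjective (f := e.toMonoidHom) e.surjective
  have hfin : Finite (IsFreeGroup.Generators p.fibre) := finite_of_fg_freeGroup
  obtain ⟨m, ⟨b⟩⟩ := Finite.exists_equiv_fin (IsFreeGroup.Generators p.fibre)
  let f : FreeGroup (Fin m) ≃* p.fibre := (FreeGroup.freeGroupCongr b.symm).trans e.symm
  have hf : FreeGroup.lift (fun i => ((f (FreeGroup.of i) : p.fibre) : FundGroup L d₀)) =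
      p.fibre.subtype.comp f.toMonoidHom := FreeGroup.ext_hom _ _ fun i => by simp
  refine ⟨m, fun i => ((f (FreeGroup.of i) : p.fibre) : FundGroup L d₀), ?_, ?_⟩
  · rw [hf]
    exact p.fibre.subtype_injective.comp f.injective
  · rw [hf, ← fibre_eq_ker p, MonoidHom.range_comp]
    rw [MonoidHom.range_eq_top.2 f.surjective, ← MonoidHom.range_eq_map, Subgroup.range_subtype]

/-- A lower bound on the rank of the fundamental group of the fibre, which follows by counting
homomorphisms to a group of order two: a homomorphism from the free group of rank `4n` is determined
by its values on the image of the fundamental group of the fibre and on the elements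
`freeFrame` of the edges other than the one of the base point, of which there are `3n - 1`. -/
theorem le_of_range_eq {m : ℕ} (x : Fin m → FundGroup L d₀)
    (hx : (FreeGroup.lift x).range = (FundGroup.alpha L d₀).ker) : n + 1 ≤ m := by
  classical
  obtain ⟨p⟩ := nonempty_basePaths L d₀
  have hmem : ∀ u, FreeGroup.lift x u ∈ p.fibre := fun u => by
    rw [fibre_eq_ker, ← hx]; exact ⟨u, rfl⟩
  let y : Fin m → p.fibre := fun i => ⟨x i, by
    have := hmem (FreeGroup.of i)
    rwa [FreeGroup.lift_apply_of] at this⟩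
  have hy : Function.Surjective (FreeGroup.lift y) := by
    have h1 : p.fibre.subtype.comp (FreeGroup.lift y) = FreeGroup.lift x :=
      FreeGroup.ext_hom _ _ fun i => by simp [y]
    rintro ⟨γ, hγ⟩
    have h2 : γ ∈ (FreeGroup.lift x).range := by rw [hx, ← fibre_eq_ker p]; exact hγ
    obtain ⟨u, hu⟩ := h2
    refine ⟨u, Subtype.ext ?_⟩
    rw [← h1] at hu
    exact hu
  let A := Multiplicative (ZMod 2)
  let F : ({d : Dart n // ¬ (L.tri 0).IsMarked d} → A) →
      (Fin m → A) × ({e : Fin (3 * n) // e ≠ d₀.1} → A) := fun φ =>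
    (fun i => FreeGroup.lift φ (p.toFree (y i)),
      fun e => FreeGroup.lift φ (p.freeFrame (e.1, true)))
  have hF : Function.Injective F := by
    intro φ ψ h
    apply FreeGroup.lift.injective
    have h1 : ∀ γ, FreeGroup.lift φ (p.toFree γ) = FreeGroup.lift ψ (p.toFree γ) := by
      have : (FreeGroup.lift φ).comp (p.toFree.comp (FreeGroup.lift y)) =
          (FreeGroup.lift ψ).comp (p.toFree.comp (FreeGroup.lift y)) :=
        FreeGroup.ext_hom _ _ fun i => by
          have := congrFun (congrArg Prod.fst h) i
          simpa using this
      intro γ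
      obtain ⟨u, rfl⟩ := hy γ
      exact DFunLike.congr_fun this u
    have h2 : ∀ d, FreeGroup.lift φ (p.freeFrame d) = FreeGroup.lift ψ (p.freeFrame d) := by
      have key : ∀ d : Dart n, FreeGroup.lift φ (p.freeFrame d) = FreeGroup.lift ψ (p.freeFrame d) →
          ∀ d' : Dart n, d'.1 = d.1 →
            FreeGroup.lift φ (p.freeFrame d') = FreeGroup.lift ψ (p.freeFrame d') := by
        intro d hd d' hd'
        rcases PtolemyAssignment.dart_eq_or hd' with rfl | rfl
        · exact hd
        · rw [freeFrame_rev, hd]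
      intro d
      by_cases hd : d.1 = d₀.1
      · exact key d₀ (by rw [freeFrame_base, map_one, map_one]) d hd
      · exact key (d.1, true) (congrFun (congrArg Prod.snd h) ⟨d.1, hd⟩) d rfl
    refine (L.tri 0).freeGroup_hom_ext fun d => ?_
    have h3 := h1 ⟨p.corner d, p.corner_mem d⟩
    rw [toFree_corner, map_mul, map_mul, map_mul, map_mul, map_inv, map_inv, h2, h2] at h3
    exact mul_left_cancel (mul_right_cancel h3)
  have hcard := Fintype.card_le_of_injective F hF
  have h2 : Fintype.card A = 2 := rfl
  rw [Fintype.card_prod, Fintype.card_fun, Fintype.card_fun, Fintype.card_fun, card_not_isMarked,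
    h2, Fintype.card_fin, Fintype.card_subtype_compl, Fintype.card_fin,
    Fintype.card_subtype_eq, ← pow_add] at hcard
  have := (Nat.pow_le_pow_iff_right (by norm_num)).1 hcard
  have := d₀.1.pos
  omega

end BasePaths

/-! ### The symmetric square of the labels of a Ptolemy assignment -/

/-- The second symmetric power of the standard representation of `SL(2, ℂ)`. -/
noncomputable def symSqRep : SL(2, ℂ) →* Module.End ℂ (Fin 3 → ℂ) :=
  (Matrix.toLinAlgEquiv' (R := ℂ) (n := Fin 3)).toMonoidHom.comp symSq

theorem symSqRep_apply (g : SL(2, ℂ)) (v : Fin 3 → ℂ) :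
    symSqRep g v = Matrix.mulVec (symSq g) v := rfl

theorem symSqRep_inv_apply_self (g : SL(2, ℂ)) (v : Fin 3 → ℂ) :
    symSqRep g⁻¹ (symSqRep g v) = v := by
  rw [← Module.End.mul_apply, ← map_mul, inv_mul_cancel, map_one, Module.End.one_apply]

theorem symSqRep_self_apply_inv (g : SL(2, ℂ)) (v : Fin 3 → ℂ) :
    symSqRep g (symSqRep g⁻¹ v) = v := by
  rw [← Module.End.mul_apply, ← map_mul, mul_inv_cancel, map_one, Module.End.one_apply]

theorem symSqRep_shortMatrix (ε : ℤˣ) (u : ℂ) (v : Fin 3 → ℂ) :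
    symSqRep (shortMatrix ε u) v =
      ![v 0 + sgn ε * u * v 1 + u ^ 2 * v 2, v 1 + 2 * sgn ε * u * v 2, v 2] := by
  have h := sgn_sq ε
  rw [symSqRep_apply]
  ext i
  fin_cases i <;>
    simp [symSq, shortMatrix_coe, Matrix.mulVec, dotProduct, Fin.sum_univ_three, pow_two, h]
  left; ring

theorem symSqRep_longMatrix (z : ℂ) (hz : z ≠ 0) (v : Fin 3 → ℂ) :
    symSqRep (longMatrix z hz) v = ![z⁻¹ ^ 2 * v 2, - v 1, z ^ 2 * v 0] := by
  rw [symSqRep_apply]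
  ext i
  fin_cases i <;>
    simp [symSq, longMatrix_coe, Matrix.mulVec, dotProduct, Fin.sum_univ_three, hz]

theorem det_symSq (g : SL(2, ℂ)) : (symSq g).det = 1 := by
  have h : g 0 0 * g 1 1 - g 0 1 * g 1 0 = 1 := by
    rw [← Matrix.det_fin_two]; exact g.2
  have : (symSq g).det = (g 0 0 * g 1 1 - g 0 1 * g 1 0) ^ 3 := by
    rw [Matrix.det_fin_three]
    simp [symSq]
    ring
  rw [this, h, one_pow]

/-- Every element of `SL(2, ℂ)` fixes a vector of the adjoint representation. -/
theorem det_one_sub_symSq (g : SL(2, ℂ)) : (1 - symSq g).det = 0 := by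
  have h : g 0 0 * g 1 1 - g 0 1 * g 1 0 = 1 := by
    rw [← Matrix.det_fin_two]; exact g.2
  rw [Matrix.det_fin_three]
  simp [symSq]
  grind

namespace PtolemyAssignment

variable {n : ℕ} {L : LayeredTriangulation n} {σ : BoundarySign L} (c : PtolemyAssignment L σ)

/-- The Ptolemy variable of an oriented edge. -/
noncomputable def var (i : Fin (L.N + 1)) (d : Dart n) : ℂ := onDart (c.val i) d

theorem var_ne_zero (i : Fin (L.N + 1)) (d : Dart n) : c.var i d ≠ 0 :=
  onDart_ne_zero (c.ne_zero i) d

theorem var_rev (i : Fin (L.N + 1)) (d : Dart n) : c.var i d.rev = - c.var i d := onDart_rev _ _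

/-- The label of a long edge. -/
noncomputable def longLabel (i : Fin (L.N + 1)) (d : Dart n) : SL(2, ℂ) :=
  longMatrix (c.var i d) (c.var_ne_zero i d)

/-- The off-diagonal entry of the label of a short edge. -/
noncomputable def entry (i : Fin (L.N + 1)) (d : Dart n) : ℂ :=
  shortEntry (L.tri i) (σ.sign i) (c.val i) d

/-- The label of a short edge. -/
noncomputable def shortLabel (i : Fin (L.N + 1)) (d : Dart n) : SL(2, ℂ) :=
  shortMatrix (σ.sign i d) (c.entry i d)

theorem entry_eq (i : Fin (L.N + 1)) (d : Dart n) : c.entry i d =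
    - (sgn (σ.sign i ((L.tri i).next d)) * sgn (σ.sign i ((L.tri i).next ((L.tri i).next d)))) *
      (c.var i ((L.tri i).next ((L.tri i).next d)) /
        (c.var i d * c.var i ((L.tri i).next d))) := by
  rw [← sgn_mul]; rfl

end PtolemyAssignment

/-! ### Twisted cocycles on the truncated surfaces -/

theorem Dart.rev_fst_ne {n : ℕ} {d : Dart n} {e : Fin (3 * n)} (h : d.1 ≠ e) : d.rev.1 ≠ e := h

/-- The fundamental group `K` of the fibre with its generators `corner`, given by the short edges of
the bottom surface, together with its monodromy `conj` (conjugation by an element `s` of the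
fundamental group of the mapping torus), the restriction `rho` of the representation of a Ptolemy
assignment and the image `stable` of `s`. The element `frame i d` is the image of the path from the
base point to the vertex `d` of the surface `tri i`, and `closing d` is the loop along the edge from
the top to the bottom at `d`, multiplied by the inverse of `s`. -/
structure FibreFrame {n : ℕ} {L : LayeredTriangulation n} {σ : BoundarySign L}
    (c : PtolemyAssignment L σ) (K : Type) [Group K] where
  corner : Dart n → K
  triangular : (L.tri 0).IsTriangular corner
  base : Dart n
  surfPath : ∀ v, (L.tri 0).SurfPath corner base v 1
  closure_eq : Subgroup.closure (Set.range corner) = ⊤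
  rho : K →* SL(2, ℂ)
  frame : Fin (L.N + 1) → Dart n → SL(2, ℂ)
  rho_corner : ∀ i d, rho (L.cornerLevel corner i d) =
    frame i d.rev * c.shortLabel i d * (frame i ((L.tri i).next d))⁻¹
  frame_rev : ∀ i d, frame i d.rev = frame i d * c.longLabel i d
  frame_up : ∀ (i : Fin L.N) (d : Dart n), d.1 ≠ L.flipAt i →
    frame i.succ d = frame i.castSucc d
  conj : K →* K
  stable : SL(2, ℂ)
  rho_conj : ∀ g, rho (conj g) = stable * rho g * stable⁻¹
  closing : Dart n → K
  closing_rev : ∀ d, closing d.rev = closing d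
  closing_corner : ∀ d, L.cornerLevel corner (Fin.last L.N) (L.mono d) =
    closing d.rev * conj (corner d) * (closing ((L.tri 0).next d))⁻¹
  rho_closing : ∀ d, rho (closing d) * stable =
    frame (Fin.last L.N) (L.mono d) * (frame 0 d)⁻¹

namespace FibreFrame

open SurfaceTriangulation

variable {n : ℕ} {L : LayeredTriangulation n} {σ : BoundarySign L} {c : PtolemyAssignment L σ}
  {K : Type} [Group K] (D : FibreFrame c K)

/-- The space of crossed homomorphisms with values in the adjoint representation. -/
def crossed : Submodule ℂ (K → Fin 3 → ℂ) where
  carrier := {z | ∀ g h, z (g * h) = z g + symSqRep (D.rho g) (z h)}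
  add_mem' := fun {z z'} hz hz' g h => by
    simp only [Pi.add_apply, hz g h, hz' g h, map_add]
    abel
  zero_mem' := fun g h => by simp
  smul_mem' := fun a z hz g h => by
    simp only [Pi.smul_apply, hz g h, map_smul, smul_add]

/-- The value of a crossed homomorphism. -/
def ev (g : K) : D.crossed →ₗ[ℂ] (Fin 3 → ℂ) where
  toFun z := z.1 g
  map_add' _ _ := rfl
  map_smul' _ _ := rfl

theorem ev_mul (g h : K) (z : D.crossed) :
    D.ev (g * h) z = D.ev g z + symSqRep (D.rho g) (D.ev h z) := z.2 g h

theorem ev_one (z : D.crossed) : D.ev 1 z = 0 := by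
  have := D.ev_mul 1 1 z
  rwa [mul_one, map_one, map_one, Module.End.one_apply, left_eq_add] at this

theorem ev_inv (g : K) (z : D.crossed) : D.ev g⁻¹ z = - symSqRep (D.rho g⁻¹) (D.ev g z) := by
  have := D.ev_mul g⁻¹ g z
  rw [inv_mul_cancel, ev_one] at this
  exact eq_neg_of_add_eq_zero_left this.symm

theorem crossed_ext {z z' : D.crossed} (h : ∀ d, D.ev (D.corner d) z = D.ev (D.corner d) z') :
    z = z' := by
  apply Subtype.ext
  funext g
  change D.ev g z = D.ev g z'
  have hg : g ∈ Subgroup.closure (Set.range D.corner) := by rw [D.closure_eq]; trivial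
  induction hg using Subgroup.closure_induction with
  | mem g hg => obtain ⟨d, rfl⟩ := hg; exact h d
  | one => rw [ev_one, ev_one]
  | mul g h _ _ hg hh => rw [ev_mul, ev_mul, hg, hh]
  | inv g _ hg => rw [ev_inv, ev_inv, hg]

/-- The monodromy on the crossed homomorphisms. -/
noncomputable def crossedMonodromy : D.crossed →ₗ[ℂ] D.crossed where
  toFun z := ⟨fun g => symSqRep D.stable⁻¹ (D.ev (D.conj g) z), fun g h => by
    have e : symSqRep (D.rho g) (symSqRep D.stable⁻¹ (D.ev (D.conj h) z)) =
        symSqRep D.stable⁻¹ (symSqRep (D.rho (D.conj g)) (D.ev (D.conj h) z)) := by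
      rw [D.rho_conj]
      simp only [map_mul, Module.End.mul_apply]
      rw [symSqRep_inv_apply_self]
    beta_reduce
    rw [map_mul D.conj, ev_mul, map_add, e]⟩
  map_add' z z' := by
    apply Subtype.ext
    funext g
    exact (congrArg _ (map_add _ _ _)).trans (map_add _ _ _)
  map_smul' a z := by
    apply Subtype.ext
    funext g
    exact (congrArg _ (map_smul _ _ _)).trans (map_smul _ _ _)

theorem ev_crossedMonodromy (g : K) (z : D.crossed) :
    D.ev g (D.crossedMonodromy z) = symSqRep D.stable⁻¹ (D.ev (D.conj g) z) := rfl

/-- A crossed homomorphism together with a vector at each vertex of the bottom surface. This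
determines a twisted cocycle on the truncated bottom surface. -/
abbrev Cochains : Type := D.crossed × (Dart n → Fin 3 → ℂ)

/-- The loop of a short edge. -/
abbrev cornerAt (i : Fin (L.N + 1)) (d : Dart n) : K := L.cornerLevel D.corner i d

/-- The value of the twisted cocycle on a short edge, given by vectors at the vertices. -/
noncomputable def shortOf (i : Fin (L.N + 1)) (G : D.Cochains →ₗ[ℂ] (Dart n → Fin 3 → ℂ))
    (d : Dart n) : D.Cochains →ₗ[ℂ] (Fin 3 → ℂ) :=
  symSqRep (D.frame i d.rev)⁻¹ ∘ₗ (D.ev (D.cornerAt i d) ∘ₗ LinearMap.fst ℂ _ _ +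
    LinearMap.proj d.rev ∘ₗ G -
      symSqRep (D.rho (D.cornerAt i d)) ∘ₗ LinearMap.proj ((L.tri i).next d) ∘ₗ G)

open scoped Classical in
/-- The vectors at the vertices of the next surface: the vectors at the vertices which persist are
kept, and those at the new vertices are chosen such that the value of the cocycle on the short edge
at the flipped edge is kept, see `short_self`. -/
noncomputable def vertNext (i : Fin L.N) (G : D.Cochains →ₗ[ℂ] (Dart n → Fin 3 → ℂ)) :
    D.Cochains →ₗ[ℂ] (Dart n → Fin 3 → ℂ) :=
  LinearMap.pi fun d => if d.1 = L.flipAt i then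
    symSqRep (D.frame i.succ d) ∘ₗ D.shortOf i.castSucc G d.rev -
      D.ev (D.cornerAt i.succ d.rev) ∘ₗ LinearMap.fst ℂ _ _ +
      symSqRep (D.rho (D.cornerAt i.succ d.rev)) ∘ₗ
        LinearMap.proj ((L.tri i.castSucc).next ((L.tri i.castSucc).next d.rev)) ∘ₗ G
  else LinearMap.proj d ∘ₗ G

/-- The vectors at the vertices of the surface `tri i`, transported to the base point. -/
noncomputable def vert (i : Fin (L.N + 1)) : D.Cochains →ₗ[ℂ] (Dart n → Fin 3 → ℂ) :=
  Fin.induction (motive := fun _ => D.Cochains →ₗ[ℂ] (Dart n → Fin 3 → ℂ))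
    (LinearMap.pi fun d => symSqRep (D.frame 0 d) ∘ₗ LinearMap.proj d ∘ₗ LinearMap.snd ℂ _ _)
    D.vertNext i

/-- The value of the twisted cocycle on a short edge. -/
noncomputable def short (i : Fin (L.N + 1)) (d : Dart n) : D.Cochains →ₗ[ℂ] (Fin 3 → ℂ) :=
  D.shortOf i (D.vert i) d

/-- The value of the twisted cocycle on a long edge. -/
noncomputable def long (i : Fin (L.N + 1)) (d : Dart n) : D.Cochains →ₗ[ℂ] (Fin 3 → ℂ) :=
  symSqRep (D.frame i d)⁻¹ ∘ₗ (LinearMap.proj d ∘ₗ D.vert i - LinearMap.proj d.rev ∘ₗ D.vert i)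

theorem vert_zero (y : D.Cochains) (d : Dart n) :
    D.vert 0 y d = symSqRep (D.frame 0 d) (y.2 d) := rfl

theorem vert_up (i : Fin L.N) (y : D.Cochains) {d : Dart n} (hd : d.1 ≠ L.flipAt i) :
    D.vert i.succ y d = D.vert i.castSucc y d := by
  change D.vertNext i (D.vert i.castSucc) y d = _
  rw [vertNext, LinearMap.pi_apply, if_neg hd]
  rfl

theorem vert_flip (i : Fin L.N) (y : D.Cochains) {d : Dart n} (hd : d.1 = L.flipAt i) :
    D.vert i.succ y d = symSqRep (D.frame i.succ d) (D.short i.castSucc d.rev y) -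
      D.ev (D.cornerAt i.succ d.rev) y.1 + symSqRep (D.rho (D.cornerAt i.succ d.rev))
        (D.vert i.castSucc y ((L.tri i.castSucc).next ((L.tri i.castSucc).next d.rev))) := by
  change D.vertNext i (D.vert i.castSucc) y d = _
  rw [vertNext, LinearMap.pi_apply, if_pos hd]
  rfl

theorem frame_short (i : Fin (L.N + 1)) (d : Dart n) (y : D.Cochains) :
    symSqRep (D.frame i d.rev) (D.short i d y) = D.ev (D.cornerAt i d) y.1 + D.vert i y d.rev -
      symSqRep (D.rho (D.cornerAt i d)) (D.vert i y ((L.tri i).next d)) :=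
  symSqRep_self_apply_inv _ _

theorem frame_long (i : Fin (L.N + 1)) (d : Dart n) (y : D.Cochains) :
    symSqRep (D.frame i d) (D.long i d y) = D.vert i y d - D.vert i y d.rev :=
  symSqRep_self_apply_inv _ _

theorem rho_corner_frame (i : Fin (L.N + 1)) (d : Dart n) (v : Fin 3 → ℂ) :
    symSqRep (D.rho (D.cornerAt i d)) (symSqRep (D.frame i ((L.tri i).next d)) v) =
      symSqRep (D.frame i d.rev) (symSqRep (c.shortLabel i d) v) := by
  rw [D.rho_corner, map_mul, map_mul, Module.End.mul_apply, Module.End.mul_apply,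
    symSqRep_inv_apply_self]

theorem frame_rev_apply (i : Fin (L.N + 1)) (d : Dart n) (v : Fin 3 → ℂ) :
    symSqRep (D.frame i d.rev) v = symSqRep (D.frame i d) (symSqRep (c.longLabel i d) v) := by
  rw [D.frame_rev, map_mul, Module.End.mul_apply]

theorem symSqRep_injective {g : SL(2, ℂ)} {v w : Fin 3 → ℂ} (h : symSqRep g v = symSqRep g w) :
    v = w := by
  rw [← symSqRep_inv_apply_self g v, h, symSqRep_inv_apply_self]

theorem long_rev (i : Fin (L.N + 1)) (d : Dart n) (y : D.Cochains) :
    D.long i d y = - symSqRep (c.longLabel i d) (D.long i d.rev y) := by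
  apply symSqRep_injective (g := D.frame i d)
  rw [map_neg, ← frame_rev_apply, frame_long, frame_long, Dart.rev_rev, neg_sub]

theorem frame_short_add (i : Fin (L.N + 1)) (d : Dart n) (y : D.Cochains) (v : Fin 3 → ℂ) :
    symSqRep (D.frame i d.rev) (D.short i d y + symSqRep (c.shortLabel i d) v) =
      D.ev (D.cornerAt i d) y.1 + D.vert i y d.rev + symSqRep (D.rho (D.cornerAt i d))
        (symSqRep (D.frame i ((L.tri i).next d)) v - D.vert i y ((L.tri i).next d)) := by
  rw [map_add, frame_short, map_sub, rho_corner_frame]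
  abel

theorem frame_long_add (i : Fin (L.N + 1)) (d : Dart n) (y : D.Cochains) (v : Fin 3 → ℂ) :
    symSqRep (D.frame i d) (D.long i d y + symSqRep (c.longLabel i d) v) =
      D.vert i y d - D.vert i y d.rev + symSqRep (D.frame i d.rev) v := by
  rw [map_add, frame_long, ← frame_rev_apply]

/-- The relation of the hexagon of a truncated triangle. -/
theorem hexagon (i : Fin (L.N + 1)) (d : Dart n) (y : D.Cochains) :
    D.long i d.rev y = D.short i d y + symSqRep (c.shortLabel i d)
      (D.long i ((L.tri i).next d) y + symSqRep (c.longLabel i ((L.tri i).next d))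
        (D.short i ((L.tri i).next d) y + symSqRep (c.shortLabel i ((L.tri i).next d))
          (D.long i ((L.tri i).next ((L.tri i).next d)) y +
            symSqRep (c.longLabel i ((L.tri i).next ((L.tri i).next d)))
            (D.short i ((L.tri i).next ((L.tri i).next d)) y)))) := by
  apply symSqRep_injective (g := D.frame i d.rev)
  rw [frame_short_add, frame_long_add, frame_short_add, frame_long_add, frame_short, frame_long,
    Dart.rev_rev, (L.tri i).next_next_next]
  have ht := L.isTriangular_cornerLevel D.triangular i d
  have h1 := congrArg (fun g => D.ev g y.1) ht
  have h2 := congrArg (fun g => symSqRep (D.rho g) (D.vert i y d)) ht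
  simp only [ev_mul, ev_one, map_mul, map_one, Module.End.mul_apply, Module.End.one_apply] at h1 h2
  simp only [map_add, map_sub]
  change symSqRep (D.rho (D.cornerAt i d)) (symSqRep (D.rho (D.cornerAt i _))
    (symSqRep (D.rho (D.cornerAt i _)) _)) = _ at h2
  change D.ev (D.cornerAt i d) y.1 + symSqRep (D.rho (D.cornerAt i d)) (D.ev (D.cornerAt i _) y.1) +
    symSqRep (D.rho (D.cornerAt i d)) (symSqRep (D.rho (D.cornerAt i _))
    (D.ev (D.cornerAt i _) y.1)) = 0 at h1
  rw [h2]
  linear_combination -h1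

theorem long_up (i : Fin L.N) (y : D.Cochains) {d : Dart n} (hd : d.1 ≠ L.flipAt i) :
    D.long i.succ d y = D.long i.castSucc d y := by
  apply symSqRep_injective (g := D.frame i.castSucc d)
  rw [frame_long, ← D.frame_up i d hd, frame_long, vert_up _ _ _ hd,
    vert_up _ _ _ (show d.rev.1 ≠ _ from hd)]

/-- The value on the short edge at a flipped edge is kept, by the choice of `vertNext`. -/
theorem short_self (i : Fin L.N) (y : D.Cochains) {d : Dart n} (hd : d.1 = L.flipAt i) :
    D.short i.succ d y = D.short i.castSucc d y := by
  apply symSqRep_injective (g := D.frame i.succ d.rev)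
  rw [frame_short, vert_flip _ _ _ (show d.rev.1 = _ from hd), Dart.rev_rev,
    (L.isFlip i).next_self d hd, vert_up _ _ _ ((L.isFlip i).next_next_edge_ne hd)]
  abel

theorem short_other (i : Fin L.N) (y : D.Cochains) {d : Dart n}
    (hd : ¬ (L.tri i.castSucc).Touches (L.flipAt i) d) :
    D.short i.succ d y = D.short i.castSucc d y := by
  have h1 : d.rev.1 ≠ L.flipAt i := fun k => hd (Or.inl k)
  have h2 : ((L.tri i.castSucc).next d).1 ≠ L.flipAt i := fun k => hd (Or.inr (Or.inl k))
  have h3 : D.cornerAt i.succ d = D.cornerAt i.castSucc d := cornerStep_other _ hd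
  apply symSqRep_injective (g := D.frame i.castSucc d.rev)
  rw [frame_short, ← D.frame_up i _ h1, frame_short, (L.isFlip i).next_other d hd, vert_up _ _ _ h1,
    vert_up _ _ _ h2, h3]

/-- The cocycle relation of the 2-cell at an end of the bottom edge of a tetrahedron. -/
theorem short_third (i : Fin L.N) (y : D.Cochains) {x : Dart n} (hx : x.1 = L.flipAt i) :
    D.short i.succ ((L.tri i.castSucc).next ((L.tri i.castSucc).next x)) y =
      D.short i.castSucc ((L.tri i.castSucc).next ((L.tri i.castSucc).next x)) y +
      symSqRep (c.shortLabel i.castSucc ((L.tri i.castSucc).next ((L.tri i.castSucc).next x)))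
        (D.short i.castSucc x.rev y) := by
  have h1 := (L.isFlip i).next_next_edge_ne hx
  have h2 := (L.isFlip i).next_edge_ne (show x.rev.1 = _ from hx)
  have h3 : D.cornerAt i.succ ((L.tri i.castSucc).next ((L.tri i.castSucc).next x)) =
      D.cornerAt i.castSucc ((L.tri i.castSucc).next ((L.tri i.castSucc).next x)) *
        D.cornerAt i.castSucc x.rev := (L.isFlip i).cornerStep_third _ hx
  have h4 := D.frame_short i.castSucc x.rev y
  rw [Dart.rev_rev] at h4
  have h5 := D.rho_corner_frame i.castSucc ((L.tri i.castSucc).next ((L.tri i.castSucc).next x))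
    (D.short i.castSucc x.rev y)
  rw [(L.tri i.castSucc).next_next_next] at h5
  apply symSqRep_injective
    (g := D.frame i.castSucc ((L.tri i.castSucc).next ((L.tri i.castSucc).next x)).rev)
  rw [map_add, frame_short, ← h5, h4, ← D.frame_up i _ (Dart.rev_fst_ne h1), frame_short,
    (L.isFlip i).next_third x hx, vert_up _ _ _ h2, vert_up _ _ _ (Dart.rev_fst_ne h1), h3, ev_mul,
    map_mul, map_mul,
    Module.End.mul_apply, (L.tri i.castSucc).next_next_next, map_sub, map_add]
  abel

/-- The cocycle relation of the 2-cell at an end of the top edge of a tetrahedron. -/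
theorem short_next (i : Fin L.N) (y : D.Cochains) {x : Dart n} (hx : x.1 = L.flipAt i) :
    D.short i.castSucc ((L.tri i.castSucc).next x) y =
      D.short i.succ ((L.tri i.castSucc).next x) y +
      symSqRep (c.shortLabel i.succ ((L.tri i.castSucc).next x)) (D.short i.castSucc x y) := by
  have h1 := (L.isFlip i).next_next_edge_ne hx
  have h2 := (L.isFlip i).next_edge_ne hx
  have h3 : D.cornerAt i.castSucc ((L.tri i.castSucc).next x) =
      D.cornerAt i.succ ((L.tri i.castSucc).next x) * D.cornerAt i.succ x := by
    have e1 : D.cornerAt i.succ ((L.tri i.castSucc).next x) = (D.cornerAt i.castSucc x)⁻¹ :=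
      (L.isFlip i).cornerStep_next _ hx
    have e2 : D.cornerAt i.succ x = (D.cornerAt i.castSucc
      ((L.tri i.castSucc).next ((L.tri i.castSucc).next x)))⁻¹ := cornerStep_self _ hx
    have e3 := L.isTriangular_cornerLevel D.triangular i.castSucc x
    rw [mul_eq_one_iff_eq_inv] at e3
    rw [e1, e2, ← e3, inv_mul_cancel_left]
  have h4 := D.frame_short i.succ x y
  have h5 := D.rho_corner_frame i.succ ((L.tri i.castSucc).next x) (D.short i.succ x y)
  rw [(L.isFlip i).next_next_eq hx] at h5
  rw [← D.short_self i y hx]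
  apply symSqRep_injective (g := D.frame i.succ ((L.tri i.castSucc).next x).rev)
  rw [map_add, frame_short, ← h5, h4, D.frame_up i _ (Dart.rev_fst_ne h2), frame_short,
    (L.isFlip i).next_next_eq hx, (L.isFlip i).next_self x hx, vert_up _ _ _ (Dart.rev_fst_ne h2),
    vert_up _ _ _ h1, h3, ev_mul, map_mul, map_mul, Module.End.mul_apply, map_sub, map_add]
  abel

/-- The monodromy on the twisted cocycles: a cocycle is extended over all surfaces, restricted to
the top surface and moved to the bottom surface along the edges between the two. -/
noncomputable def cochainMonodromy : D.Cochains →ₗ[ℂ] D.Cochains :=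
  (D.crossedMonodromy ∘ₗ LinearMap.fst ℂ _ _).prod (LinearMap.pi fun d =>
    symSqRep (D.frame (Fin.last L.N) (L.mono d))⁻¹ ∘ₗ
      (LinearMap.proj (L.mono d) ∘ₗ D.vert (Fin.last L.N) +
        D.ev (D.closing d) ∘ₗ LinearMap.fst ℂ _ _))

theorem cochainMonodromy_fst (y : D.Cochains) :
    (D.cochainMonodromy y).1 = D.crossedMonodromy y.1 := rfl

theorem frame_cochainMonodromy (y : D.Cochains) (d : Dart n) :
    symSqRep (D.frame (Fin.last L.N) (L.mono d)) ((D.cochainMonodromy y).2 d) =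
      D.vert (Fin.last L.N) y (L.mono d) + D.ev (D.closing d) y.1 :=
  symSqRep_self_apply_inv _ _

theorem longLabel_mono (d : Dart n) :
    c.longLabel (Fin.last L.N) (L.mono d) = c.longLabel 0 d :=
  PtolemyAssignment.longMatrix_congr (c.val_mono d) _ _

theorem shortLabel_mono (d : Dart n) :
    c.shortLabel (Fin.last L.N) (L.mono d) = c.shortLabel 0 d := by
  refine PtolemyAssignment.shortMatrix_congr (σ.sign_mono d) ?_
  simp only [PtolemyAssignment.entry, shortEntry, L.mono_next, σ.sign_mono, c.val_mono]

/-- The monodromy carries the values on the top surface to values on the bottom surface. -/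
theorem long_mono (y : D.Cochains) (d : Dart n) :
    D.long (Fin.last L.N) (L.mono d) y = D.long 0 d (D.cochainMonodromy y) := by
  have h : D.long 0 d (D.cochainMonodromy y) = (D.cochainMonodromy y).2 d -
      symSqRep (c.longLabel 0 d) ((D.cochainMonodromy y).2 d.rev) := by
    apply symSqRep_injective (g := D.frame 0 d)
    rw [frame_long, map_sub, vert_zero, vert_zero, frame_rev_apply]
  rw [h]
  apply symSqRep_injective (g := D.frame (Fin.last L.N) (L.mono d))
  rw [frame_long, map_sub, ← longLabel_mono, ← frame_rev_apply, ← L.mono_rev,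
    frame_cochainMonodromy, frame_cochainMonodromy, D.closing_rev]
  abel

theorem short_mono (y : D.Cochains) (d : Dart n) :
    D.short (Fin.last L.N) (L.mono d) y = D.short 0 d (D.cochainMonodromy y) := by
  have h : symSqRep (D.frame (Fin.last L.N) (L.mono d.rev)) (D.short 0 d (D.cochainMonodromy y)) =
      symSqRep (D.rho (D.closing d.rev)) (D.ev (D.conj (D.corner d)) y.1) +
      symSqRep (D.frame (Fin.last L.N) (L.mono d.rev)) ((D.cochainMonodromy y).2 d.rev) -
      symSqRep (D.frame (Fin.last L.N) (L.mono d.rev)) (symSqRep (c.shortLabel 0 d)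
        ((D.cochainMonodromy y).2 ((L.tri 0).next d))) := by
    have e1 : D.frame (Fin.last L.N) (L.mono d.rev) =
        D.rho (D.closing d.rev) * D.stable * D.frame 0 d.rev := by
      rw [D.rho_closing, inv_mul_cancel_right]
    have e2 := D.frame_short 0 d (D.cochainMonodromy y)
    rw [vert_zero, vert_zero, rho_corner_frame, cochainMonodromy_fst, ev_crossedMonodromy] at e2
    rw [e1]
    simp only [map_mul, Module.End.mul_apply]
    rw [e2]
    simp only [map_add, map_sub, symSqRep_self_apply_inv]
    rfl
  apply symSqRep_injective (g := D.frame (Fin.last L.N) (L.mono d.rev))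
  have e3 := D.frame_short (Fin.last L.N) (L.mono d) y
  have e4 := D.rho_corner_frame (Fin.last L.N) (L.mono d)
    ((D.cochainMonodromy y).2 ((L.tri 0).next d))
  rw [L.mono_next, frame_cochainMonodromy, ← L.mono_rev, shortLabel_mono] at e4
  rw [← L.mono_rev, L.mono_next] at e3
  rw [e3, h, ← e4, frame_cochainMonodromy]
  have e5 : D.ev (D.cornerAt (Fin.last L.N) (L.mono d) * D.closing ((L.tri 0).next d)) y.1 =
      D.ev (D.closing d.rev * D.conj (D.corner d)) y.1 := by
    rw [show D.cornerAt (Fin.last L.N) (L.mono d) = _ from D.closing_corner d,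
      inv_mul_cancel_right]
  rw [ev_mul, ev_mul] at e5
  rw [map_add]
  linear_combination e5

end FibreFrame

/-! ### The filtration of the twisted cocycles by their values on the short edges -/

namespace FibreFrame

open SurfaceTriangulation

variable {n : ℕ} {L : LayeredTriangulation n} {σ : BoundarySign L} {c : PtolemyAssignment L σ}
  {K : Type} [Group K] (D : FibreFrame c K)

theorem shortLabel_apply (i : Fin (L.N + 1)) (d : Dart n) (v : Fin 3 → ℂ) :
    symSqRep (c.shortLabel i d) v = ![v 0 + sgn (σ.sign i d) * c.entry i d * v 1 +
      c.entry i d ^ 2 * v 2, v 1 + 2 * sgn (σ.sign i d) * c.entry i d * v 2, v 2] :=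
  symSqRep_shortMatrix _ _ _

theorem longLabel_apply (i : Fin (L.N + 1)) (d : Dart n) (v : Fin 3 → ℂ) :
    symSqRep (c.longLabel i d) v = ![(c.var i d)⁻¹ ^ 2 * v 2, - v 1, c.var i d ^ 2 * v 0] :=
  symSqRep_longMatrix _ _ _

/-- A component of the values on the short edges. -/
noncomputable def shortComp (j : Fin 3) : D.Cochains →ₗ[ℂ] (Dart n → ℂ) :=
  LinearMap.pi fun d => LinearMap.proj j ∘ₗ D.short 0 d

theorem shortComp_apply (j : Fin 3) (y : D.Cochains) (d : Dart n) :
    D.shortComp j y d = D.short 0 d y j := rfl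

/-- If the labels of the short edges act trivially on a component of the values on the short edges,
then these components are transported by the flips like untwisted cocycles. -/
theorem short_eq_shortLevel (y : D.Cochains) (j : Fin 3)
    (h : ∀ (i : Fin (L.N + 1)) (k : Fin L.N) (d d' : Dart n),
      (∀ q, D.short k.castSucc q y j = L.shortLevel k.castSucc (D.shortComp j y) q) →
      symSqRep (c.shortLabel i d) (D.short k.castSucc d' y) j = D.short k.castSucc d' y j)
    (i : Fin (L.N + 1)) (d : Dart n) :
    D.short i d y j = L.shortLevel i (D.shortComp j y) d := by
  induction i using Fin.induction generalizing d with
  | zero => rw [L.shortLevel_zero]; rfl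
  | succ k ih =>
    have ih' := fun q => (ih q).symm
    have hF := L.isFlip k
    rw [L.shortLevel_succ, shortStep_apply, ih']
    refine (L.tri k.castSucc).dart_cases (L.flipAt k) d _ (fun hd => ?_) ?_ ?_ ?_
    · rw [if_neg (hF.next_edge_ne hd), if_neg (hF.next_next_edge_ne hd), D.short_self k y hd]
      ring
    · rintro x hx rfl
      have e := congrFun (D.short_next k y hx) j
      rw [Pi.add_apply, h _ _ _ _ ih] at e
      rw [if_neg (hF.next_next_edge_ne hx), (L.tri k.castSucc).next_next_next, if_pos hx, ih', e]
      ring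
    · rintro x hx rfl
      have e := congrFun (D.short_third k y hx) j
      rw [Pi.add_apply, h _ _ _ _ ih] at e
      rw [(L.tri k.castSucc).next_next_next, if_pos hx, if_neg (hF.next_edge_ne hx), ih', e]
      ring
    · intro hd
      rw [if_neg fun k => hd (Or.inr (Or.inl k)), if_neg fun k => hd (Or.inr (Or.inr k)),
        D.short_other k y hd]
      ring

theorem short_two (y : D.Cochains) (i : Fin (L.N + 1)) (d : Dart n) :
    D.short i d y 2 = L.shortLevel i (D.shortComp 2 y) d :=
  D.short_eq_shortLevel y 2 (fun i k d d' _ => by rw [shortLabel_apply]; rfl) i d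

theorem short_two_eq_zero {y : D.Cochains} (hy : D.shortComp 2 y = 0) (i : Fin (L.N + 1))
    (d : Dart n) : D.short i d y 2 = 0 := by
  rw [short_two, hy, map_zero]; rfl

theorem short_one {y : D.Cochains} (hy : D.shortComp 2 y = 0) (i : Fin (L.N + 1)) (d : Dart n) :
    D.short i d y 1 = L.shortLevel i (D.shortComp 1 y) d :=
  D.short_eq_shortLevel y 1 (fun i k d d' _ => by
    rw [shortLabel_apply, D.short_two_eq_zero hy]; simp) i d

theorem shortComp_two_monodromy (y : D.Cochains) :
    D.shortComp 2 (D.cochainMonodromy y) = L.shortTotal (D.shortComp 2 y) := by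
  funext d
  rw [L.shortTotal_apply, ← short_two, shortComp_apply, ← short_mono]

theorem shortComp_one_monodromy {y : D.Cochains} (hy : D.shortComp 2 y = 0) :
    D.shortComp 1 (D.cochainMonodromy y) = L.shortTotal (D.shortComp 1 y) := by
  funext d
  rw [L.shortTotal_apply, ← D.short_one hy, shortComp_apply, ← short_mono]

/-- The values of a twisted cocycle on the short edges lie in the highest weight line. -/
def IsHorizontal (y : D.Cochains) : Prop := D.shortComp 2 y = 0 ∧ D.shortComp 1 y = 0

variable {D} {y : D.Cochains}

theorem IsHorizontal.two (hy : D.IsHorizontal y) (i : Fin (L.N + 1)) (d : Dart n) :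
    D.short i d y 2 = 0 := D.short_two_eq_zero hy.1 i d

theorem IsHorizontal.one (hy : D.IsHorizontal y) (i : Fin (L.N + 1)) (d : Dart n) :
    D.short i d y 1 = 0 := by
  rw [D.short_one hy.1, hy.2, map_zero]; rfl

theorem long_rev_one (i : Fin (L.N + 1)) (d : Dart n) :
    D.long i d.rev y 1 = D.long i d y 1 := by
  rw [D.long_rev i d, Pi.neg_apply, longLabel_apply]
  simp

theorem long_two (i : Fin (L.N + 1)) (d : Dart n) :
    D.long i d y 2 = - c.var i d ^ 2 * D.long i d.rev y 0 := by
  rw [D.long_rev i d, Pi.neg_apply, longLabel_apply]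
  simp

variable (D) in
/-- The infinitesimal change of the entry of a short edge. The terms of the long edges make it
invariant under changing the cocycle by the coboundaries of highest weight vectors at the
vertices. -/
noncomputable def entryChange (i : Fin (L.N + 1)) (d : Dart n) (y : D.Cochains) : ℂ :=
  D.short i d y 0 - D.long i d.rev y 0 + D.long i ((L.tri i).next d) y 0

/-- The hexagon of a truncated triangle, in its lowest weight component. -/
theorem IsHorizontal.hexagon_two (hy : D.IsHorizontal y) (i : Fin (L.N + 1)) (d : Dart n) :
    c.var i ((L.tri i).next ((L.tri i).next d)) *
        (c.var i ((L.tri i).next d) ^ 2 * D.entryChange i ((L.tri i).next d) y +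
      c.var i d ^ 2 * D.entryChange i ((L.tri i).next ((L.tri i).next d)) y) =
    c.var i d * c.var i ((L.tri i).next d) *
      (sgn (σ.sign i d) * sgn (σ.sign i ((L.tri i).next d)) *
        sgn (σ.sign i ((L.tri i).next ((L.tri i).next d)))) *
        D.long i ((L.tri i).next ((L.tri i).next d)) y 1 := by
  have h := congrFun (D.hexagon i d y) 2
  have z0 := c.var_ne_zero i d
  have z1 := c.var_ne_zero i ((L.tri i).next d)
  have z2 := c.var_ne_zero i ((L.tri i).next ((L.tri i).next d))
  have w := sgn_sq (σ.sign i ((L.tri i).next ((L.tri i).next d)))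
  have w0 := sgn_sq (σ.sign i d)
  have e := c.entry_eq i ((L.tri i).next d)
  rw [(L.tri i).next_next_next] at e
  simp only [Pi.add_apply, shortLabel_apply, longLabel_apply, hy.one, hy.two, Matrix.cons_val,
    long_two, Dart.rev_rev, c.var_rev] at h
  unfold entryChange
  rw [(L.tri i).next_next_next]
  rw [e] at h
  field_simp at h
  generalize sgn (σ.sign i ((L.tri i).next ((L.tri i).next d))) = s2 at *
  generalize sgn (σ.sign i d) = s0 at *
  rw [pow_two s2, pow_two s0, w, w0] at h
  apply mul_left_cancel₀ z2
  linear_combination -h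

/-- The change of the entry of a short edge in terms of the values on the long edges, as
obtained by differentiating the formula for the entry. -/
theorem IsHorizontal.entryChange_eq (hy : D.IsHorizontal y) (i : Fin (L.N + 1)) (d : Dart n) :
    2 * (c.var i d * c.var i ((L.tri i).next d)) * D.entryChange i d y =
      sgn (σ.sign i d) * sgn (σ.sign i ((L.tri i).next d)) *
        sgn (σ.sign i ((L.tri i).next ((L.tri i).next d))) *
        c.var i ((L.tri i).next ((L.tri i).next d)) * (D.long i d y 1 +
          D.long i ((L.tri i).next d) y 1 - D.long i ((L.tri i).next ((L.tri i).next d)) y 1) := by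
  have h0 := hy.hexagon_two i d
  have h1 := hy.hexagon_two i ((L.tri i).next d)
  have h2 := hy.hexagon_two i ((L.tri i).next ((L.tri i).next d))
  simp only [(L.tri i).next_next_next] at h1 h2
  have z0 := c.var_ne_zero i d
  have z1 := c.var_ne_zero i ((L.tri i).next d)
  have z2 := c.var_ne_zero i ((L.tri i).next ((L.tri i).next d))
  generalize c.var i d = c0 at *
  generalize c.var i ((L.tri i).next d) = c1 at *
  generalize c.var i ((L.tri i).next ((L.tri i).next d)) = c2 at *
  apply mul_left_cancel₀ (mul_ne_zero z0 z1)
  linear_combination c0 * h1 + c1 * h2 - c2 * h0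

/-- The entries of the short edges at an end of the bottom edge of a tetrahedron add up, up to
signs, and so do their changes. -/
theorem IsHorizontal.entryChange_third (hy : D.IsHorizontal y) (i : Fin L.N) {x : Dart n}
    (hx : x.1 = L.flipAt i) :
    D.entryChange i.succ ((L.tri i.castSucc).next ((L.tri i.castSucc).next x)) y =
      D.entryChange i.castSucc ((L.tri i.castSucc).next ((L.tri i.castSucc).next x)) y +
      D.entryChange i.castSucc x.rev y := by
  have hF := L.isFlip i
  have e := congrFun (D.short_third i y hx) 0
  rw [Pi.add_apply, shortLabel_apply, hy.one, hy.two] at e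
  unfold entryChange
  rw [e, hF.next_third x hx, (L.tri i.castSucc).next_next_next, Dart.rev_rev,
    D.long_up i y (Dart.rev_fst_ne (hF.next_next_edge_ne hx)),
    D.long_up i y (hF.next_edge_ne (show x.rev.1 = _ from hx))]
  simp
  ring

/-- The linearised Ptolemy equation follows from the changes of three entries of short edges. -/
theorem ptolemy_change_alg {X X' C E B F lx lx' lc le lb lf U V W a b g h p q r t : ℂ}
    (hX : X ≠ 0)
    (ha : a * a = 1) (hb : b * b = 1) (hg : g * g = 1) (hh : h * h = 1) (hU : U = V + W)
    (h2 : 2 * (C * E) * U = a * b * g * h * X' * (lc + le - lx'))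
    (h3 : 2 * (C * X) * V = a * p * (q * h) * B * (lc + lx - lb))
    (h4 : 2 * (-X * E) * W = b * (g * r) * t * F * (lx + le - lf))
    (P : X * -X' + (-(h * r * t * a) * (C * F) + g * q * p * b * (E * B)) = 0) :
    X' * lx' = X⁻¹ * (-(h * r * t * a) * (C * (F * lf) + F * (C * lc)) +
      g * q * p * b * (E * (B * lb) + B * (E * le)) -
      (-(h * r * t * a) * (C * F) + g * q * p * b * (E * B)) / X * (X * lx)) := by
  have k1 : (a * b * g * h) * (a * b * g * h) = 1 := by
    linear_combination b * b * g * g * h * h * ha + g * g * h * h * hb + h * h * hg + hh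
  have k2 : (a * b * g * h) * (a * p * (q * h)) = g * q * p * b := by
    linear_combination b * g * p * q * h * h * ha + b * g * p * q * hh
  have k3 : (a * b * g * h) * (b * (g * r) * t) = h * r * t * a := by
    linear_combination a * h * r * t * g * g * hb + a * h * r * t * hg
  subst hU
  rw [← k2, ← k3] at P ⊢
  generalize a * b * g * h = k at *
  generalize a * p * (q * h) = m at *
  generalize b * (g * r) * t = l at *
  field_simp
  linear_combination X * k * h2 - E * k * h3 + C * k * h4 - (lc + le) * P +
    X * X' * (lc + le - lx') * k1

variable (D) in
/-- The infinitesimal change of the Ptolemy variables. The zero weight component of the value on a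
long edge is the logarithmic derivative of its Ptolemy variable. -/
noncomputable def varChange (i : Fin (L.N + 1)) : D.Cochains →ₗ[ℂ] (Fin (3 * n) → ℂ) :=
  LinearMap.pi fun e => c.val i e • (LinearMap.proj 1 ∘ₗ D.long i (e, true))

theorem onDart_varChange (i : Fin (L.N + 1)) (d : Dart n) :
    onDart (D.varChange i y) d = c.var i d * D.long i d y 1 := by
  obtain ⟨e, b⟩ := d
  cases b with
  | true => rfl
  | false =>
    have h := long_rev_one (D := D) (y := y) i (e, true)
    change D.long i (e, false) y 1 = _ at h
    rw [h]
    change -(c.val i e * D.long i (e, true) y 1) = -(c.val i e) * D.long i (e, true) y 1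
    ring

/-- The Ptolemy variable of the new edge changes as prescribed by the derivative of the flip. -/
theorem IsHorizontal.varChange_self (hy : D.IsHorizontal y) (i : Fin L.N) :
    D.varChange i.succ y (L.flipAt i) = flipVarsDeriv (L.tri i.castSucc) (σ.sign i.castSucc)
      (σ.sign i.succ) (L.flipAt i) (c.val i.castSucc) (D.varChange i.castSucc y) (L.flipAt i) := by
  have hF := L.isFlip i
  obtain ⟨x, hx, hxt⟩ : ∃ x : Dart n, x.1 = L.flipAt i ∧ x = (L.flipAt i, true) := ⟨_, rfl, rfl⟩
  have hx' : x.rev.1 = L.flipAt i := hx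
  have E1 := hy.entryChange_third i hx
  have E2 := hy.entryChange_eq i.succ ((L.tri i.castSucc).next ((L.tri i.castSucc).next x))
  have E3 := hy.entryChange_eq i.castSucc ((L.tri i.castSucc).next ((L.tri i.castSucc).next x))
  have E4 := hy.entryChange_eq i.castSucc x.rev
  have P := c.ptolemy i x hx
  have s1 := σ.sign_third i x hx
  have s2 := σ.sign_next i x hx
  have s3 := σ.sign_next i x.rev hx'
  have z0 := c.var_ne_zero i.castSucc x
  have z0' := c.var_ne_zero i.succ x
  have zc := c.var_ne_zero i.castSucc ((L.tri i.castSucc).next ((L.tri i.castSucc).next x))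
  have zd := c.var_ne_zero i.castSucc ((L.tri i.castSucc).next x.rev)
  rw [flipVarsDeriv_self, ← hxt]
  change onDart (D.varChange i.succ y) (L.flipAt i, true) =
    (onDart (c.val i.castSucc) (L.flipAt i, true))⁻¹ *
      (_ - _ / onDart (c.val i.castSucc) (L.flipAt i, true) *
        onDart (D.varChange i.castSucc y) (L.flipAt i, true))
  rw [← hxt]
  unfold ptolemyRestDeriv
  unfold ptolemyRest at P ⊢
  simp only [hF.next_third x hx, hF.next_rev x hx, (L.tri i.castSucc).next_next_next, s1, s2, s3,
    c.var_rev, long_rev_one, sgn_mul] at E2 E3 E4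
  have u1 : ∀ q : Dart n, q.1 ≠ L.flipAt i → c.var i.succ q = c.var i.castSucc q := fun q hq =>
    onDart_congr (c.val_other i _ hq)
  have u2 := hF.next_next_edge_ne hx
  have u3 := hF.next_edge_ne hx'
  have u4 : ∀ i d, onDart (c.val i) d = c.var i d := fun _ _ => rfl
  rw [u1 _ u2, u1 _ u3, D.long_up i y u2, D.long_up i y u3] at E2
  simp only [u4, c.var_rev, sgn_mul] at P
  simp only [u4, add_apply, smul_apply, onDartLinear_apply,
    onDart_varChange, smul_eq_mul, sgn_mul]
  exact ptolemy_change_alg z0 (sgn_sq _) (sgn_sq _) (sgn_sq _) (sgn_sq _) E1 E2 E3 E4 P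

theorem IsHorizontal.varChange_eq (hy : D.IsHorizontal y) (i : Fin (L.N + 1)) :
    D.varChange i y = c.varLevel i (D.varChange 0 y) := by
  induction i using Fin.induction with
  | zero => rw [c.varLevel_zero]
  | succ k ih =>
    rw [c.varLevel_succ, ← ih]
    funext e
    by_cases he : e = L.flipAt k
    · rw [he]
      exact hy.varChange_self k
    · rw [flipVarsDeriv_other he]
      change c.val k.succ e * D.long k.succ (e, true) y 1 = c.val k.castSucc e * _
      rw [c.val_other k e he, D.long_up k y he]
      rfl

theorem IsHorizontal.varChange_monodromy (hy : D.IsHorizontal y) :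
    D.varChange 0 (D.cochainMonodromy y) = c.varTotal (D.varChange 0 y) := by
  funext e
  rw [c.varTotal_apply, ← hy.varChange_eq, onDart_varChange, long_mono]
  exact congrArg (· * _) (c.val_mono (e, true)).symm

end FibreFrame

/-! ### The characteristic polynomial of the monodromy on crossed homomorphisms -/

namespace FibreFrame

open SurfaceTriangulation

variable {n : ℕ} {L : LayeredTriangulation n} {σ : BoundarySign L} {c : PtolemyAssignment L σ}
  {K : Type} [Group K] (D : FibreFrame c K)

/-- The restriction of `y` to the fundamental group of the fibre is the coboundary of `v`. -/
def IsCoboundary (v : Fin 3 → ℂ) (y : D.Cochains) : Prop :=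
  ∀ g, D.ev g y.1 = v - symSqRep (D.rho g) v

/-- The vector at a vertex of `tri i` relative to the vector `-v` at the base point, transported to
the vertex. -/
noncomputable def vertLocal (v : Fin 3 → ℂ) (y : D.Cochains) (i : Fin (L.N + 1)) (d : Dart n) :
    Fin 3 → ℂ :=
  symSqRep (D.frame i d)⁻¹ (D.vert i y d + v)

theorem frame_vertLocal (v : Fin 3 → ℂ) (y : D.Cochains) (i : Fin (L.N + 1)) (d : Dart n) :
    symSqRep (D.frame i d) (D.vertLocal v y i d) = D.vert i y d + v :=
  symSqRep_self_apply_inv _ _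

variable {D} {v : Fin 3 → ℂ} {y : D.Cochains}

theorem long_eq_vertLocal (i : Fin (L.N + 1)) (d : Dart n) : D.long i d y =
    D.vertLocal v y i d - symSqRep (c.longLabel i d) (D.vertLocal v y i d.rev) := by
  apply symSqRep_injective (g := D.frame i d)
  rw [map_sub, frame_long, ← frame_rev_apply, frame_vertLocal, frame_vertLocal]
  abel

theorem IsCoboundary.short_eq (hv : D.IsCoboundary v y) (i : Fin (L.N + 1)) (d : Dart n) :
    D.short i d y = D.vertLocal v y i d.rev -
      symSqRep (c.shortLabel i d) (D.vertLocal v y i ((L.tri i).next d)) := by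
  apply symSqRep_injective (g := D.frame i d.rev)
  rw [map_sub, frame_short, ← rho_corner_frame, frame_vertLocal, frame_vertLocal, hv, map_add]
  abel

theorem IsCoboundary.vertLocal_flip (hv : D.IsCoboundary v y) (i : Fin L.N) {d : Dart n}
    (hd : d.1 = L.flipAt i) : D.vertLocal v y i.succ d =
      D.vertLocal v y i.castSucc d -
        symSqRep (c.shortLabel i.castSucc d.rev)
          (D.vertLocal v y i.castSucc ((L.tri i.castSucc).next d.rev)) +
        symSqRep (c.shortLabel i.succ d.rev)
          (D.vertLocal v y i.castSucc
            ((L.tri i.castSucc).next ((L.tri i.castSucc).next d.rev))) := by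
  have hF := L.isFlip i
  have hd' : d.rev.1 = L.flipAt i := hd
  have e1 := hv.short_eq i.castSucc d.rev
  rw [Dart.rev_rev] at e1
  have e2 := D.rho_corner_frame i.succ d.rev
    (D.vertLocal v y i.castSucc ((L.tri i.castSucc).next ((L.tri i.castSucc).next d.rev)))
  rw [hF.next_self _ hd', D.frame_up i _ (hF.next_next_edge_ne hd'), frame_vertLocal,
    Dart.rev_rev] at e2
  rw [← e1]
  apply symSqRep_injective (g := D.frame i.succ d)
  rw [map_add, ← e2, frame_vertLocal, vert_flip _ _ _ hd, hv, map_add]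
  abel

theorem vertLocal_up (i : Fin L.N) {d : Dart n} (hd : d.1 ≠ L.flipAt i) :
    D.vertLocal v y i.succ d = D.vertLocal v y i.castSucc d := by
  rw [vertLocal, vertLocal, D.frame_up i d hd, vert_up _ _ _ hd]

/-- If the labels of the short edges act trivially on a component of the vectors at the vertices,
then these components are transported by the flips like untwisted cochains. -/
theorem IsCoboundary.vertLocal_eq_vertexLevel (hv : D.IsCoboundary v y) (j : Fin 3)
    (f : Dart n → ℂ) (hf : ∀ d, D.vertLocal v y 0 d j = f d)
    (h : ∀ (i : Fin (L.N + 1)) (k : Fin L.N) (d d' : Dart n),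
      symSqRep (c.shortLabel i d) (D.vertLocal v y k.castSucc d') j =
        D.vertLocal v y k.castSucc d' j)
    (i : Fin (L.N + 1)) (d : Dart n) :
    D.vertLocal v y i d j = L.vertexLevel i f d := by
  induction i using Fin.induction generalizing d with
  | zero => rw [L.vertexLevel_zero]; exact hf d
  | succ k ih =>
    rw [L.vertexLevel_succ, vertexStep_apply]
    split_ifs with hd
    · rw [hv.vertLocal_flip k hd, Pi.add_apply, Pi.sub_apply, h, h, ih, ih, ih]
    · rw [vertLocal_up k hd, ih]

theorem IsCoboundary.vertLocal_two (hv : D.IsCoboundary v y) (i : Fin (L.N + 1)) (d : Dart n) :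
    D.vertLocal v y i d 2 = L.vertexLevel i (fun q => D.vertLocal v y 0 q 2) d :=
  hv.vertLocal_eq_vertexLevel 2 _ (fun _ => rfl) (fun i k d d' => by rw [shortLabel_apply]; rfl) i d

theorem IsCoboundary.vertLocal_two_eq_zero (hv : D.IsCoboundary v y)
    (h2 : ∀ q, D.vertLocal v y 0 q 2 = 0) (i : Fin (L.N + 1)) (d : Dart n) :
    D.vertLocal v y i d 2 = 0 := by
  rw [hv.vertLocal_two, funext h2]
  exact congrFun (map_zero _) d

theorem IsCoboundary.vertLocal_one (hv : D.IsCoboundary v y)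
    (h2 : ∀ q, D.vertLocal v y 0 q 2 = 0) (i : Fin (L.N + 1)) (d : Dart n) :
    D.vertLocal v y i d 1 = L.vertexLevel i (fun q => D.vertLocal v y 0 q 1) d :=
  hv.vertLocal_eq_vertexLevel 1 _ (fun _ => rfl) (fun i k d d' => by
    rw [shortLabel_apply, hv.vertLocal_two_eq_zero h2]; simp) i d

theorem IsCoboundary.vertLocal_one_eq_zero (hv : D.IsCoboundary v y)
    (h2 : ∀ q, D.vertLocal v y 0 q 2 = 0) (h1 : ∀ q, D.vertLocal v y 0 q 1 = 0)
    (i : Fin (L.N + 1)) (d : Dart n) : D.vertLocal v y i d 1 = 0 := by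
  rw [hv.vertLocal_one h2, funext h1]
  exact congrFun (map_zero _) d

theorem IsCoboundary.vertLocal_zero (hv : D.IsCoboundary v y)
    (h2 : ∀ q, D.vertLocal v y 0 q 2 = 0) (h1 : ∀ q, D.vertLocal v y 0 q 1 = 0)
    (i : Fin (L.N + 1)) (d : Dart n) :
    D.vertLocal v y i d 0 = L.vertexLevel i (fun q => D.vertLocal v y 0 q 0) d :=
  hv.vertLocal_eq_vertexLevel 0 _ (fun _ => rfl) (fun i k d d' => by
    rw [shortLabel_apply, hv.vertLocal_two_eq_zero h2, hv.vertLocal_one_eq_zero h2 h1]; simp) i d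

theorem isCoboundary_inr (f : Dart n → Fin 3 → ℂ) : D.IsCoboundary 0 ((0, f) : D.Cochains) := by
  intro g
  rw [map_zero, map_zero, sub_zero]

theorem vertLocal_inr (f : Dart n → Fin 3 → ℂ) (d : Dart n) :
    D.vertLocal 0 ((0, f) : D.Cochains) 0 d = f d := by
  apply symSqRep_injective (g := D.frame 0 d)
  rw [frame_vertLocal, vert_zero, add_zero]

theorem cochainMonodromy_inr (f : Dart n → Fin 3 → ℂ) (d : Dart n) :
    (D.cochainMonodromy (0, f)).2 d =
      D.vertLocal 0 ((0, f) : D.Cochains) (Fin.last L.N) (L.mono d) := by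
  apply symSqRep_injective (g := D.frame (Fin.last L.N) (L.mono d))
  rw [frame_cochainMonodromy, frame_vertLocal, map_zero]

variable (D) in
/-- The monodromy on the coboundaries of vectors at the vertices. -/
noncomputable def vertexMonodromy : (Dart n → Fin 3 → ℂ) →ₗ[ℂ] (Dart n → Fin 3 → ℂ) :=
  LinearMap.snd ℂ _ _ ∘ₗ D.cochainMonodromy ∘ₗ LinearMap.inr ℂ _ _

theorem vertexMonodromy_apply (f : Dart n → Fin 3 → ℂ) (d : Dart n) :
    D.vertexMonodromy f d = D.vertLocal 0 ((0, f) : D.Cochains) (Fin.last L.N) (L.mono d) :=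
  cochainMonodromy_inr f d

variable (D) in
/-- The labels of the short edges are upper triangular, so the filtration by weights is preserved,
and each of the three weights contributes the untwisted monodromy on functions on the vertices. -/
theorem charpoly_vertexMonodromy : D.vertexMonodromy.charpoly =
    L.vertexTotal.charpoly * L.vertexTotal.charpoly * L.vertexTotal.charpoly := by
  have hc := fun f => isCoboundary_inr (D := D) f
  refine charpoly_filtered _ _ (fun f => ?_) (fun f h2 => ?_) fun f h2 h1 => ?_
  · funext d
    rw [vertexMonodromy_apply, (hc f).vertLocal_two, L.vertexTotal_apply]
    simp only [vertLocal_inr]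
  · funext d
    rw [vertexMonodromy_apply, (hc f).vertLocal_one (by simpa only [vertLocal_inr] using h2),
      L.vertexTotal_apply]
    simp only [vertLocal_inr]
  · funext d
    rw [vertexMonodromy_apply, (hc f).vertLocal_zero (by simpa only [vertLocal_inr] using h2)
      (by simpa only [vertLocal_inr] using h1), L.vertexTotal_apply]
    simp only [vertLocal_inr]

/-- The vectors at the vertices contribute a cube to the characteristic polynomial of the monodromy
on the twisted cocycles. -/
theorem charpoly_cochainMonodromy [FiniteDimensional ℂ D.crossed] :
    D.cochainMonodromy.charpoly = L.vertexTotal.charpoly * L.vertexTotal.charpoly *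
      L.vertexTotal.charpoly * D.crossedMonodromy.charpoly := by
  rw [← D.charpoly_vertexMonodromy]
  refine charpoly_of_exact (LinearMap.inr ℂ D.crossed (Dart n → Fin 3 → ℂ)) (LinearMap.fst ℂ _ _)
    LinearMap.inr_injective LinearMap.fst_surjective (fun y => ?_) _ _ _ (fun f => ?_) fun y => rfl
  · constructor
    · intro h
      exact ⟨y.2, Prod.ext h.symm rfl⟩
    · rintro ⟨f, rfl⟩
      rfl
  · exact Prod.ext (map_zero D.crossedMonodromy) rfl

/-! ### Cocycles which do not change the Ptolemy variables -/

variable (D) in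
/-- The coboundaries of a vector at the base point. -/
noncomputable def coboundary : (Fin 3 → ℂ) →ₗ[ℂ] D.crossed where
  toFun v := ⟨fun g => v - symSqRep (D.rho g) v, fun g h => by
    simp only [map_mul, map_sub, Module.End.mul_apply]
    abel⟩
  map_add' v w := by
    apply Subtype.ext
    funext g
    change v + w - _ = (v - _) + (w - _)
    rw [map_add]
    abel
  map_smul' a v := by
    apply Subtype.ext
    funext g
    change a • v - _ = a • (v - _)
    rw [map_smul, smul_sub]

variable (D) in
/-- The twisted cocycles given by a vector at the base point and by highest weight vectors at the
vertices. -/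
noncomputable def parabolic : ((Fin 3 → ℂ) × (Dart n → ℂ)) →ₗ[ℂ] D.Cochains :=
  (D.coboundary ∘ₗ LinearMap.fst ℂ _ _).prod (LinearMap.pi fun d =>
    LinearMap.single ℂ (fun _ : Fin 3 => ℂ) 0 ∘ₗ LinearMap.proj d ∘ₗ LinearMap.snd ℂ _ _ -
      symSqRep (D.frame 0 d)⁻¹ ∘ₗ LinearMap.fst ℂ _ _)

theorem parabolic_snd (v : Fin 3 → ℂ) (f : Dart n → ℂ) (d : Dart n) :
    (D.parabolic (v, f)).2 d = ![f d, 0, 0] - symSqRep (D.frame 0 d)⁻¹ v := by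
  have h : (![f d, 0, 0] : Fin 3 → ℂ) = Pi.single 0 (f d) := by
    funext j
    fin_cases j <;> rfl
  rw [h]
  rfl

theorem parabolic_zero_snd (v : Fin 3 → ℂ) (d : Dart n) :
    (D.parabolic (v, 0)).2 d = - symSqRep (D.frame 0 d)⁻¹ v := by
  have h : (![0, 0, 0] : Fin 3 → ℂ) = 0 := by
    funext j
    fin_cases j <;> rfl
  rw [parabolic_snd, Pi.zero_apply, h, zero_sub]

theorem isCoboundary_parabolic (v : Fin 3 → ℂ) (f : Dart n → ℂ) :
    D.IsCoboundary v (D.parabolic (v, f)) := fun _ => rfl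

theorem vertLocal_parabolic (v : Fin 3 → ℂ) (f : Dart n → ℂ) (d : Dart n) :
    D.vertLocal v (D.parabolic (v, f)) 0 d = ![f d, 0, 0] := by
  apply symSqRep_injective (g := D.frame 0 d)
  rw [frame_vertLocal, vert_zero, parabolic_snd, map_sub, symSqRep_self_apply_inv, sub_add_cancel]

theorem vertLocal_parabolic_last (v : Fin 3 → ℂ) (f : Dart n → ℂ) (d : Dart n) :
    D.vertLocal v (D.parabolic (v, f)) (Fin.last L.N) (L.mono d) =
      ![L.vertexTotal f d, 0, 0] := by
  have hc := isCoboundary_parabolic (D := D) v f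
  have h2 : ∀ q, D.vertLocal v (D.parabolic (v, f)) 0 q 2 = 0 := fun q => by
    rw [vertLocal_parabolic]; rfl
  have h1 : ∀ q, D.vertLocal v (D.parabolic (v, f)) 0 q 1 = 0 := fun q => by
    rw [vertLocal_parabolic]; rfl
  funext j
  fin_cases j
  · refine (hc.vertLocal_zero h2 h1 _ _).trans ?_
    rw [← L.vertexTotal_apply]
    simp [vertLocal_parabolic]
  · exact hc.vertLocal_one_eq_zero h2 h1 _ _
  · exact hc.vertLocal_two_eq_zero h2 _ _

/-- The monodromy acts on the vector at the base point by the inverse of `stable`, and on the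
highest weight vectors as on untwisted functions on the vertices. -/
theorem cochainMonodromy_parabolic (v : Fin 3 → ℂ) (f : Dart n → ℂ) :
    D.cochainMonodromy (D.parabolic (v, f)) =
      D.parabolic (symSqRep D.stable⁻¹ v, L.vertexTotal f) := by
  refine Prod.ext (Subtype.ext (funext fun g => ?_)) (funext fun d => ?_)
  · change symSqRep D.stable⁻¹ (v - symSqRep (D.rho (D.conj g)) v) =
      symSqRep D.stable⁻¹ v - symSqRep (D.rho g) (symSqRep D.stable⁻¹ v)
    rw [D.rho_conj, map_sub]
    simp only [map_mul, Module.End.mul_apply]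
    rw [symSqRep_inv_apply_self]
  · apply symSqRep_injective (g := D.frame (Fin.last L.N) (L.mono d))
    have e := D.frame_vertLocal v (D.parabolic (v, f)) (Fin.last L.N) (L.mono d)
    rw [vertLocal_parabolic_last] at e
    have k : D.rho (D.closing d) =
        D.frame (Fin.last L.N) (L.mono d) * (D.frame 0 d)⁻¹ * D.stable⁻¹ := by
      rw [← D.rho_closing, mul_inv_cancel_right]
    rw [frame_cochainMonodromy, parabolic_snd, map_sub, e, isCoboundary_parabolic, k]
    simp only [map_mul, Module.End.mul_apply]
    abel

theorem parabolic_injective : Function.Injective D.parabolic := by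
  rw [injective_iff_map_eq_zero]
  rintro ⟨v, f⟩ h
  have hl := fun d => (long_eq_vertLocal (v := v) (y := D.parabolic (v, f)) 0 d).symm
  simp only [vertLocal_parabolic, longLabel_apply] at hl
  have hf : f = 0 := by
    funext d
    have := congrFun (hl d) 0
    rw [h, map_zero] at this
    simpa using this
  subst hf
  have hv := congrFun (congrArg Prod.snd h) D.base
  rw [parabolic_zero_snd] at hv
  have hv' : symSqRep (D.frame 0 D.base)⁻¹ v = 0 := by simpa using hv
  have : v = 0 := symSqRep_injective (hv'.trans (map_zero _).symm)
  rw [this]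
  rfl

/-- A cocycle which vanishes on the truncated bottom surface is the coboundary of a vector. -/
theorem exists_eq_parabolic_of_flat (hl : ∀ d, D.long 0 d y = 0) (hs : ∀ d, D.short 0 d y = 0) :
    ∃ v, D.parabolic (v, 0) = y := by
  have hl' : ∀ d, D.vert 0 y d.rev = D.vert 0 y d := fun d => by
    have := D.frame_long 0 d y
    rw [hl, map_zero] at this
    exact (sub_eq_zero.1 this.symm).symm
  have hs' : ∀ d, D.ev (D.corner d) y.1 = symSqRep (D.rho (D.corner d))
      (D.vert 0 y ((L.tri 0).next d)) - D.vert 0 y d.rev := fun d => by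
    have := D.frame_short 0 d y
    rw [hs, map_zero] at this
    exact eq_sub_of_add_eq (sub_eq_zero.1 this.symm)
  have hp : ∀ v w u, (L.tri 0).SurfPath D.corner v w u →
      D.ev u y.1 = symSqRep (D.rho u) (D.vert 0 y w) - D.vert 0 y v := by
    intro v w u h
    induction h with
    | refl v => rw [ev_one, map_one, map_one, Module.End.one_apply, sub_self]
    | long d => rw [ev_one, map_one, map_one, Module.End.one_apply, hl', sub_self]
    | short d => exact hs' d
    | symm v w u _ ih =>
      rw [ev_inv, ih, map_sub, map_inv, symSqRep_inv_apply_self, neg_sub]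
    | trans v w z u u' _ _ ih ih' =>
      rw [ev_mul, ih, ih', map_sub, map_mul, map_mul, Module.End.mul_apply]
      abel
  have hb : ∀ d, D.vert 0 y d = D.vert 0 y D.base := fun d => by
    have := hp _ _ _ (D.surfPath d)
    rw [ev_one, map_one, map_one, Module.End.one_apply] at this
    exact sub_eq_zero.1 this.symm
  refine ⟨- D.vert 0 y D.base, Prod.ext (D.crossed_ext fun d => ?_) (funext fun d => ?_)⟩
  · change - D.vert 0 y D.base - symSqRep (D.rho (D.corner d)) (- D.vert 0 y D.base) = _
    rw [hs', hb ((L.tri 0).next d), hb d.rev, map_neg]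
    abel
  · apply symSqRep_injective (g := D.frame 0 d)
    rw [parabolic_zero_snd, map_neg, symSqRep_self_apply_inv, ← vert_zero, hb d, neg_neg]

/-- A horizontal cocycle which does not change the Ptolemy variables does not change the entries of
the short edges either; after subtracting the coboundary of highest weight vectors at the vertices,
it vanishes on the truncated bottom surface. -/
theorem IsHorizontal.exists_eq_parabolic (hy : D.IsHorizontal y) (h : D.varChange 0 y = 0) :
    ∃ x, D.parabolic x = y := by
  have hl : ∀ d, D.long 0 d y 1 = 0 := fun d => by
    have := onDart_varChange (D := D) (y := y) 0 d
    rw [h] at this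
    have h0 : onDart (0 : Fin (3 * n) → ℂ) d = 0 := by simp [onDart]
    rw [h0] at this
    exact (mul_eq_zero.1 this.symm).resolve_left (c.var_ne_zero 0 d)
  have hs : ∀ d, D.entryChange 0 d y = 0 := fun d => by
    have := hy.entryChange_eq 0 d
    rw [hl, hl, hl, add_zero, sub_zero, mul_zero] at this
    refine (mul_eq_zero.1 this).resolve_left ?_
    exact mul_ne_zero two_ne_zero (mul_ne_zero (c.var_ne_zero 0 _) (c.var_ne_zero 0 _))
  have hl' : ∀ d, D.long 0 d (y - D.parabolic (0, fun d => D.long 0 d y 0)) = 0 := fun d => by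
    rw [map_sub, long_eq_vertLocal (v := 0) (y := D.parabolic _), vertLocal_parabolic,
      vertLocal_parabolic, longLabel_apply]
    funext j
    fin_cases j
    · simp
    · simpa using hl d
    · simp [long_two]
  have hs' : ∀ d, D.short 0 d (y - D.parabolic (0, fun d => D.long 0 d y 0)) = 0 := fun d => by
    rw [map_sub, (isCoboundary_parabolic _ _).short_eq, vertLocal_parabolic,
      vertLocal_parabolic, shortLabel_apply]
    have := hs d
    unfold entryChange at this
    funext j
    fin_cases j
    · simp
      linear_combination this
    · simpa using hy.one 0 d
    · simpa using hy.two 0 d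
  obtain ⟨v, hv⟩ := exists_eq_parabolic_of_flat hl' hs'
  refine ⟨(v, 0) + (0, fun d => D.long 0 d y 0), ?_⟩
  rw [map_add, hv, sub_add_cancel]

theorem isHorizontal_parabolic (x : (Fin 3 → ℂ) × (Dart n → ℂ)) :
    D.IsHorizontal (D.parabolic x) := by
  obtain ⟨v, f⟩ := x
  constructor <;>
  · funext d
    rw [shortComp_apply, (isCoboundary_parabolic v f).short_eq, vertLocal_parabolic,
      vertLocal_parabolic, shortLabel_apply]
    simp

theorem varChange_parabolic (x : (Fin 3 → ℂ) × (Dart n → ℂ)) :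
    D.varChange 0 (D.parabolic x) = 0 := by
  obtain ⟨v, f⟩ := x
  funext e
  change c.val 0 e * D.long 0 (e, true) _ 1 = 0
  rw [long_eq_vertLocal (v := v), vertLocal_parabolic, vertLocal_parabolic, longLabel_apply]
  simp

end FibreFrame

/-! ### Characteristic polynomials of filtered endomorphisms -/

theorem charpoly_restrict_of_equiv {K A B : Type*} [Field K] [AddCommGroup A] [Module K A]
    [FiniteDimensional K A] [AddCommGroup B] [Module K B] [FiniteDimensional K B]
    (f : B →ₗ[K] B) (M : Submodule K B) (hM : ∀ x ∈ M, f x ∈ M) (e : A ≃ₗ[K] M) (g : A →ₗ[K] A)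
    (h : ∀ a, f (e a) = e (g a)) : (f.restrict hM).charpoly = g.charpoly := by
  rw [← LinearEquiv.charpoly_conj e]
  congr 1
  refine LinearMap.ext fun y => ?_
  obtain ⟨a, rfl⟩ := e.surjective y
  rw [LinearEquiv.conj_apply_apply, LinearEquiv.symm_apply_apply]
  exact Subtype.ext (h a)

/-- The characteristic polynomial of an endomorphism which preserves a filtration with three steps,
where the maps `p₁`, `p₂`, `p₃` to the graded pieces are surjective because of the dimensions. -/
theorem charpoly_of_filtration {K A B C₁ C₂ C₃ : Type*} [Field K]
    [AddCommGroup A] [Module K A] [FiniteDimensional K A]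
    [AddCommGroup B] [Module K B] [FiniteDimensional K B]
    [AddCommGroup C₁] [Module K C₁] [FiniteDimensional K C₁]
    [AddCommGroup C₂] [Module K C₂] [FiniteDimensional K C₂]
    [AddCommGroup C₃] [Module K C₃] [FiniteDimensional K C₃]
    (i : A →ₗ[K] B) (p₁ : B →ₗ[K] C₁) (p₂ : B →ₗ[K] C₂) (p₃ : B →ₗ[K] C₃)
    (f : B →ₗ[K] B) (g : A →ₗ[K] A) (g₁ : C₁ →ₗ[K] C₁) (g₂ : C₂ →ₗ[K] C₂) (g₃ : C₃ →ₗ[K] C₃)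
    (hi : Function.Injective i)
    (h : ∀ y, (∃ a, i a = y) ↔ (p₁ y = 0 ∧ p₂ y = 0) ∧ p₃ y = 0)
    (hf : ∀ a, f (i a) = i (g a)) (h₁ : ∀ y, p₁ (f y) = g₁ (p₁ y))
    (h₂ : ∀ y, p₁ y = 0 → p₂ (f y) = g₂ (p₂ y))
    (h₃ : ∀ y, p₁ y = 0 ∧ p₂ y = 0 → p₃ (f y) = g₃ (p₃ y))
    (hd : Module.finrank K A + Module.finrank K C₁ + Module.finrank K C₂ + Module.finrank K C₃ ≤
      Module.finrank K B) :
    f.charpoly = g.charpoly * g₃.charpoly * g₂.charpoly * g₁.charpoly := by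
  set M₁ := LinearMap.ker p₁
  set M₂ := M₁ ⊓ LinearMap.ker p₂
  set M₃ := M₂ ⊓ LinearMap.ker p₃
  have m1 : ∀ y, y ∈ M₁ ↔ y ∈ (⊤ : Submodule K B) ∧ p₁ y = 0 :=
    fun y => ⟨fun h => ⟨trivial, h⟩, fun h => h.2⟩
  have m2 : ∀ y, y ∈ M₂ ↔ y ∈ M₁ ∧ p₂ y = 0 := fun y => Iff.rfl
  have m3 : ∀ y, y ∈ M₃ ↔ y ∈ M₂ ∧ p₃ y = 0 := fun y => Iff.rfl
  have m3' : ∀ y, y ∈ M₃ ↔ ∃ a, i a = y := fun y => (h y).symm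
  have k1 : ∀ y ∈ M₁, f y ∈ M₁ := fun y hy => by
    change p₁ (f y) = 0
    rw [h₁, show p₁ y = 0 from hy, map_zero]
  have k2 : ∀ y ∈ M₂, f y ∈ M₂ := fun y hy => ⟨k1 y hy.1, by
    change p₂ (f y) = 0
    rw [h₂ y hy.1, show p₂ y = 0 from hy.2, map_zero]⟩
  have k3 : ∀ y ∈ M₃, f y ∈ M₃ := fun y hy => by
    obtain ⟨a, rfl⟩ := (m3' y).1 hy
    rw [hf]
    exact (m3' _).2 ⟨_, rfl⟩
  let e : A ≃ₗ[K] M₃ := LinearEquiv.ofBijective (i.codRestrict M₃ fun a => (m3' _).2 ⟨a, rfl⟩)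
    ⟨fun _ _ h => hi (congrArg Subtype.val h), fun y => by
      obtain ⟨a, ha⟩ := (m3' _).1 y.2
      exact ⟨a, Subtype.ext ha⟩⟩
  have r1 := finrank_eq_add_finrank_range _ _ _ m1
  have r2 := finrank_eq_add_finrank_range _ _ _ m2
  have r3 := finrank_eq_add_finrank_range _ _ _ m3
  have b1 := Submodule.finrank_le (LinearMap.range (p₁ ∘ₗ Submodule.subtype ⊤))
  have b2 := Submodule.finrank_le (LinearMap.range (p₂ ∘ₗ M₁.subtype))
  have b3 := Submodule.finrank_le (LinearMap.range (p₃ ∘ₗ M₂.subtype))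
  rw [finrank_top] at r1
  rw [← e.finrank_eq] at r3
  have s1 := Submodule.eq_top_of_finrank_eq (by omega :
    Module.finrank K (LinearMap.range (p₁ ∘ₗ Submodule.subtype ⊤)) = Module.finrank K C₁)
  have s2 := Submodule.eq_top_of_finrank_eq (by omega :
    Module.finrank K (LinearMap.range (p₂ ∘ₗ M₁.subtype)) = Module.finrank K C₂)
  have s3 := Submodule.eq_top_of_finrank_eq (by omega :
    Module.finrank K (LinearMap.range (p₃ ∘ₗ M₂.subtype)) = Module.finrank K C₃)
  rw [← charpoly_restrict_of_equiv f M₃ k3 e g hf, ← charpoly_restrict_top f fun _ _ => trivial,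
    charpoly_restrict_eq f ⊤ M₁ (fun _ _ => trivial) k1 p₁ g₁ m1 (fun y _ => h₁ y),
    charpoly_restrict_eq f M₁ M₂ k1 k2 p₂ g₂ m2 h₂,
    charpoly_restrict_eq f M₂ M₃ k2 k3 p₃ g₃ m3 h₃]
  · intro z
    obtain ⟨y, hy⟩ := LinearMap.range_eq_top.1 s3 z
    exact ⟨y.1, y.2, hy⟩
  · intro z
    obtain ⟨y, hy⟩ := LinearMap.range_eq_top.1 s2 z
    exact ⟨y.1, y.2, hy⟩
  · intro z
    obtain ⟨y, hy⟩ := LinearMap.range_eq_top.1 s1 z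
    exact ⟨y.1, y.2, hy⟩

/-! ### The comparison with the derivative of the flips -/

namespace FibreFrame

open SurfaceTriangulation

variable {n : ℕ} {L : LayeredTriangulation n} {σ : BoundarySign L} {c : PtolemyAssignment L σ}
  {K : Type} [Group K] {D : FibreFrame c K}

theorem exists_eq_parabolic_iff (y : D.Cochains) : (∃ x, D.parabolic x = y) ↔
    (D.shortComp 2 y = 0 ∧ D.shortComp 1 y = 0) ∧ D.varChange 0 y = 0 := by
  constructor
  · rintro ⟨x, rfl⟩
    exact ⟨isHorizontal_parabolic x, varChange_parabolic x⟩
  · rintro ⟨h1, h2⟩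
    exact IsHorizontal.exists_eq_parabolic h1 h2

/-- The characteristic polynomial of the monodromy on the crossed homomorphisms. It is compared with
those of the flips by means of the filtration of the twisted cocycles by the weights of their
values on the short edges. -/
theorem charpoly_crossedMonodromy [FiniteDimensional ℂ D.crossed]
    (hd : 3 * (n + 1) ≤ Module.finrank ℂ D.crossed) :
    D.crossedMonodromy.charpoly =
      (c.varTotal : (Fin (3 * n) → ℂ) →ₗ[ℂ] (Fin (3 * n) → ℂ)).charpoly *
        LinearMap.charpoly (R := ℂ) (M := Fin 3 → ℂ) (symSqRep D.stable⁻¹) := by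
  have key := charpoly_of_filtration D.parabolic (D.shortComp 2) (D.shortComp 1) (D.varChange 0)
    D.cochainMonodromy (LinearMap.prodMap (symSqRep D.stable⁻¹) L.vertexTotal) L.shortTotal
    L.shortTotal (c.varTotal : (Fin (3 * n) → ℂ) →ₗ[ℂ] (Fin (3 * n) → ℂ)) parabolic_injective
    exists_eq_parabolic_iff (fun x => cochainMonodromy_parabolic x.1 x.2)
    D.shortComp_two_monodromy (fun y hy => D.shortComp_one_monodromy hy)
    (fun y hy => IsHorizontal.varChange_monodromy hy) (by
      -- `3 + 6n + 6n + 6n + 3n = 3(n + 1) + 18n`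
      simp [Module.finrank_prod, Module.finrank_pi_fintype]
      omega)
  rw [charpoly_cochainMonodromy, ← L.charpoly_vertexTotal, LinearMap.charpoly_prodMap] at key
  have hb : L.vertexTotal.charpoly ≠ 0 := L.vertexTotal.charpoly_monic.ne_zero
  -- The contributions of the boundary circles agree on both sides and cancel.
  apply mul_left_cancel₀ (mul_ne_zero (mul_ne_zero hb hb) hb)
  rw [key]
  ring

end FibreFrame

/-! ### Crossed homomorphisms on a free group -/

namespace FibreFrame

variable {n : ℕ} {L : LayeredTriangulation n} {σ : BoundarySign L} {c : PtolemyAssignment L σ}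
  {K : Type} [Group K] (D : FibreFrame c K) {m : ℕ} (x : Fin m → K)

/-- The values of a crossed homomorphism on given elements. -/
noncomputable def values : D.crossed →ₗ[ℂ] (Fin m × Fin 3 → ℂ) where
  toFun z p := D.ev (x p.1) z p.2
  map_add' _ _ := rfl
  map_smul' _ _ := rfl

/-- The fundamental formula of Fox calculus for crossed homomorphisms. -/
theorem ev_lift (z : D.crossed) (u : FreeGroup (Fin m)) : D.ev (FreeGroup.lift x u) z =
    ∑ l, (foxMatrix (symSq.comp D.rho) x l u).mulVec (D.ev (x l) z) := by
  refine _root_.crossed_ext (fun u v => symSqRep (D.rho (FreeGroup.lift x u)) v) (fun v => ?_)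
    (fun u => D.ev (FreeGroup.lift x u) z)
    (fun u => ∑ l, (foxMatrix (symSq.comp D.rho) x l u).mulVec (D.ev (x l) z))
    (fun u v => ?_) (fun u v => ?_) (fun i => ?_) u
  · rw [map_one, map_one, map_one, Module.End.one_apply]
  · rw [map_mul, ev_mul]
  · rw [map_sum, ← Finset.sum_add_distrib]
    refine Finset.sum_congr rfl fun l _ => ?_
    rw [foxMatrix_mul, Matrix.add_mulVec, ← Matrix.mulVec_mulVec]
    rfl
  · rw [Finset.sum_eq_single i]
    · rw [foxMatrix_of, if_pos rfl, Matrix.one_mulVec, FreeGroup.lift_apply_of]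
    · intro l _ hl
      rw [foxMatrix_of, if_neg (Ne.symm hl), Matrix.zero_mulVec]
    · intro h
      exact absurd (Finset.mem_univ i) h

variable {x}

/-- A crossed homomorphism has arbitrary values on a free basis. -/
noncomputable def valuesEquiv (hx : Function.Bijective (FreeGroup.lift x)) :
    D.crossed ≃ₗ[ℂ] (Fin m × Fin 3 → ℂ) :=
  LinearEquiv.ofBijective (D.values x) <| by
    let e : FreeGroup (Fin m) ≃* K := MulEquiv.ofBijective (FreeGroup.lift x) hx
    have he : ∀ g, FreeGroup.lift x (e.symm g) = g := e.apply_symm_apply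
    refine ⟨fun z z' h => Subtype.ext (funext fun g => ?_), fun a => ?_⟩
    · change D.ev g z = D.ev g z'
      rw [← he g, ev_lift, ev_lift]
      refine Finset.sum_congr rfl fun l _ => ?_
      congr 1
      funext j
      exact congrFun h (l, j)
    · refine ⟨⟨fun g => ∑ l, (foxMatrix (symSq.comp D.rho) x l (e.symm g)).mulVec
        fun j => a (l, j), fun g h => ?_⟩, ?_⟩
      · rw [map_sum, ← Finset.sum_add_distrib]
        refine Finset.sum_congr rfl fun l _ => ?_
        rw [map_mul, foxMatrix_mul, Matrix.add_mulVec, ← Matrix.mulVec_mulVec, he]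
        rfl
      · funext p
        obtain ⟨i, j⟩ := p
        change (∑ l, (foxMatrix (symSq.comp D.rho) x l (e.symm (x i))).mulVec _) j = a (i, j)
        have hi : e.symm (x i) = FreeGroup.of i := by
          rw [MulEquiv.symm_apply_eq]
          exact FreeGroup.lift_apply_of.symm
        rw [hi, Finset.sum_eq_single i]
        · rw [foxMatrix_of, if_pos rfl, Matrix.one_mulVec]
        · intro l _ hl
          rw [foxMatrix_of, if_neg (Ne.symm hl), Matrix.zero_mulVec]
        · intro h
          exact absurd (Finset.mem_univ i) h

theorem finiteDimensional_crossed (hx : Function.Bijective (FreeGroup.lift x)) :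
    FiniteDimensional ℂ D.crossed :=
  (D.valuesEquiv hx).symm.finiteDimensional

theorem finrank_crossed (hx : Function.Bijective (FreeGroup.lift x)) :
    Module.finrank ℂ D.crossed = 3 * m := by
  rw [(D.valuesEquiv hx).finrank_eq, Module.finrank_fintype_fun_eq_card]
  simp
  ring

/-- The monodromy on the crossed homomorphisms is given by the Fox derivatives of the images of a
free basis. -/
theorem charpoly_crossedMonodromy_eq [FiniteDimensional ℂ D.crossed]
    (hx : Function.Bijective (FreeGroup.lift x))
    (w : Fin m → FreeGroup (Fin m)) (hw : ∀ i, FreeGroup.lift x (w i) = D.conj (x i)) :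
    (Matrix.of fun p q : Fin m × Fin 3 => (symSq D.stable⁻¹ *
      foxMatrix (symSq.comp D.rho) x q.1 (w p.1)) p.2 q.2).charpoly =
      D.crossedMonodromy.charpoly := by
  rw [← Matrix.charpoly_toLin', ← LinearEquiv.charpoly_conj (D.valuesEquiv hx)]
  congr 1
  refine LinearMap.ext fun a => ?_
  obtain ⟨z, rfl⟩ := (D.valuesEquiv hx).surjective a
  rw [LinearEquiv.conj_apply_apply, LinearEquiv.symm_apply_apply, Matrix.toLin'_apply]
  funext p
  obtain ⟨i, j⟩ := p
  change _ = symSqRep D.stable⁻¹ (D.ev (D.conj (x i)) z) j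
  rw [← hw, ev_lift, map_sum, Finset.sum_apply]
  simp only [symSqRep_apply, Matrix.mulVec_mulVec]
  rw [Matrix.mulVec, dotProduct, Fintype.sum_prod_type]
  rfl

end FibreFrame

/-! ### The twisted Alexander polynomial -/

namespace SurfaceTriangulation

/-- A path with values in a group is a path with values in any subgroup which contains the values of
the short edges. -/
theorem SurfPath.lift {n : ℕ} {T : SurfaceTriangulation n} {H : Type} [Group H] {K : Subgroup H}
    {s : Dart n → K} {v w : Dart n} {u : H} (h : T.SurfPath (fun d => (s d : H)) v w u) :
    ∃ u' : K, (u' : H) = u ∧ T.SurfPath s v w u' := by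
  induction h with
  | refl v => exact ⟨1, rfl, SurfPath.refl v⟩
  | long d => exact ⟨1, rfl, SurfPath.long d⟩
  | short d => exact ⟨s d, rfl, SurfPath.short d⟩
  | symm v w u _ ih =>
    obtain ⟨u', rfl, h'⟩ := ih
    exact ⟨u'⁻¹, rfl, SurfPath.symm _ _ _ h'⟩
  | trans v w z u u' _ _ ih ih' =>
    obtain ⟨a, rfl, h⟩ := ih
    obtain ⟨b, rfl, h'⟩ := ih'
    exact ⟨a * b, rfl, SurfPath.trans _ _ _ _ _ h h'⟩

end SurfaceTriangulation

namespace BasePaths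

variable {n : ℕ} {L : LayeredTriangulation n} {σ : BoundarySign L} {d₀ : Dart n}
  (p : BasePaths L d₀) (c : PtolemyAssignment L σ) (s : FundGroup L d₀)

/-- The loops of the short edges of the bottom surface, as elements of the kernel of the class of
the fibration. -/
noncomputable def kerCorner (d : Dart n) : (FundGroup.alpha L d₀).ker :=
  ⟨p.corner d, p.alpha_corner d⟩

theorem coe_cornerLevel_kerCorner (i : Fin (L.N + 1)) (d : Dart n) :
    ((L.cornerLevel p.kerCorner i d : (FundGroup.alpha L d₀).ker) : FundGroup L d₀) =
      L.cornerLevel p.corner i d :=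
  L.map_cornerLevel (FundGroup.alpha L d₀).ker.subtype p.kerCorner i d

theorem isTriangular_kerCorner : (L.tri 0).IsTriangular p.kerCorner := fun d =>
  Subtype.ext (p.isTriangular_corner d)

theorem closure_kerCorner : Subgroup.closure (Set.range p.kerCorner) = ⊤ := by
  apply Subgroup.map_injective (FundGroup.alpha L d₀).ker.subtype_injective
  rw [MonoidHom.map_closure, ← Set.range_comp]
  refine (show _ = p.fibre from rfl).trans ?_
  rw [fibre_eq_ker, ← MonoidHom.range_eq_map, Subgroup.range_subtype]

/-- The fundamental group of the fibre with the restriction of the representation of a Ptolemy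
assignment and with the conjugation by an element over the generator. -/
noncomputable def fibreFrame (hs : FundGroup.alpha L d₀ s = Multiplicative.ofAdd 1) :
    FibreFrame c (FundGroup.alpha L d₀).ker where
  corner := p.kerCorner
  triangular := p.isTriangular_kerCorner
  base := d₀
  surfPath v := by
    have h := p.surfPath_levelPath (p.levelPath v)
    rw [p.close_path] at h
    obtain ⟨u, hu, h'⟩ := SurfaceTriangulation.SurfPath.lift (s := p.kerCorner) h
    rwa [show u = 1 from Subtype.ext hu] at h'
  closure_eq := p.closure_kerCorner
  rho := (FundGroup.hom c.label c.label_rel d₀).comp (FundGroup.alpha L d₀).ker.subtype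
  frame i d := p.frame c.label c.label_rel ⟨i, d⟩
  rho_corner i d := by
    have h := p.hom_loop c.label c.label_rel
      (TEdge.short i d d.rev ((L.tri i).next d) rfl rfl)
    rw [p.loop_short] at h
    rw [MonoidHom.comp_apply, Subgroup.subtype_apply, coe_cornerLevel_kerCorner]
    exact h
  frame_rev i d := by
    have h := p.hom_loop c.label c.label_rel (TEdge.long i d d.rev rfl)
    rw [p.loop_long, map_one] at h
    exact (mul_inv_eq_one.1 h.symm).symm
  frame_up i d hd := by
    have h := p.hom_loop c.label c.label_rel (TEdge.up i d hd)
    rw [p.loop_up, map_one] at h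
    exact (mul_inv_eq_one.1 h.symm).symm.trans (mul_one _)
  conj := (MulAut.conjNormal s).toMonoidHom
  stable := FundGroup.hom c.label c.label_rel d₀ s
  rho_conj g := by
    change FundGroup.hom c.label c.label_rel d₀ (MulAut.conjNormal s g : FundGroup L d₀) = _
    rw [MulAut.conjNormal_apply, map_mul, map_mul, map_inv]
    rfl
  closing d := ⟨p.closing d * s⁻¹, by
    rw [MonoidHom.mem_ker, map_mul, map_inv, p.alpha_closing, hs, mul_inv_cancel]⟩
  closing_rev d := Subtype.ext (congrArg (· * s⁻¹) (p.closing_rev d))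
  closing_corner d := by
    apply Subtype.ext
    rw [coe_cornerLevel_kerCorner]
    change _ = p.closing d.rev * s⁻¹ * (MulAut.conjNormal s (p.kerCorner d) : FundGroup L d₀) *
      (p.closing ((L.tri 0).next d) * s⁻¹)⁻¹
    rw [MulAut.conjNormal_apply]
    rw [eq_mul_inv_of_mul_eq (p.closing_corner d).symm]
    change _ = p.closing d.rev * s⁻¹ * (s * p.corner d * s⁻¹) * _
    group
  rho_closing d := by
    have h := p.hom_loop c.label c.label_rel (TEdge.close d _ rfl)
    rw [p.loop_close] at h
    change FundGroup.hom c.label c.label_rel d₀ (p.closing d * s⁻¹) *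
      FundGroup.hom c.label c.label_rel d₀ s = _
    rw [← map_mul, inv_mul_cancel_right, h]
    exact congrArg (· * _) (mul_one _)

end BasePaths

namespace FundGroup

variable {n : ℕ} {L : LayeredTriangulation n} {σ : BoundarySign L} {d₀ : Dart n}
  (c : PtolemyAssignment L σ)

/-- The monodromy matrix of Fox derivatives of a fibre presentation has the characteristic
polynomial of the flips, up to the contribution of the coboundaries. -/
theorem charpoly_monodromy {m : ℕ} {gen : Option (Fin m) → FundGroup L d₀}
    {rel : Fin m → FreeGroup (Option (Fin m))}
    (hp : IsFibrePresentation (FundGroup.alpha L d₀) gen rel) :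
    (hp.monodromy (symSq.comp (FundGroup.hom c.label c.label_rel d₀))).charpoly =
      (topJacobian L σ (c.val 0)).charpoly *
        ((symSq.comp (FundGroup.hom c.label c.label_rel d₀)) (gen none)⁻¹).charpoly := by
  obtain ⟨p⟩ := nonempty_basePaths L d₀
  let D := p.fibreFrame c (gen none) hp.alpha_none
  let x : Fin m → (FundGroup.alpha L d₀).ker := fun i => ⟨gen (some i), by
    have := hp.alpha_lift (FreeGroup.of i)
    rwa [FreeGroup.lift_apply_of] at this⟩
  have hx : ∀ u, ((FreeGroup.lift x u : (FundGroup.alpha L d₀).ker) : FundGroup L d₀) =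
      FreeGroup.lift (fun i => gen (some i)) u := fun u => by
    have : (FundGroup.alpha L d₀).ker.subtype.comp (FreeGroup.lift x) =
        FreeGroup.lift (fun i => gen (some i)) := FreeGroup.ext_hom _ _ fun i => by simp [x]
    exact DFunLike.congr_fun this u
  have hbij : Function.Bijective (FreeGroup.lift x) := by
    refine ⟨fun u v h => hp.injective ?_, fun g => ?_⟩
    · rw [← hx, ← hx, h]
    · have hg : (g : FundGroup L d₀) ∈ (FreeGroup.lift fun i => gen (some i)).range := by
        rw [hp.range_eq]; exact g.2
      obtain ⟨u, hu⟩ := hg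
      exact ⟨u, Subtype.ext ((hx u).trans hu)⟩
  have hfd : FiniteDimensional ℂ D.crossed := D.finiteDimensional_crossed hbij
  have hm := BasePaths.le_of_range_eq _ hp.range_eq
  have h1 := D.charpoly_crossedMonodromy_eq hbij hp.word fun i => Subtype.ext <| by
    rw [hx, hp.lift_word]
    rfl
  -- The rank of the fibre group is at least `n + 1`, so the twisted cocycles fill up all graded
  -- pieces of the filtration.
  have h2 := D.charpoly_crossedMonodromy (by rw [D.finrank_crossed hbij]; omega)
  have h3 : ∀ l w, foxMatrix (symSq.comp D.rho) x l w =
      foxMatrix (symSq.comp (FundGroup.hom c.label c.label_rel d₀))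
        (fun i => gen (some i)) l w := by
    intro l w
    have : (symSq.comp D.rho).comp (FreeGroup.lift x) =
        (symSq.comp (FundGroup.hom c.label c.label_rel d₀)).comp
          (FreeGroup.lift fun i => gen (some i)) :=
      MonoidHom.ext fun u => congrArg
        (fun g => symSq (FundGroup.hom c.label c.label_rel d₀ g)) (hx u)
    rw [foxMatrix, foxMatrix, this]
  have h4 : D.stable⁻¹ = FundGroup.hom c.label c.label_rel d₀ (gen none)⁻¹ :=
    (map_inv (FundGroup.hom c.label c.label_rel d₀) (gen none)).symm
  rw [h2, h4] at h1
  simp only [h3] at h1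
  rw [c.topJacobian_charpoly, MonoidHom.comp_apply, ← Matrix.charpoly_toLin' (symSq _)]
  exact h1

/-- The characteristic polynomial of the Jacobian matrix is the twisted Alexander polynomial of the
second symmetric power of the representation of a Ptolemy assignment. -/
theorem isTwistedAlexanderPolynomial :
    IsTwistedAlexanderPolynomial (symSq.comp (FundGroup.hom c.label c.label_rel d₀))
      (FundGroup.alpha L d₀) (Matrix.det ((LaurentPolynomial.T 1 : ℂ[T;T⁻¹]) • 1 -
        (topJacobian L σ (c.val 0)).map LaurentPolynomial.C)) := by
  rw [det_T_sub]
  constructor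
  · obtain ⟨p⟩ := nonempty_basePaths L d₀
    obtain ⟨m, x, hinj, hrange⟩ := BasePaths.exists_basis L d₀
    exact ⟨m, exists_isFibrePresentation _ (p.closing d₀) (p.alpha_closing d₀) x hinj hrange⟩
  · intro m gen rel hp
    exact hp.hasWadaInvariant _ (det_symSq _) (fun g _ => det_one_sub_symSq _) _
      (charpoly_monodromy c hp)

end FundGroup

theorem mainTheorem2 {n : ℕ} (L : LayeredTriangulation n) (σ : BoundarySign L)
    (c : PtolemyAssignment L σ) (d₀ : Dart n)
    (hirr : (stdRep (c.rho d₀)).IsIrreducible) :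
    DifferentiableAt ℂ (topVars L σ) (c.val 0) ∧
      IsTwistedAlexanderPolynomial (symSq.comp (c.rho d₀)) (TGroup.alpha L d₀)
        (Matrix.det ((LaurentPolynomial.T 1 : ℂ[T;T⁻¹]) • 1 -
          (topJacobian L σ (c.val 0)).map LaurentPolynomial.C)) :=
  ⟨c.hasFDerivAt_topVars.differentiableAt, FundGroup.isTwistedAlexanderPolynomial c⟩
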